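/- **Setting.** Let $K\ge 1$ agents have sample losses $Q_k(z;\xi)$, $z=\mathrm{col}\{x,y\}\in\mathbb R^{M_1}\times\mathbb R^{M_2}$, twice differentiable in $z$, local costs $J_k(z)=\mathbb E_{\xi\sim\mathcal D_k}Q_k(z;\xi)$, global cost $J=\frac1K\sum_kJ_k$, and let $P(x)=\max_yJ(x,y)$ (the maximum is attained), $P^\star=\inf_xP(x)$. Norms are $\ell_2$ (spectral for matrices). Assume: (1) each $J_k$ is $C^2$, $\nabla J_k$ is $L_f$-Lipschitz and $\nabla^2J_k$ is $L_h$-Lipschitz; (2) for all $z$ and $k$: $\mathbb E\nabla Q_k(z;\xi)=\nabla J_k(z)$, $\mathbb E\nabla^2Q_k(z;\xi)=\nabla^2J_k(z)$, $\mathbb E\|\nabla Q_k(z;\xi)-\nabla J_k(z)\|^2\le\sigma^2$, $\mathbb E\|\nabla^2Q_k(z;\xi)-\nabla^2J_k(z)\|^2\le\sigma_h^2$, where $\xi\sim\mathcal D_k$; (3) $\|\nabla_yJ(x,y)\|^2\ge2\nu(P(x)-J(x,y))$ with $\nu>0$, $P^\star>-\infty$, and $\kappa:=L_f/\nu\ge1$;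 (4) $A=[a_{k\ell}]\in\mathbb R^{K\times K}$ is primitive and doubly stochastic, and $\lambda:=\|A-\mathbf 1\mathbf 1^\top/K\|<1$. **Algorithm (Local-DiMA).** Parameters $\mu_x,\mu_y,\bar\mu_x,\bar\mu_y,\beta$ and $N\ge1$; $0/\|0\|:=0$. All samples $\xi_{k,-1},\xi_{k,i,n}\sim\mathcal D_k$ are independent. Start with $z_{k,0}=z_0=(x_0,y_0)$, $z_{k,-1}=z_{-1}=(x_{-1},y_{-1})$ for all $k$, where $\|x_0-x_{-1}\|\le\mu_x$, $\|y_0-y_{-1}\|\le\mu_y$ (e.g. $z_{-1}=z_0$), and $u_{k,-1}=m_{k,-1}=\nabla Q_k(z_{-1};\xi_{k,-1})$. In round $i=0,1,\dots$ each agent $k$ sets $z_{k,i,0}=z_{k,i}$ and, for $0\le n<N$, $g_{k,i,n}=\nabla Q_k(z_{k,i,n};\xi_{k,i,n})$, $x_{k,i,n+1}=x_{k,i,n}-\bar\mu_xg^x_{k,i,n}/\|g^x_{k,i,n}\|$, $y_{k,i,n+1}=y_{k,i,n}+\bar\mu_yg^y_{k,i,n}/\|g^y_{k,i,n}\|$;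 then $g_{k,i}=\frac1N\sum_ng_{k,i,n}$, $h_{k,i}=\frac1N\sum_n\nabla^2Q_k(z_{k,i};\xi_{k,i,n})(z_{k,i}-z_{k,i-1})$, $m_{k,i}=(1-\beta)(m_{k,i-1}+h_{k,i})+\beta g_{k,i}$, $u_{k,i}=\sum_\ell a_{k\ell}(u_{\ell,i-1}+m_{\ell,i}-m_{\ell,i-1})$, $x_{k,i+1}=\sum_\ell a_{k\ell}(x_{\ell,i}-\mu_xu^x_{\ell,i}/\|u^x_{\ell,i}\|)$, $y_{k,i+1}=\sum_\ell a_{k\ell}(y_{\ell,i}+\mu_yu^y_{\ell,i}/\|u^y_{\ell,i}\|)$. Let $x_{c,i},y_{c,i}$ be the averages of $x_{k,i},y_{k,i}$ over $k$ (index $c$ always denotes this average) and $$\mathcal S_T=\frac1T\sum_{i=0}^{T-1}\mathbb E\big[\|\nabla_xJ(x_{c,i},y_{c,i})\|+\|\nabla_yJ(x_{c,i},y_{c,i})\|\big].$$ **Theorem.** Let $T\ge1$, $0<\mu_x\le\mu_y/(6\kappa)$, $0<\bar\mu_x\le\bar\mu_y$ and $\beta>0$. The expectations in $\mathcal S_T$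 are finite, and the following hold. (i) *Explicit bound.* If $\beta<1$, then, with $L=L_f+L_f\kappa/2$ and $\Delta_{0}=P(x_0)-J(x_0,y_0)$, $$\begin{aligned}\mathcal S_T\le{}&\tfrac{3(\Omega_0-P^\star)}{\mu_xT}+\tfrac{72\kappa\Delta_0}{\mu_yT}+3(Q_4+Q_5)+\tfrac{3L\mu_x}2+\tfrac{225\kappa\sigma}{\sqrt KT\beta}+225\kappa Q_6+\tfrac{450\kappa}{(1-\lambda)\sqrt K}Q_1\\&+\tfrac{450\kappa\lambda}{(1-\lambda)\sqrt K}Q_2+24L_f\big(\tfrac{3\kappa\mu_y}2+\tfrac{\mu_x}4+\tfrac{19\kappa\mu_x}2+\mu_y\big),\end{aligned}$$ where $Q_2=\frac{2\sqrt K\sigma_h\mu_y}{\sqrt N}+3KL_h\mu_y^2+\frac{\sqrt K\sigma}{\sqrt N}\beta+\sqrt KNL_f\bar\mu_y\beta$, $Q_1=\lambda(Q_2+2\sqrt KL_f\mu_y)$, $Q_3=\frac{\sigma_h}{\sqrt N}+L_f$, $Q_4=\big(3L_f+\frac{75\kappa L_f}{1-\lambda}+\frac{300\kappa\lambda Q_3}{(1-\lambda)^2}+\frac{300\kappa\lambda\sigma_h}{(1-\lambda)^2\sqrt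 N}+72L_f\kappa+\frac{150\kappa\lambda Q_3}{1-\lambda}+\frac{150\kappa\lambda\sigma_h}{(1-\lambda)\sqrt N}\big)4\lambda\mu_y$, $Q_5=\frac{2700\kappa L_h\lambda}{(1-\lambda)^2\sqrt K}\cdot\frac{8\lambda^2K\mu_y^2}{1-\lambda}$, $Q_6=\frac{48L_h\mu_y^2}{(1-\lambda)^2\beta}+\frac{3L_h\mu_y^2}\beta+\frac{7\sigma_h\mu_y}{(1-\lambda)\sqrt{NK\beta}}+\frac{3\sigma_h\mu_y}{\sqrt{NK\beta}}+\frac{\sqrt\beta\sigma}{\sqrt{NK}}+NL_f\bar\mu_y$, and $$\begin{aligned}\Omega_0=\mathbb E\Big[&P(x_{c,0})+\tfrac{A_c}{\sqrt K}\Xi_{-1}+\tfrac{\bar A_c}K\Xi^2_{-1}+\sum_{w\in\{x,y\}}\Big(B_w\big(\textstyle\sum_k\|u^w_{k,-1}-u^w_{c,-1}\|^2\big)^{1/2}+C_w\big(\textstyle\sum_k\|m^w_{k,-1}-\nabla_wJ_k(z_{-1})\|^2\big)^{1/2}\Big)\\&+D\,\mathrm{dist}\big(y_{c,0},\operatorname{argmax}_yJ(x_{c,0},y)\big)\Big],\end{aligned}$$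 with $\Xi_{-1}=\sum_{w\in\{x,y\}}(\sum_k\|w_{k,-1}-w_{c,-1}\|^2)^{1/2}$ and $\Xi^2_{-1}=\sum_{w\in\{x,y\}}\sum_k\|w_{k,-1}-w_{c,-1}\|^2$ (both zero for the common start), $A_c=\frac{75\kappa L_f\mu_x}{1-\lambda}+\frac{300\kappa\lambda Q_3\mu_x}{(1-\lambda)^2}+\frac{300\kappa\lambda\sigma_h\mu_x}{(1-\lambda)^2\sqrt N}$, $\bar A_c=\frac{1800\kappa L_h\lambda\mu_x\sqrt K}{(1-\lambda)^2}$, $B_x=\frac{3\mu_x\lambda}{(1-\lambda)\sqrt K}$, $B_y=\frac{72\kappa\lambda\mu_x}{(1-\lambda)\sqrt K}$, $C_x=\frac{6\mu_x\lambda}{(1-\lambda)\sqrt K}$, $C_y=\frac{144\kappa\lambda\mu_x}{(1-\lambda)\sqrt K}$, $D=8L_f\mu_x$. For (ii) and (iii) fix $0<a\le b$ and $G$. Suppose $P(x_0)-P^\star\le G$, $\Delta_0\le G$, $\frac1K\sum_k\|\nabla J_k(z_{-1})-\nabla J(z_{-1})\|^2\le G^2$ with $G\ge0$, that the three quantities $$\beta\Big/\frac{(NK)^{1/3}}{T^{2/3}},\qquad\mu_y\Big/\frac{(1-\lambda)^{1/2}(NK)^{1/3}}{T^{2/3}},\qquad\mu_x\Big/\frac{(1-\lambda)^{1/2}(NK)^{1/3}}{\kappa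 T^{2/3}}$$ lie in $[a,b]$, and that $\bar\mu_x=\mu_x/(NL_f)$, $\bar\mu_y=\mu_y/(NL_f)$. There are constants $C,C'>0$, depending only on $L_f,L_h,\sigma,\sigma_h,G,a,b$ (not on $\kappa,\lambda,N,K,T,\varepsilon$ or the dimensions), such that: (ii) *Rate.* If $\beta<1$ (which holds for all sufficiently large $T$), then $$\mathcal S_T\le C\Big(\frac{\kappa}{(1-\lambda)^{1/2}(NKT)^{1/3}}+\frac{\kappa(NK)^{1/3}}{(1-\lambda)^{3/2}T^{2/3}}\Big).$$ (iii) *Complexity.* Let $\varepsilon>0$. If $N=\Theta\big(\kappa\varepsilon^{-1}/((1-\lambda)^{3/2}K)\big)$, with constants $a$ (lower) and $b$ (upper), and $T\ge\frac{C'}{(1-\lambda)^3}\kappa^2\varepsilon^{-2}$, then $\beta<1$, $\mathcal S_T\le\varepsilon$, and for some $i<T$ the point $(x_{c,i},y_{c,i})$ is $\varepsilon$-game stationary, i.e. $\mathbb E\|\nabla_xJ(x_{c,i},y_{c,i})\|\le\varepsilon$ and $\mathbb E\|\nabla_yJ(x_{c,i},y_{c,i})\|\le\varepsilon$. Thus,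 for a fixed mixing rate, $O(\kappa^2\varepsilon^{-2})$ communication rounds suffice. -/

import Mathlib

open MeasureTheory ProbabilityTheory

noncomputable section

namespace LocalDiMA

/-! ### Vectors `z = col {x, y}`, gradients and Hessians -/

/-- The space `ℝ^{M₁} × ℝ^{M₂}` of concatenated vectors `z = col {x, y}`, with the `ℓ²` norm. -/
abbrev Vec (M₁ M₂ : ℕ) : Type :=
  WithLp 2 (EuclideanSpace ℝ (Fin M₁) × EuclideanSpace ℝ (Fin M₂))

variable {K M₁ M₂ : ℕ} {S : Type*}

/-- The concatenation `col {x, y}`. -/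
def col (x : EuclideanSpace ℝ (Fin M₁)) (y : EuclideanSpace ℝ (Fin M₂)) : Vec M₁ M₂ :=
  WithLp.toLp 2 (x, y)

/-- The block `∇_x f(x, y)` of the gradient `∇_z f = col {∇_x f, ∇_y f}`. -/
def gradX (f : Vec M₁ M₂ → ℝ) (z : Vec M₁ M₂) : EuclideanSpace ℝ (Fin M₁) :=
  (gradient f z).fst

/-- The block `∇_y f(x, y)` of the gradient `∇_z f = col {∇_x f, ∇_y f}`. -/
def gradY (f : Vec M₁ M₂ → ℝ) (z : Vec M₁ M₂) : EuclideanSpace ℝ (Fin M₂) :=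
  (gradient f z).snd

/-- The Hessian `∇²_z f(z)`, as a linear operator (its norm is the spectral norm). -/
def hess (f : Vec M₁ M₂ → ℝ) (z : Vec M₁ M₂) : Vec M₁ M₂ →L[ℝ] Vec M₁ M₂ :=
  fderiv ℝ (gradient f) z

/-- The stochastic Hessian-vector product `∇²_z f(z₁) (z₁ - z₂)` of a sample loss `f`. -/
def hvp (f : Vec M₁ M₂ → ℝ) (z₁ z₂ : Vec M₁ M₂) : Vec M₁ M₂ :=
  hess f z₁ (z₁ - z₂)

/-! ### The minimax problem -/

/-- The local cost `J_k(z) = 𝔼_{ξ ∼ 𝒟_k} Q_k(z; ξ)`. -/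
def localCost [MeasurableSpace S] (Q : Fin K → Vec M₁ M₂ → S → ℝ) (𝒟 : Fin K → Measure S)
    (k : Fin K) (z : Vec M₁ M₂) : ℝ :=
  ∫ s, Q k z s ∂(𝒟 k)

/-- The global cost `J = (1/K) ∑ₖ J_k`. -/
def globalCost [MeasurableSpace S] (Q : Fin K → Vec M₁ M₂ → S → ℝ) (𝒟 : Fin K → Measure S)
    (z : Vec M₁ M₂) : ℝ :=
  (K : ℝ)⁻¹ * ∑ k, localCost Q 𝒟 k z

/-- The envelope `P(x) = max_y J(x, y)`. -/
def envelope (J : Vec M₁ M₂ → ℝ) (x : EuclideanSpace ℝ (Fin M₁)) : ℝ :=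
  ⨆ y, J (col x y)

/-- The optimal value `P⋆ = inf_x P(x)`. -/
def optValue (J : Vec M₁ M₂ → ℝ) : ℝ := ⨅ x, envelope J x

/-- The set of maximum points of `J(x, ·)`. -/
def argmaxSet (J : Vec M₁ M₂ → ℝ) (x : EuclideanSpace ℝ (Fin M₁)) :
    Set (EuclideanSpace ℝ (Fin M₂)) :=
  {y | ∀ y', J (col x y') ≤ J (col x y)}

/-- The numerical constants of the assumptions. -/
structure Constants where
  /-- gradient Lipschitz constant -/
  Lf : ℝ
  /-- Hessian Lipschitz constant -/
  Lh : ℝ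
  /-- standard deviation of the stochastic gradients -/
  σ : ℝ
  /-- standard deviation of the stochastic Hessians -/
  σh : ℝ
  /-- Polyak-Łojasiewicz constant -/
  ν : ℝ

/-- The condition number `κ = L_f / ν`. -/
def Constants.κ (c : Constants) : ℝ := c.Lf / c.ν

/-- The constant `L = L_f + L_f κ / 2`. -/
def Constants.L (c : Constants) : ℝ := c.Lf + c.Lf * c.κ / 2

/-- Lipschitz conditions: every local cost is twice continuously differentiable and
`L_f`-smooth, and its Hessian is `L_h`-Lipschitz. -/
structure LipschitzConditions (c : Constants) (J : Vec M₁ M₂ → ℝ) : Prop where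
  contDiff : ContDiff ℝ 2 J
  gradient_lipschitz : ∀ z w, ‖gradient J z - gradient J w‖ ≤ c.Lf * ‖z - w‖
  hess_lipschitz : ∀ z w, ‖hess J z - hess J w‖ ≤ c.Lh * ‖z - w‖

/-- The stochastic oracle of one agent: the sample losses `q(·; ξ)` are integrable and twice
differentiable, and the stochastic gradients and Hessians are unbiased with variances at most
`σ²` and `σ_h²`. -/
structure BoundedVariance [MeasurableSpace S] (c : Constants) (q : Vec M₁ M₂ → S → ℝ)
    (μ : Measure S) (J : Vec M₁ M₂ → ℝ) : Prop where
  measurable : ∀ z, Measurable (q z)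
  integrable : ∀ z, Integrable (q z) μ
  differentiable : ∀ s, Differentiable ℝ (fun z => q z s)
  gradient_differentiable : ∀ s, Differentiable ℝ (gradient (fun z => q z s))
  gradient_unbiased : ∀ z, ∫ s, gradient (fun w => q w s) z ∂μ = gradient J z
  hess_unbiased : ∀ z, ∫ s, hess (fun w => q w s) z ∂μ = hess J z
  gradient_variance : ∀ z,
    ∫⁻ s, ‖gradient (fun w => q w s) z - gradient J z‖ₑ ^ 2 ∂μ ≤ ENNReal.ofReal (c.σ ^ 2)
  hess_variance : ∀ z,
    ∫⁻ s, ‖hess (fun w => q w s) z - hess J z‖ₑ ^ 2 ∂μ ≤ ENNReal.ofReal (c.σh ^ 2)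

/-- Cost function: `J(x, ·)` has a maximum for every `x`, `-J` is `ν`-PL in `y`, and the envelope
`P` is bounded below. -/
structure CostConditions (c : Constants) (J : Vec M₁ M₂ → ℝ) : Prop where
  exists_max : ∀ x, (argmaxSet J x).Nonempty
  pl : ∀ x y, 2 * c.ν * (envelope J x - J (col x y)) ≤ ‖gradY J (col x y)‖ ^ 2
  bddBelow : BddBelow (Set.range (envelope J))

/-- The mixing rate `λ = ‖A - 𝟙 𝟙ᵀ / K‖` (spectral norm). -/
def mixingRate (A : Matrix (Fin K) (Fin K) ℝ) : ℝ :=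
  ‖Matrix.toEuclideanCLM (n := Fin K) (𝕜 := ℝ) (A - Matrix.of fun _ _ => (K : ℝ)⁻¹)‖

/-- Mixing matrix: primitive and doubly stochastic, with mixing rate `λ < 1`. -/
structure MixingConditions (A : Matrix (Fin K) (Fin K) ℝ) : Prop where
  primitive : A.IsPrimitive
  doublyStochastic : A ∈ doublyStochastic ℝ (Fin K)
  mixingRate_lt_one : mixingRate A < 1

/-- The standing assumptions on the constants, the costs, the oracles and the network. -/
structure Assumptions [MeasurableSpace S] (c : Constants) (Q : Fin K → Vec M₁ M₂ → S → ℝ)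
    (𝒟 : Fin K → Measure S) (A : Matrix (Fin K) (Fin K) ℝ) : Prop where
  agents_pos : 0 < K
  Lh_nonneg : 0 ≤ c.Lh
  σ_nonneg : 0 ≤ c.σ
  σh_nonneg : 0 ≤ c.σh
  ν_pos : 0 < c.ν
  one_le_κ : 1 ≤ c.κ
  lipschitz : ∀ k, LipschitzConditions c (localCost Q 𝒟 k)
  oracle : ∀ k, BoundedVariance c (Q k) (𝒟 k) (localCost Q 𝒟 k)
  cost : CostConditions c (globalCost Q 𝒟)
  mixing : MixingConditions A

/-- A random point `w` is `ε`-game stationary for `J`: `𝔼‖∇_x J(w)‖ ≤ ε` and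
`𝔼‖∇_y J(w)‖ ≤ ε`. -/
def IsGameStationary {Ω : Type*} [MeasurableSpace Ω] (P : Measure Ω) (J : Vec M₁ M₂ → ℝ) (ε : ℝ)
    (w : Ω → Vec M₁ M₂) : Prop :=
  Integrable (fun ω => ‖gradX J (w ω)‖) P ∧ Integrable (fun ω => ‖gradY J (w ω)‖) P ∧
    ∫ ω, ‖gradX J (w ω)‖ ∂P ≤ ε ∧ ∫ ω, ‖gradY J (w ω)‖ ∂P ≤ ε

/-! ### The algorithm Local-DiMA -/

/-- Parameters: step sizes `μ_x, μ_y` of the diffusion step, step sizes `μ̄_x, μ̄_y` of the local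
steps, smoothing factor `β`, momentum-correction switch `γ ∈ {0, 1}`, number `N` of local steps. -/
structure Params where
  μx : ℝ
  μy : ℝ
  μbx : ℝ
  μby : ℝ
  β : ℝ
  γ : ℝ
  N : ℕ

/-- One normalized descent-ascent step from `z = col {x, y}` along `v = col {v_x, v_y}`:
`x - a v_x / ‖v_x‖` and `y + b v_y / ‖v_y‖`, where `0 / ‖0‖ = 0`. -/
def normalizedStep (a b : ℝ) (z v : Vec M₁ M₂) : Vec M₁ M₂ :=
  col (z.fst - a • ((‖v.fst‖)⁻¹ • v.fst)) (z.snd + b • ((‖v.snd‖)⁻¹ • v.snd))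

/-- The local iterates `z_{k,i,n}` of an agent with sample loss `q`, started at `z` and run with
the samples `s 0, s 1, …`. -/
def localIterate (p : Params) (q : Vec M₁ M₂ → S → ℝ) (s : ℕ → S) (z : Vec M₁ M₂) :
    ℕ → Vec M₁ M₂
  | 0 => z
  | n + 1 =>
    normalizedStep p.μbx p.μby (localIterate p q s z n)
      (gradient (fun w => q w (s n)) (localIterate p q s z n))

/-- The accumulated stochastic gradient `g_{k,i}`. -/
def localGrad (p : Params) (q : Vec M₁ M₂ → S → ℝ) (s : ℕ → S) (z : Vec M₁ M₂) : Vec M₁ M₂ :=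
  (p.N : ℝ)⁻¹ • ∑ n ∈ Finset.range p.N,
    gradient (fun w => q w (s n)) (localIterate p q s z n)

/-- The accumulated momentum correction `h_{k,i}`, at the points `z = z_{k,i}` and
`z' = z_{k,i-1}`. -/
def localCorrection (p : Params) (q : Vec M₁ M₂ → S → ℝ) (s : ℕ → S) (z z' : Vec M₁ M₂) :
    Vec M₁ M₂ :=
  (p.N : ℝ)⁻¹ • ∑ n ∈ Finset.range p.N, hvp (fun w => q w (s n)) z z'

/-- The state of the network at the beginning of communication round `i`. -/
structure State (K M₁ M₂ : ℕ) where
  /-- the iterates `z_{k,i}` -/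
  z : Fin K → Vec M₁ M₂
  /-- the previous iterates `z_{k,i-1}` -/
  zPrev : Fin K → Vec M₁ M₂
  /-- the momenta `m_{k,i-1}` -/
  m : Fin K → Vec M₁ M₂
  /-- the tracking variables `u_{k,i-1}` -/
  u : Fin K → Vec M₁ M₂

/-- The updated momentum `m_{k,i} = (1 - β) (m_{k,i-1} + γ h_{k,i}) + β g_{k,i}`; here `s k n` is
the sample of agent `k` in local step `n`. -/
def newMomentum (p : Params) (Q : Fin K → Vec M₁ M₂ → S → ℝ) (s : Fin K → ℕ → S)
    (σ : State K M₁ M₂) (k : Fin K) : Vec M₁ M₂ :=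
  (1 - p.β) • (σ.m k + p.γ • localCorrection p (Q k) (s k) (σ.z k) (σ.zPrev k))
    + p.β • localGrad p (Q k) (s k) (σ.z k)

/-- Momentum tracking `u_{k,i} = ∑_ℓ a_{kℓ} (u_{ℓ,i-1} + m_{ℓ,i} - m_{ℓ,i-1})`. -/
def newTracking (p : Params) (Q : Fin K → Vec M₁ M₂ → S → ℝ) (A : Matrix (Fin K) (Fin K) ℝ)
    (s : Fin K → ℕ → S) (σ : State K M₁ M₂) (k : Fin K) : Vec M₁ M₂ :=
  ∑ l, A k l • (σ.u l + newMomentum p Q s σ l - σ.m l)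

/-- One communication round: local steps, momentum, tracking, and normalized diffusion
`x_{k,i+1} = ∑_ℓ a_{kℓ} (x_{ℓ,i} - μ_x u^x_{ℓ,i} / ‖u^x_{ℓ,i}‖)`,
`y_{k,i+1} = ∑_ℓ a_{kℓ} (y_{ℓ,i} + μ_y u^y_{ℓ,i} / ‖u^y_{ℓ,i}‖)`. -/
def communicationRound (p : Params) (Q : Fin K → Vec M₁ M₂ → S → ℝ)
    (A : Matrix (Fin K) (Fin K) ℝ) (s : Fin K → ℕ → S) (σ : State K M₁ M₂) : State K M₁ M₂ where
  z k := ∑ l, A k l • normalizedStep p.μx p.μy (σ.z l) (newTracking p Q A s σ l)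
  zPrev := σ.z
  m := newMomentum p Q s σ
  u := newTracking p Q A s σ

/-- The index set of the samples: `(k, none)` is the sample with which agent `k` initializes its
momentum, `(k, some (i, n))` is the sample of agent `k` in local step `n` of round `i`. -/
abbrev SampleIndex (K : ℕ) : Type := Fin K × Option (ℕ × ℕ)

/-- The run of Local-DiMA along a realization `s` of the samples. All agents start from the common
points `z₀ = col {x₀, y₀}` and `zm = col {x₋₁, y₋₁}`; the momenta and tracking variables are
initialized by `u_{k,-1} = m_{k,-1} = ∇Q_k(zm; ξ_{k,-1})`. -/
def run (p : Params) (Q : Fin K → Vec M₁ M₂ → S → ℝ) (A : Matrix (Fin K) (Fin K) ℝ)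
    (z₀ zm : Vec M₁ M₂) (s : SampleIndex K → S) : ℕ → State K M₁ M₂
  | 0 =>
    { z := fun _ => z₀
      zPrev := fun _ => zm
      m := fun k => gradient (fun w => Q k w (s (k, none))) zm
      u := fun k => gradient (fun w => Q k w (s (k, none))) zm }
  | i + 1 =>
    communicationRound p Q A (fun k n => s (k, some (i, n))) (run p Q A z₀ zm s i)

/-- The samples are independent (over agents, rounds and local steps), those of agent `k` being
distributed according to `𝒟 k`. -/
structure IsSampling {Ω : Type*} [MeasurableSpace S] [MeasurableSpace Ω] (P : Measure Ω)
    (𝒟 : Fin K → Measure S) (ξ : SampleIndex K → Ω → S) : Prop where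
  measurable : ∀ j, Measurable (ξ j)
  law : ∀ j, P.map (ξ j) = 𝒟 j.1
  indep : iIndepFun ξ P

/-- The network average `(1/K) ∑ₖ v_k`. -/
def centroid {V : Type*} [AddCommGroup V] [Module ℝ V] (v : Fin K → V) : V :=
  (K : ℝ)⁻¹ • ∑ k, v k

/-- The centroid `(x_{c,i}, y_{c,i})` of the iterates at round `i`. -/
def centroidIterate (p : Params) (Q : Fin K → Vec M₁ M₂ → S → ℝ) (A : Matrix (Fin K) (Fin K) ℝ)
    (z₀ zm : Vec M₁ M₂) (s : SampleIndex K → S) (i : ℕ) : Vec M₁ M₂ :=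
  centroid (run p Q A z₀ zm s i).z

/-- `‖∇_x J(x_c, y_c)‖ + ‖∇_y J(x_c, y_c)‖` at a point. -/
def gradNorms (J : Vec M₁ M₂ → ℝ) (z : Vec M₁ M₂) : ℝ := ‖gradX J z‖ + ‖gradY J z‖

/-- The averaged expected game-stationarity measure at the centroids,
`(1/T) ∑_{i<T} 𝔼[‖∇_x J(x_{c,i}, y_{c,i})‖ + ‖∇_y J(x_{c,i}, y_{c,i})‖]`. -/
def avgMeasure {Ω : Type*} [MeasurableSpace S] [MeasurableSpace Ω] (P : Measure Ω)
    (p : Params) (Q : Fin K → Vec M₁ M₂ → S → ℝ) (𝒟 : Fin K → Measure S)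
    (A : Matrix (Fin K) (Fin K) ℝ) (z₀ zm : Vec M₁ M₂) (ξ : SampleIndex K → Ω → S) (T : ℕ) : ℝ :=
  (T : ℝ)⁻¹ * ∑ i ∈ Finset.range T,
    ∫ ω, gradNorms (globalCost Q 𝒟) (centroidIterate p Q A z₀ zm (fun j => ξ j ω) i) ∂P

/-! ### The explicit bound -/

/-- The `ℓ²` norm of the network vector `col {v_1, …, v_K}`. -/
def netNorm {V : Type*} [NormedAddCommGroup V] (v : Fin K → V) : ℝ := √(∑ k, ‖v k‖ ^ 2)

/-- The distance of the network vector `col {v_1, …, v_K}` to its centroid. -/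
def consensusError {V : Type*} [NormedAddCommGroup V] [Module ℝ V] (v : Fin K → V) : ℝ :=
  netNorm fun k => v k - centroid v

/-- `Q₃ = σ_h / √N + L_f`. -/
def Q₃ (c : Constants) (p : Params) : ℝ := c.σh / √p.N + c.Lf

/-- `Q₂`. -/
def Q₂ (c : Constants) (p : Params) (K : ℕ) : ℝ :=
  2 * √K * c.σh * p.μy / √p.N + 3 * K * c.Lh * p.μy ^ 2 + √K * c.σ / √p.N * p.β
    + √K * p.N * c.Lf * p.μby * p.β

/-- `Q₁`. -/
def Q₁ (c : Constants) (p : Params) (K : ℕ) (lam : ℝ) : ℝ :=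
  lam * (2 * √K * c.σh * p.μy / √p.N + 3 * K * c.Lh * p.μy ^ 2 + √K * c.σ / √p.N * p.β
    + √K * p.N * c.Lf * p.μby * p.β + 2 * √K * c.Lf * p.μy)

/-- `Q₄`. -/
def Q₄ (c : Constants) (p : Params) (lam : ℝ) : ℝ :=
  (3 * c.Lf + 75 * c.κ * c.Lf / (1 - lam) + 300 * c.κ * lam * Q₃ c p / (1 - lam) ^ 2
    + 300 * c.κ * lam * c.σh / ((1 - lam) ^ 2 * √p.N) + 72 * c.Lf * c.κ
    + 150 * c.κ * lam * Q₃ c p / (1 - lam) + 150 * c.κ * lam * c.σh / ((1 - lam) * √p.N))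
    * (4 * lam * p.μy)

/-- `Q₅`. -/
def Q₅ (c : Constants) (p : Params) (K : ℕ) (lam : ℝ) : ℝ :=
  2700 * c.κ * c.Lh * lam / ((1 - lam) ^ 2 * √K) * (8 * lam ^ 2 * K * p.μy ^ 2 / (1 - lam))

/-- `Q₆`. -/
def Q₆ (c : Constants) (p : Params) (K : ℕ) (lam : ℝ) : ℝ :=
  48 * c.Lh * p.μy ^ 2 / ((1 - lam) ^ 2 * p.β) + 3 * c.Lh * p.μy ^ 2 / p.β
    + 7 * c.σh * p.μy / ((1 - lam) * √(p.N * K * p.β)) + 3 * c.σh * p.μy / √(p.N * K * p.β)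
    + √p.β * c.σ / √(p.N * K) + p.N * c.Lf * p.μby

/-- The coefficient `A_c` of the potential function. -/
def coefA (c : Constants) (p : Params) (lam : ℝ) : ℝ :=
  75 * c.κ * c.Lf * p.μx / (1 - lam) + 300 * c.κ * lam * Q₃ c p * p.μx / (1 - lam) ^ 2
    + 300 * c.κ * lam * c.σh * p.μx / ((1 - lam) ^ 2 * √p.N)

/-- The coefficient `Ā_c` of the potential function. -/
def coefAbar (c : Constants) (p : Params) (K : ℕ) (lam : ℝ) : ℝ :=
  1800 * c.κ * c.Lh * lam * p.μx * √K / (1 - lam) ^ 2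

/-- The coefficient `B_x` of the potential function. -/
def coefBx (p : Params) (K : ℕ) (lam : ℝ) : ℝ := 3 * p.μx * lam / ((1 - lam) * √K)

/-- The coefficient `B_y` of the potential function. -/
def coefBy (c : Constants) (p : Params) (K : ℕ) (lam : ℝ) : ℝ :=
  72 * c.κ * lam * p.μx / ((1 - lam) * √K)

/-- The coefficient `C_x` of the potential function. -/
def coefCx (p : Params) (K : ℕ) (lam : ℝ) : ℝ := 6 * p.μx * lam / ((1 - lam) * √K)

/-- The coefficient `C_y` of the potential function. -/
def coefCy (c : Constants) (p : Params) (K : ℕ) (lam : ℝ) : ℝ :=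
  144 * c.κ * lam * p.μx / ((1 - lam) * √K)

/-- The coefficient `D` of the potential function. -/
def coefD (c : Constants) (p : Params) : ℝ := 8 * c.Lf * p.μx

/-- The random variable whose expectation is the potential function: for the state of round `i`,
`P(x_{c,i}) + (A_c/√K) Ξ_{i-1} + (Ā_c/K) Ξ²_{i-1} + B_x ‖𝒰^x_{c,i-1} - 𝒰^x_{i-1}‖
+ B_y ‖𝒰^y_{c,i-1} - 𝒰^y_{i-1}‖ + C_x ‖ℳ^x_{i-1} - col {∇_x J_k(z_{k,i-1})}‖
+ C_y ‖ℳ^y_{i-1} - col {∇_y J_k(z_{k,i-1})}‖ + D dist(y_{c,i}, argmax_y J(x_{c,i}, y))`. -/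
def potentialOf [MeasurableSpace S] (c : Constants) (p : Params) (Q : Fin K → Vec M₁ M₂ → S → ℝ)
    (𝒟 : Fin K → Measure S) (lam : ℝ) (σ : State K M₁ M₂) : ℝ :=
  envelope (globalCost Q 𝒟) (centroid σ.z).fst
    + coefA c p lam / √K *
      (consensusError (fun k => (σ.zPrev k).fst) + consensusError (fun k => (σ.zPrev k).snd))
    + coefAbar c p K lam / K * (consensusError (fun k => (σ.zPrev k).fst) ^ 2
      + consensusError (fun k => (σ.zPrev k).snd) ^ 2)
    + coefBx p K lam * consensusError (fun k => (σ.u k).fst)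
    + coefBy c p K lam * consensusError (fun k => (σ.u k).snd)
    + coefCx p K lam * netNorm (fun k => (σ.m k).fst - gradX (localCost Q 𝒟 k) (σ.zPrev k))
    + coefCy c p K lam * netNorm (fun k => (σ.m k).snd - gradY (localCost Q 𝒟 k) (σ.zPrev k))
    + coefD c p *
      Metric.infDist (centroid σ.z).snd (argmaxSet (globalCost Q 𝒟) (centroid σ.z).fst)

/-- The initial potential `Ω₀`. -/
def initialPotential {Ω : Type*} [MeasurableSpace S] [MeasurableSpace Ω] (P : Measure Ω)
    (c : Constants) (p : Params) (Q : Fin K → Vec M₁ M₂ → S → ℝ) (𝒟 : Fin K → Measure S)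
    (A : Matrix (Fin K) (Fin K) ℝ) (z₀ zm : Vec M₁ M₂) (ξ : SampleIndex K → Ω → S) : ℝ :=
  ∫ ω, potentialOf c p Q 𝒟 (mixingRate A) (run p Q A z₀ zm (fun j => ξ j ω) 0) ∂P

/-- The initial gap `Δ_{c,0} = P(x₀) - J(x₀, y₀)`. -/
def initialGap (J : Vec M₁ M₂ → ℝ) (z₀ : Vec M₁ M₂) : ℝ := envelope J z₀.fst - J z₀

/-- The explicit bound on the averaged measure, in terms of the value `Ω₀` of the initial
potential, the optimal value `P⋆` and the initial gap `Δ₀`. -/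
def explicitBound (c : Constants) (p : Params) (K T : ℕ) (lam Ω₀ Pstar Δ₀ : ℝ) : ℝ :=
  3 * (Ω₀ - Pstar) / (p.μx * T) + 72 * c.κ * Δ₀ / (p.μy * T)
    + 3 * (Q₄ c p lam + Q₅ c p K lam) + 3 * c.L * p.μx / 2
    + 225 * c.κ * c.σ / (√K * T * p.β) + 225 * c.κ * Q₆ c p K lam
    + 450 * c.κ / ((1 - lam) * √K) * Q₁ c p K lam
    + 450 * c.κ * lam / ((1 - lam) * √K) * Q₂ c p K
    + 24 * c.Lf * (3 * c.κ * p.μy / 2 + p.μx / 4 + 19 * c.κ * p.μx / 2 + p.μy)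

/-! ### Choice of the parameters -/

/-- The conditions on the parameters other than `β < 1`: positive step sizes,
`μ_x ≤ μ_y / (6κ)`, `μ̄_x ≤ μ̄_y`, `0 < β`, active momentum correction, at least one local step. -/
structure StepConditions (c : Constants) (p : Params) : Prop where
  μx_pos : 0 < p.μx
  μx_le : p.μx ≤ p.μy / (6 * c.κ)
  μbx_pos : 0 < p.μbx
  μbx_le : p.μbx ≤ p.μby
  β_pos : 0 < p.β
  γ_eq : p.γ = 1
  N_pos : 0 < p.N

/-- The initial displacement between the two starting points is at most one diffusion step. In
particular this holds if they coincide. -/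
structure CloseStart (p : Params) (z₀ zm : Vec M₁ M₂) : Prop where
  fst_le : ‖z₀.fst - zm.fst‖ ≤ p.μx
  snd_le : ‖z₀.snd - zm.snd‖ ≤ p.μy

/-- The tuning `β = Θ((NK)^{1/3} / T^{2/3})`, `μ_y = Θ((1-λ)^{1/2} (NK)^{1/3} / T^{2/3})`,
`μ_x = Θ((1-λ)^{1/2} (NK)^{1/3} / (κ T^{2/3}))`, `μ̄_x = μ_x / (N L_f)`, `μ̄_y = μ_y / (N L_f)`,
all `Θ` having the constants `a` and `b`. -/
structure Tuned (a b : ℝ) (c : Constants) (p : Params) (K T : ℕ) (lam : ℝ) : Prop where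
  β_mem : p.β ∈ Set.Icc (a * ((p.N * K : ℝ) ^ (1 / 3 : ℝ) / (T : ℝ) ^ (2 / 3 : ℝ)))
    (b * ((p.N * K : ℝ) ^ (1 / 3 : ℝ) / (T : ℝ) ^ (2 / 3 : ℝ)))
  μy_mem : p.μy ∈
    Set.Icc (a * ((1 - lam) ^ (1 / 2 : ℝ) * (p.N * K : ℝ) ^ (1 / 3 : ℝ) / (T : ℝ) ^ (2 / 3 : ℝ)))
    (b * ((1 - lam) ^ (1 / 2 : ℝ) * (p.N * K : ℝ) ^ (1 / 3 : ℝ) / (T : ℝ) ^ (2 / 3 : ℝ)))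
  μx_mem : p.μx ∈
    Set.Icc (a * ((1 - lam) ^ (1 / 2 : ℝ) * (p.N * K : ℝ) ^ (1 / 3 : ℝ)
      / (c.κ * (T : ℝ) ^ (2 / 3 : ℝ))))
    (b * ((1 - lam) ^ (1 / 2 : ℝ) * (p.N * K : ℝ) ^ (1 / 3 : ℝ) / (c.κ * (T : ℝ) ^ (2 / 3 : ℝ))))
  μbx_eq : p.μbx = p.μx / (p.N * c.Lf)
  μby_eq : p.μby = p.μy / (p.N * c.Lf)

/-- The initial quantities of the run are bounded by `G`: the gap `P(x₀) - P⋆`, the gap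
`P(x₀) - J(x₀, y₀)`, and the root-mean-square deviation of the local gradients from the global
gradient at the starting point `zm`. -/
structure InitialBound [MeasurableSpace S] (G : ℝ) (Q : Fin K → Vec M₁ M₂ → S → ℝ)
    (𝒟 : Fin K → Measure S) (z₀ zm : Vec M₁ M₂) : Prop where
  value_gap : envelope (globalCost Q 𝒟) z₀.fst - optValue (globalCost Q 𝒟) ≤ G
  dual_gap : initialGap (globalCost Q 𝒟) z₀ ≤ G
  heterogeneity :
    netNorm (fun k => gradient (localCost Q 𝒟 k) zm - gradient (globalCost Q 𝒟) zm) ≤ √K * G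

/-- The rate `κ / ((1-λ)^{1/2} (NKT)^{1/3}) + κ (NK)^{1/3} / ((1-λ)^{3/2} T^{2/3})`. -/
def rate (κ lam : ℝ) (N K T : ℕ) : ℝ :=
  κ / ((1 - lam) ^ (1 / 2 : ℝ) * (N * K * T : ℝ) ^ (1 / 3 : ℝ))
    + κ * (N * K : ℝ) ^ (1 / 3 : ℝ) / ((1 - lam) ^ (3 / 2 : ℝ) * (T : ℝ) ^ (2 / 3 : ℝ))

end LocalDiMA

end

noncomputable section

namespace LocalDiMA

/-! ### Network vectors: centroids, consensus errors and mixing -/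

section Network

variable {K : ℕ} {V : Type*} [NormedAddCommGroup V]

/-! The shape of the potential suggests a Lyapunov argument, but the potential is never propagated
from round to round. The stationarity measure is bounded along every realization of the samples, the
bounds are summed over the rounds, and expectations are taken only at the end.

One round. Each agent moves along a normalized vector, and ⟨g, u/‖u‖⟩ ≥ ‖g‖ - 2‖u - g‖ holds without
any lower bound on ‖u‖, so inner products become gradient norms minus direction errors. The step in
x lowers the envelope P by about μ_x‖∇_x J‖, except that P responds to the gradient at a maximizer
in y instead of the one at the current y. The PL condition bounds the difference of these two
gradients by (5/2)κ‖∇_y J‖ (`SmoothPL.norm_gradX_sub_le`). The dual gap P - J falls by about μ_y‖∇_y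
J‖, and μ_x ≤ μ_y/(6κ) keeps the step in x from destroying this. The first inequality plus 6κ times
the second is `SmoothPL.gradNorms_le`, whose main terms telescope.

Direction errors. The difference between a tracking variable and the gradient at the centroid splits
into the consensus error of the tracking variables, the network average of the momentum errors, and
the drift of the agents from the centroid (`avg_direction_error_le`). Because all steps are
normalized, drifts, one-round displacements and local excursions have deterministic bounds. The
Hessian correction carries the old momentum from the previous iterate to the current one, so the
momentum error obeys e ↦ (1-β)e + noise + Taylor error + β·bias. This recursion is used twice. In
the network norm only β∑‖e‖ is needed, because the increments of the momentum contain e with the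
factor β, and therefore the tracking error contains no 1/β (`sum_consensusError_u_le`). For the
network average the recursion is solved exactly, which leaves discounted sums of averaged noise
(`norm_centroid_momentumError_le`).

Expectations. A noise term is centered in its own sample once the other samples are frozen, and of
two distinct noise terms at least one ignores the sample of the other. Resampling one coordinate of
the product law (`measurePreserving_update`) then makes distinct noise terms orthogonal. Averaging
over N local steps, K agents and about 1/β rounds gives the second moment w/(NKβ) in
`NoiseFamily.discounted`.

Conclusion. `Assumptions.avgMeasure_le` collects these estimates. The explicit bound dominates it
term by term with room to spare, and the initial errors are absorbed into the initial potential. The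
rate follows by inserting the tuned parameters, written as monomials in (1-λ)^{1/2}, (NK)^{1/3} and
T^{1/3}. The complexity claim is a choice of N and T in the rate, followed by the remark that some
round is no worse than the average. -/

theorem netNorm_eq_norm (v : Fin K → V) : netNorm v = ‖WithLp.toLp 2 v‖ := by
  rw [PiLp.norm_eq_of_L2]; rfl

theorem netNorm_nonneg (v : Fin K → V) : 0 ≤ netNorm v := Real.sqrt_nonneg _

theorem netNorm_sq (v : Fin K → V) : netNorm v ^ 2 = ∑ k, ‖v k‖ ^ 2 :=
  Real.sq_sqrt (Finset.sum_nonneg fun _ _ => sq_nonneg _)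

theorem netNorm_add_le (v w : Fin K → V) :
    netNorm (fun k => v k + w k) ≤ netNorm v + netNorm w := by
  simp only [netNorm_eq_norm]
  exact norm_add_le (WithLp.toLp 2 v) (WithLp.toLp 2 w)

theorem netNorm_mono {W : Type*} [NormedAddCommGroup W] {v : Fin K → V} {w : Fin K → W}
    (h : ∀ k, ‖v k‖ ≤ ‖w k‖) : netNorm v ≤ netNorm w :=
  Real.sqrt_le_sqrt <| Finset.sum_le_sum fun k _ => by gcongr; exact h k

theorem netNorm_smul [NormedSpace ℝ V] (a : ℝ) (v : Fin K → V) :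
    netNorm (fun k => a • v k) = |a| * netNorm v := by
  simp only [netNorm_eq_norm]
  exact norm_smul a (WithLp.toLp 2 v)

theorem netNorm_neg (v : Fin K → V) : netNorm (fun k => - v k) = netNorm v := by
  simp [netNorm]

theorem netNorm_le_of_forall_le {v : Fin K → V} {C : ℝ} (hC : 0 ≤ C) (h : ∀ k, ‖v k‖ ≤ C) :
    netNorm v ≤ √K * C := by
  have : netNorm v ≤ netNorm (fun _ : Fin K => C) :=
    netNorm_mono fun k => by rw [Real.norm_of_nonneg hC]; exact h k
  refine this.trans (le_of_eq ?_)
  simp [netNorm, Real.sqrt_sq hC]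

theorem sum_norm_le (v : Fin K → V) : ∑ k, ‖v k‖ ≤ √K * netNorm v := by
  rw [netNorm, ← Real.sqrt_mul (Nat.cast_nonneg K)]
  apply Real.le_sqrt_of_sq_le
  simpa using sq_sum_le_card_mul_sum_sq (s := Finset.univ) (f := fun k => ‖v k‖)

theorem avg_norm_le (hK : 0 < K) (v : Fin K → V) : (K : ℝ)⁻¹ * ∑ k, ‖v k‖ ≤ netNorm v / √K := by
  have hK' : (0 : ℝ) < K := by exact_mod_cast hK
  have h := sum_norm_le v
  have h2 : (K : ℝ) = √K * √K := (Real.mul_self_sqrt hK'.le).symm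
  have h3 : 0 < √(K : ℝ) := Real.sqrt_pos.2 hK'
  calc (K : ℝ)⁻¹ * ∑ k, ‖v k‖ ≤ (K : ℝ)⁻¹ * (√K * netNorm v) := by gcongr
    _ = netNorm v / √K := by
      rw [eq_div_iff h3.ne', inv_mul_eq_div, div_mul_eq_mul_div, div_eq_iff hK'.ne']
      linear_combination (-netNorm v) * h2

variable [InnerProductSpace ℝ V]

theorem norm_centroid_le (v : Fin K → V) : ‖centroid v‖ ≤ (K : ℝ)⁻¹ * ∑ k, ‖v k‖ := by
  rw [centroid, norm_smul, norm_inv, Real.norm_natCast]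
  gcongr
  exact norm_sum_le _ _

theorem centroid_add (v w : Fin K → V) :
    centroid (fun k => v k + w k) = centroid v + centroid w := by
  simp [centroid, Finset.sum_add_distrib]

theorem centroid_sub (v w : Fin K → V) :
    centroid (fun k => v k - w k) = centroid v - centroid w := by
  simp [centroid, Finset.sum_sub_distrib, smul_sub]

theorem centroid_smul (a : ℝ) (v : Fin K → V) :
    centroid (fun k => a • v k) = a • centroid v := by
  simp [centroid, ← Finset.smul_sum, smul_comm a]

theorem centroid_const (hK : 0 < K) (v : V) : centroid (fun _ : Fin K => v) = v := by
  have hK' : (K : ℝ) ≠ 0 := by exact_mod_cast hK.ne'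
  rw [centroid, Finset.sum_const, Finset.card_univ, Fintype.card_fin, ← Nat.cast_smul_eq_nsmul ℝ,
    smul_smul, inv_mul_cancel₀ hK', one_smul]

theorem map_centroid {W : Type*} [NormedAddCommGroup W] [InnerProductSpace ℝ W]
    (L : V →L[ℝ] W) (v : Fin K → V) : L (centroid v) = centroid fun k => L (v k) := by
  simp [centroid]

theorem norm_centroid_le_of_forall_le (hK : 0 < K) {v : Fin K → V} {C : ℝ} (h : ∀ k, ‖v k‖ ≤ C) :
    ‖centroid v‖ ≤ C := by
  have hK' : (0 : ℝ) < K := by exact_mod_cast hK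
  refine (norm_centroid_le v).trans ?_
  calc (K : ℝ)⁻¹ * ∑ k, ‖v k‖ ≤ (K : ℝ)⁻¹ * ∑ _k : Fin K, C := by gcongr; exact h _
    _ = C := by simp; field_simp

theorem consensusError_nonneg (v : Fin K → V) : 0 ≤ consensusError v := netNorm_nonneg _

theorem consensusError_const (hK : 0 < K) (v : V) :
    consensusError (fun _ : Fin K => v) = 0 := by
  simp [consensusError, centroid_const hK, netNorm]

/-- Subtracting the centroid is an orthogonal projection: ∑‖v_k - v_c‖² = ∑‖v_k‖² - K‖v_c‖². -/
theorem consensusError_le_netNorm (hK : 0 < K) (v : Fin K → V) :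
    consensusError v ≤ netNorm v := by
  have hK' : (K : ℝ) ≠ 0 := by exact_mod_cast hK.ne'
  refine Real.sqrt_le_sqrt ?_
  have hs : ∑ k, v k = (K : ℝ) • centroid v := by
    rw [centroid, smul_smul, mul_inv_cancel₀ hK', one_smul]
  have : ∑ k, ‖v k - centroid v‖ ^ 2 = ∑ k, ‖v k‖ ^ 2 - K * ‖centroid v‖ ^ 2 := by
    simp only [norm_sub_sq_real, Finset.sum_add_distrib, Finset.sum_sub_distrib,
      ← Finset.mul_sum, ← sum_inner, hs, inner_smul_left, real_inner_self_eq_norm_sq]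
    simp
    ring
  rw [this]
  have : 0 ≤ (K : ℝ) * ‖centroid v‖ ^ 2 := by positivity
  linarith

theorem consensusError_add_le (v w : Fin K → V) :
    consensusError (fun k => v k + w k) ≤ consensusError v + consensusError w := by
  unfold consensusError
  rw [centroid_add]
  simp only [add_sub_add_comm]
  exact netNorm_add_le _ _

theorem netNorm_le_consensusError_add (v : Fin K → V) :
    netNorm v ≤ consensusError v + √K * ‖centroid v‖ := by
  have h := netNorm_add_le (fun k => v k - centroid v) (fun _ => centroid v)
  simp only [sub_add_cancel] at h
  exact h.trans (add_le_add le_rfl (netNorm_le_of_forall_le (norm_nonneg _) fun _ => le_rfl))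

/-- A matrix acts on network vectors with its spectral norm as Lipschitz constant. -/
theorem netNorm_matrix_le [FiniteDimensional ℝ V] (B : Matrix (Fin K) (Fin K) ℝ) (v : Fin K → V) :
    netNorm (fun k => ∑ l, B k l • v l)
      ≤ ‖Matrix.toEuclideanCLM (n := Fin K) (𝕜 := ℝ) B‖ * netNorm v := by
  set M := ‖Matrix.toEuclideanCLM (n := Fin K) (𝕜 := ℝ) B‖
  -- In an orthonormal basis of `V` the claim separates into one statement in ℝ^K for each
  -- coordinate, where the operator norm of `B` applies.
  let b := stdOrthonormalBasis ℝ V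
  apply Real.sqrt_le_iff.2
  refine ⟨mul_nonneg (norm_nonneg _) (netNorm_nonneg _), ?_⟩
  rw [mul_pow, netNorm_sq]
  simp only [← b.sum_sq_norm_inner_right]
  rw [Finset.sum_comm, Finset.sum_comm (s := Finset.univ (α := Fin K)), Finset.mul_sum]
  refine Finset.sum_le_sum fun j _ => ?_
  let x : EuclideanSpace ℝ (Fin K) := WithLp.toLp 2 fun l => inner ℝ (b j) (v l)
  have h := (Matrix.toEuclideanCLM (n := Fin K) (𝕜 := ℝ) B).le_opNorm x
  have h2 := pow_le_pow_left₀ (norm_nonneg _) h 2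
  rw [mul_pow, EuclideanSpace.norm_sq_eq, EuclideanSpace.norm_sq_eq] at h2
  convert h2 using 3 with k _
  rw [Matrix.ofLp_toEuclideanCLM]
  simp [inner_sum, inner_smul_right, x, Matrix.mulVec, dotProduct]

theorem centroid_mix {A : Matrix (Fin K) (Fin K) ℝ} (hA : A ∈ doublyStochastic ℝ (Fin K))
    (v : Fin K → V) : centroid (fun k => ∑ l, A k l • v l) = centroid v := by
  simp only [centroid]
  rw [Finset.sum_comm]
  simp only [← Finset.sum_smul, sum_col_of_mem_doublyStochastic hA, one_smul]

/-- Both `A` and 𝟙𝟙ᵀ/K fix network vectors with equal entries, and 𝟙𝟙ᵀ/K annihilates centered ones.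
So the deviation after mixing is A - 𝟙𝟙ᵀ/K applied to the deviation before mixing. -/
theorem consensusError_mix_le [FiniteDimensional ℝ V] {A : Matrix (Fin K) (Fin K) ℝ}
    (hA : A ∈ doublyStochastic ℝ (Fin K))
    (v : Fin K → V) :
    consensusError (fun k => ∑ l, A k l • v l) ≤ mixingRate A * consensusError v := by
  have h := netNorm_matrix_le (A - Matrix.of fun _ _ => (K : ℝ)⁻¹) (fun k => v k - centroid v)
  unfold consensusError
  rw [centroid_mix hA]
  refine (le_of_eq ?_).trans h
  congr 1
  funext k
  have h1 : ∑ l, A k l = 1 := sum_row_of_mem_doublyStochastic hA k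
  have hK : (K : ℝ) ≠ 0 := by
    have := k.pos
    exact_mod_cast this.ne'
  simp only [Matrix.sub_apply, Matrix.of_apply, sub_smul, smul_sub, Finset.sum_sub_distrib,
    ← Finset.sum_smul, h1, one_smul, ← Finset.smul_sum]
  have : ((K : ℝ)⁻¹ * K) = 1 := inv_mul_cancel₀ hK
  simp [centroid, smul_smul, Finset.sum_const, ← Nat.cast_smul_eq_nsmul ℝ, hK]

end Network

/-! ### Normalized directions and a test-vector bound -/

section Vectors

variable {V : Type*} [NormedAddCommGroup V] [InnerProductSpace ℝ V]

theorem norm_normalize_le (u : V) : ‖(‖u‖)⁻¹ • u‖ ≤ 1 := by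
  rw [norm_smul, norm_inv, norm_norm]
  exact inv_mul_le_one

/-- The pairing of `u` with its own normalization is ‖u‖, also for `u = 0`. Replacing `u` by `g`
costs ‖u - g‖ once in the pairing and once in the norm. -/
theorem inner_normalize_ge (g u : V) : ‖g‖ - 2 * ‖u - g‖ ≤ inner ℝ g ((‖u‖)⁻¹ • u) := by
  have h1 : inner ℝ u ((‖u‖)⁻¹ • u) = ‖u‖ := by
    rw [inner_smul_right, real_inner_self_eq_norm_sq]
    by_cases h : ‖u‖ = 0
    · simp [h]
    · field_simp
  have h2 : inner ℝ g ((‖u‖)⁻¹ • u) = ‖u‖ - inner ℝ (u - g) ((‖u‖)⁻¹ • u) := by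
    rw [inner_sub_left, h1]; ring
  have h3 : inner ℝ (u - g) ((‖u‖)⁻¹ • u) ≤ ‖u - g‖ := by
    refine (real_inner_le_norm _ _).trans ?_
    have := mul_le_mul_of_nonneg_left (norm_normalize_le u) (norm_nonneg (u - g))
    linarith
  have h4 : ‖g‖ ≤ ‖u‖ + ‖u - g‖ := by
    have := norm_sub_norm_le g u
    rw [norm_sub_rev] at this
    linarith
  linarith

/-- Test with d = g/M. The lemma turns one-sided quadratic comparisons of functions into bounds on
gradients. -/
theorem norm_sq_le_of_inner_le {g : V} {δ M : ℝ} (hM : 0 < M)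
    (h : ∀ d : V, inner ℝ g d ≤ δ + M / 2 * ‖d‖ ^ 2) : ‖g‖ ^ 2 ≤ 2 * M * δ := by
  have := h (M⁻¹ • g)
  rw [inner_smul_right, real_inner_self_eq_norm_sq, norm_smul, norm_inv,
    Real.norm_of_nonneg hM.le] at this
  have h2 : M * (M⁻¹ * ‖g‖ ^ 2) ≤ M * (δ + M / 2 * (M⁻¹ * ‖g‖) ^ 2) := by gcongr
  have h3 : M * (M⁻¹ * ‖g‖ ^ 2) = ‖g‖ ^ 2 := by field_simp
  have h4 : M * (δ + M / 2 * (M⁻¹ * ‖g‖) ^ 2) = M * δ + ‖g‖ ^ 2 / 2 := by field_simp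
  linarith

end Vectors

end LocalDiMA

end

noncomputable section

namespace LocalDiMA

variable {K M₁ M₂ : ℕ} {S : Type*}

/-! ### Taylor estimates for smooth costs -/

section Smooth

variable {E : Type*} [NormedAddCommGroup E] [InnerProductSpace ℝ E] [CompleteSpace E]

theorem inner_gradient {f : E → ℝ} (z d : E) : inner ℝ (gradient f z) d = fderiv ℝ f z d := by
  simp [gradient]

theorem norm_fderiv_sub_eq (f : E → ℝ) (z w : E) :
    ‖fderiv ℝ f z - fderiv ℝ f w‖ = ‖gradient f z - gradient f w‖ := by
  simp only [gradient, ← map_sub, LinearIsometryEquiv.norm_map]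

/-- The mean value inequality on a ball gives `L` in place of the sharp L/2. The later constants
leave room for this loss. -/
theorem gradient_quadratic_bound {f : E → ℝ} {L : ℝ} (hL : 0 ≤ L) (hf : Differentiable ℝ f)
    (h : ∀ z w, ‖gradient f z - gradient f w‖ ≤ L * ‖z - w‖) (z d : E) :
    |f (z + d) - f z - inner ℝ (gradient f z) d| ≤ L * ‖d‖ ^ 2 := by
  have := (convex_closedBall z ‖d‖).norm_image_sub_le_of_norm_fderiv_le' (𝕜 := ℝ) (f := f)
    (C := L * ‖d‖) (φ := fderiv ℝ f z) (x := z) (y := z + d) (fun x _ => hf x)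
    (fun x hx => by
      rw [norm_fderiv_sub_eq]
      refine (h x z).trans ?_
      gcongr
      exact mem_closedBall_iff_norm.1 hx)
    (by simp) (by simp)
  rw [add_sub_cancel_left, Real.norm_eq_abs] at this
  rw [inner_gradient]
  calc _ ≤ _ := this
    _ = _ := by ring

end Smooth

section LocalCost

variable {c : Constants} {J : Vec M₁ M₂ → ℝ}

theorem LipschitzConditions.differentiable (h : LipschitzConditions c J) : Differentiable ℝ J :=
  h.contDiff.differentiable (by norm_num)

theorem LipschitzConditions.gradient_differentiable (h : LipschitzConditions c J) :
    Differentiable ℝ (gradient J) := by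
  have h1 : ContDiff ℝ 1 (fderiv ℝ J) := h.contDiff.fderiv_right (by norm_num)
  exact (InnerProductSpace.toDual ℝ (Vec M₁ M₂)).symm.toContinuousLinearEquiv.differentiable.comp
    (h1.differentiable (by norm_num))

theorem LipschitzConditions.norm_hess_le (h : LipschitzConditions c J) (hL : 0 ≤ c.Lf)
    (z : Vec M₁ M₂) : ‖hess J z‖ ≤ c.Lf := by
  have : LipschitzWith ⟨c.Lf, hL⟩ (gradient J) :=
    LipschitzWith.of_dist_le_mul fun z w => by
      rw [dist_eq_norm, dist_eq_norm]
      exact h.gradient_lipschitz z w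
  exact norm_fderiv_le_of_lipschitz ℝ this

/-- The Hessian sits at `z`, the new iterate, as in the momentum correction. The mean value
inequality is applied to the gradient on the ball around `z` that reaches `w`. -/
theorem LipschitzConditions.gradient_taylor (h : LipschitzConditions c J) (hL : 0 ≤ c.Lh)
    (z w : Vec M₁ M₂) :
    ‖gradient J w + hess J z (z - w) - gradient J z‖ ≤ c.Lh * ‖z - w‖ ^ 2 := by
  have := (convex_closedBall z ‖w - z‖).norm_image_sub_le_of_norm_fderiv_le' (𝕜 := ℝ)
    (f := gradient J) (C := c.Lh * ‖w - z‖) (φ := hess J z) (x := z) (y := w)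
    (fun x _ => h.gradient_differentiable x)
    (fun x hx => by
      refine (h.hess_lipschitz x z).trans ?_
      gcongr
      exact mem_closedBall_iff_norm.1 hx)
    (by simp) (by simp [dist_eq_norm])
  have e : gradient J w + hess J z (z - w) - gradient J z
      = gradient J w - gradient J z - hess J z (w - z) := by
    rw [← neg_sub w z, map_neg]; abel
  rw [e, norm_sub_rev z w]
  calc _ ≤ _ := this
    _ = _ := by ring

/-- A first-order substitute for the quadratic estimate. In the network norm the squared
displacements of the single agents would cost an extra factor √K, which a bound linear in the
displacement avoids. -/
theorem LipschitzConditions.gradient_taylor' (h : LipschitzConditions c J) (hL : 0 ≤ c.Lf)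
    (z w : Vec M₁ M₂) :
    ‖gradient J w + hess J z (z - w) - gradient J z‖ ≤ 2 * c.Lf * ‖z - w‖ := by
  have h1 := h.gradient_lipschitz w z
  have h2 := ((hess J z).le_opNorm (z - w)).trans
    (mul_le_mul_of_nonneg_right (h.norm_hess_le hL z) (norm_nonneg _))
  rw [add_sub_right_comm]
  refine (norm_add_le _ _).trans ?_
  rw [norm_sub_rev w z] at h1
  linarith

end LocalCost

theorem norm_fst_le (z : Vec M₁ M₂) : ‖z.fst‖ ≤ ‖z‖ := by
  apply le_of_sq_le_sq _ (norm_nonneg _)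
  rw [WithLp.prod_norm_sq_eq_of_L2]
  nlinarith [sq_nonneg ‖z.snd‖]

theorem norm_snd_le (z : Vec M₁ M₂) : ‖z.snd‖ ≤ ‖z‖ := by
  apply le_of_sq_le_sq _ (norm_nonneg _)
  rw [WithLp.prod_norm_sq_eq_of_L2]
  nlinarith [sq_nonneg ‖z.fst‖]

theorem norm_le_fst_add_snd (z : Vec M₁ M₂) : ‖z‖ ≤ ‖z.fst‖ + ‖z.snd‖ := by
  apply le_of_sq_le_sq _ (by positivity)
  rw [WithLp.prod_norm_sq_eq_of_L2]
  nlinarith [norm_nonneg z.fst, norm_nonneg z.snd]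

theorem inner_eq_fst_add_snd (z w : Vec M₁ M₂) :
    inner ℝ z w = inner ℝ z.fst w.fst + inner ℝ z.snd w.snd :=
  WithLp.prod_inner_apply z w

/-- The structural facts about the global cost that the descent argument needs. -/
structure SmoothPL (c : Constants) (J : Vec M₁ M₂ → ℝ) : Prop where
  ν_pos : 0 < c.ν
  one_le_κ : 1 ≤ c.κ
  differentiable : Differentiable ℝ J
  gradient_lipschitz : ∀ z w, ‖gradient J z - gradient J w‖ ≤ c.Lf * ‖z - w‖
  cost : CostConditions c J

theorem Lf_pos_of {c : Constants} (hν : 0 < c.ν) (hκ : 1 ≤ c.κ) : 0 < c.Lf := by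
  have : c.ν ≤ c.Lf := by
    rw [Constants.κ, le_div_iff₀ hν] at hκ
    linarith
  linarith

/-! ### The envelope under the PL condition -/

section Envelope

variable {c : Constants} {J : Vec M₁ M₂ → ℝ}

theorem envelope_eq {x : EuclideanSpace ℝ (Fin M₁)} {y : EuclideanSpace ℝ (Fin M₂)}
    (h : y ∈ argmaxSet J x) : envelope J x = J (col x y) :=
  le_antisymm (ciSup_le h) (le_ciSup ⟨J (col x y), by rintro _ ⟨y', rfl⟩; exact h y'⟩ y)

namespace SmoothPL

theorem Lf_pos (h : SmoothPL c J) : 0 < c.Lf := Lf_pos_of h.ν_pos h.one_le_κ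

theorem Lf_eq (h : SmoothPL c J) : c.Lf = c.κ * c.ν := by
  have := h.ν_pos
  rw [Constants.κ]; field_simp

theorem le_envelope (h : SmoothPL c J) (x : EuclideanSpace ℝ (Fin M₁))
    (y : EuclideanSpace ℝ (Fin M₂)) : J (col x y) ≤ envelope J x := by
  obtain ⟨ys, hys⟩ := h.cost.exists_max x
  rw [envelope_eq hys]
  exact hys y

theorem quadratic_bound (h : SmoothPL c J) (z d : Vec M₁ M₂) :
    |J (z + d) - J z - (inner ℝ (gradX J z) d.fst + inner ℝ (gradY J z) d.snd)|
      ≤ c.Lf * ‖d‖ ^ 2 := by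
  have := gradient_quadratic_bound h.Lf_pos.le h.differentiable h.gradient_lipschitz z d
  rwa [inner_eq_fst_add_snd] at this

theorem quadratic_bound_fst (h : SmoothPL c J) (x d : EuclideanSpace ℝ (Fin M₁))
    (y : EuclideanSpace ℝ (Fin M₂)) :
    |J (col (x + d) y) - J (col x y) - inner ℝ (gradX J (col x y)) d| ≤ c.Lf * ‖d‖ ^ 2 := by
  have := h.quadratic_bound (col x y) (col d 0)
  have e : col x y + col d 0 = col (x + d) y := by
    unfold col; rw [← WithLp.toLp_add]; simp
  have e2 : ‖col d (0 : EuclideanSpace ℝ (Fin M₂))‖ ^ 2 = ‖d‖ ^ 2 := by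
    rw [WithLp.prod_norm_sq_eq_of_L2]; simp [col]
  rw [e, e2] at this
  simpa [col] using this

theorem quadratic_bound_snd (h : SmoothPL c J) (x : EuclideanSpace ℝ (Fin M₁))
    (y d : EuclideanSpace ℝ (Fin M₂)) :
    |J (col x (y + d)) - J (col x y) - inner ℝ (gradY J (col x y)) d| ≤ c.Lf * ‖d‖ ^ 2 := by
  have := h.quadratic_bound (col x y) (col 0 d)
  have e : col x y + col 0 d = col x (y + d) := by
    unfold col; rw [← WithLp.toLp_add]; simp
  have e2 : ‖col (0 : EuclideanSpace ℝ (Fin M₁)) d‖ ^ 2 = ‖d‖ ^ 2 := by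
    rw [WithLp.prod_norm_sq_eq_of_L2]; simp [col]
  rw [e, e2] at this
  simpa [col] using this

/-- Maximality and the quadratic lower bound supply the hypothesis of `norm_sq_le_of_inner_le` with
δ = 0. -/
theorem gradY_eq_zero (h : SmoothPL c J) {x : EuclideanSpace ℝ (Fin M₁)}
    {y : EuclideanSpace ℝ (Fin M₂)} (hy : y ∈ argmaxSet J x) : gradY J (col x y) = 0 := by
  have hL := h.Lf_pos
  have := norm_sq_le_of_inner_le (g := gradY J (col x y)) (δ := 0) (M := 2 * c.Lf) (by linarith)
    fun d => by
      have h1 := (abs_le.1 (h.quadratic_bound_snd x y d)).1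
      have h2 := hy (y + d)
      linarith
  rw [mul_zero] at this
  exact norm_eq_zero.1 (pow_eq_zero_iff two_ne_zero |>.1 (le_antisymm this (sq_nonneg _)))

/-- No differentiability of the envelope is used. Keep the maximizer `y` of the old point: its
y-gradient vanishes at `x`, hence is at most L_f‖d‖ at x + d, and PL turns this into a dual gap of
at most (L_f κ/2)‖d‖². Together with the quadratic bound in x this explains L = L_f + L_f κ/2. -/
theorem envelope_step_le (h : SmoothPL c J) {x : EuclideanSpace ℝ (Fin M₁)}
    {y : EuclideanSpace ℝ (Fin M₂)} (hy : y ∈ argmaxSet J x) (d : EuclideanSpace ℝ (Fin M₁)) :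
    envelope J (x + d) ≤ envelope J x + inner ℝ (gradX J (col x y)) d + c.L * ‖d‖ ^ 2 := by
  have hν := h.ν_pos
  have h1 := (abs_le.1 (h.quadratic_bound_fst x d y)).2
  have h2 := h.cost.pl (x + d) y
  have h3 : ‖gradY J (col (x + d) y)‖ ≤ c.Lf * ‖d‖ := by
    have := h.gradient_lipschitz (col (x + d) y) (col x y)
    have e : col (x + d) y - col x y = col d 0 := by
      unfold col; rw [← WithLp.toLp_sub]; simp
    have e2 : ‖col d (0 : EuclideanSpace ℝ (Fin M₂))‖ ≤ ‖d‖ :=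
      (norm_le_fst_add_snd _).trans (by simp [col])
    calc ‖gradY J (col (x + d) y)‖ = ‖gradY J (col (x + d) y) - gradY J (col x y)‖ := by
          rw [h.gradY_eq_zero hy, sub_zero]
      _ = ‖(gradient J (col (x + d) y) - gradient J (col x y)).snd‖ := rfl
      _ ≤ c.Lf * ‖col (x + d) y - col x y‖ := (norm_snd_le _).trans this
      _ ≤ c.Lf * ‖d‖ := by
        rw [e]; exact mul_le_mul_of_nonneg_left e2 h.Lf_pos.le
  have h4 : ‖gradY J (col (x + d) y)‖ ^ 2 ≤ (c.Lf * ‖d‖) ^ 2 := by gcongr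
  have h5 : envelope J (x + d) - J (col (x + d) y) ≤ c.Lf * c.κ / 2 * ‖d‖ ^ 2 := by
    have h6 : 2 * c.ν * (envelope J (x + d) - J (col (x + d) y))
        ≤ 2 * c.ν * (c.Lf * c.κ / 2 * ‖d‖ ^ 2) := by
      refine (h2.trans h4).trans (le_of_eq ?_)
      calc (c.Lf * ‖d‖) ^ 2 = c.Lf * c.Lf * ‖d‖ ^ 2 := by ring
        _ = c.Lf * (c.κ * c.ν) * ‖d‖ ^ 2 := by rw [← h.Lf_eq]
        _ = _ := by ring
    exact le_of_mul_le_mul_left h6 (by linarith)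
  rw [envelope_eq hy, Constants.L]
  linarith

theorem L_le (h : SmoothPL c J) : c.L ≤ 3 / 2 * c.κ * c.Lf := by
  have := h.Lf_pos
  have := h.one_le_κ
  rw [Constants.L]
  nlinarith

/-- Since P(x + d) ≥ J(x + d, y) for all d, the upper quadratic bound on P and the lower one on J
leave a linear form in d dominated by the dual gap plus a multiple of ‖d‖². Testing it bounds the
squared difference by 10κL_f times the gap, and PL by 5κ²‖∇_y J‖², where √5 ≤ 5/2. Neither a unique
maximizer nor the distance to the maximizers is involved. -/
theorem norm_gradX_sub_le (h : SmoothPL c J) {x : EuclideanSpace ℝ (Fin M₁)}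
    {ys : EuclideanSpace ℝ (Fin M₂)} (hy : ys ∈ argmaxSet J x) (y : EuclideanSpace ℝ (Fin M₂)) :
    ‖gradX J (col x ys) - gradX J (col x y)‖ ≤ 5 / 2 * c.κ * ‖gradY J (col x y)‖ := by
  have hν := h.ν_pos
  have hL := h.Lf_pos
  have hκ := h.one_le_κ
  set g := gradX J (col x ys) - gradX J (col x y) with hg
  have key : ‖-g‖ ^ 2 ≤ 2 * (5 * c.κ * c.Lf) * (envelope J x - J (col x y)) := by
    refine norm_sq_le_of_inner_le (by positivity) fun d => ?_
    have h1 := h.envelope_step_le hy d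
    have h2 := (abs_le.1 (h.quadratic_bound_fst x d y)).1
    have h3 := h.le_envelope (x + d) y
    have h4 : inner ℝ (-g) d
        = inner ℝ (gradX J (col x y)) d - inner ℝ (gradX J (col x ys)) d := by
      rw [hg, neg_sub, inner_sub_left]
    have h5 : (c.L + c.Lf) * ‖d‖ ^ 2 ≤ (5 * c.κ * c.Lf / 2) * ‖d‖ ^ 2 := by
      gcongr
      have := h.L_le
      nlinarith
    linarith
  rw [norm_neg] at key
  have hpl := h.cost.pl x y
  have h6 : ‖g‖ ^ 2 ≤ (5 / 2 * c.κ * ‖gradY J (col x y)‖) ^ 2 := by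
    have e : 2 * (5 * c.κ * c.Lf) * (envelope J x - J (col x y))
        = 5 * c.κ ^ 2 * (2 * c.ν * (envelope J x - J (col x y))) := by
      rw [h.Lf_eq]; ring
    have h7 : 5 * c.κ ^ 2 * (2 * c.ν * (envelope J x - J (col x y)))
        ≤ 5 * c.κ ^ 2 * ‖gradY J (col x y)‖ ^ 2 := by gcongr
    have h8 : 0 ≤ (c.κ * ‖gradY J (col x y)‖) ^ 2 := sq_nonneg _
    calc _ ≤ 5 * c.κ ^ 2 * ‖gradY J (col x y)‖ ^ 2 := by rw [e] at key; exact key.trans h7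
      _ ≤ _ := by nlinarith
  exact le_of_sq_le_sq h6 (by positivity)

end SmoothPL

end Envelope

end LocalDiMA

end

noncomputable section

namespace LocalDiMA

variable {K M₁ M₂ : ℕ} {S : Type*}

/-! ### One averaged normalized descent-ascent step -/

section Step

theorem col_fst_snd (z : Vec M₁ M₂) : col z.fst z.snd = z := rfl

theorem normalizedStep_sub_fst (a b : ℝ) (z v : Vec M₁ M₂) :
    (normalizedStep a b z v - z).fst = -(a • ((‖v.fst‖)⁻¹ • v.fst)) := by
  simp [normalizedStep, col]

theorem normalizedStep_sub_snd (a b : ℝ) (z v : Vec M₁ M₂) :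
    (normalizedStep a b z v - z).snd = b • ((‖v.snd‖)⁻¹ • v.snd) := by
  simp [normalizedStep, col]

theorem norm_smul_normalize_le {V : Type*} [NormedAddCommGroup V] [InnerProductSpace ℝ V]
    {a : ℝ} (ha : 0 ≤ a) (v : V) : ‖a • ((‖v‖)⁻¹ • v)‖ ≤ a := by
  rw [norm_smul, Real.norm_of_nonneg ha]
  exact mul_le_of_le_one_right ha (norm_normalize_le v)

theorem norm_normalizedStep_sub_le {a b : ℝ} (ha : 0 ≤ a) (hb : 0 ≤ b) (z v : Vec M₁ M₂) :
    ‖normalizedStep a b z v - z‖ ≤ a + b := by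
  refine (norm_le_fst_add_snd _).trans ?_
  rw [normalizedStep_sub_fst, normalizedStep_sub_snd, norm_neg]
  exact add_le_add (norm_smul_normalize_le ha _) (norm_smul_normalize_le hb _)

theorem norm_localIterate_sub_le {p : Params} (hx : 0 ≤ p.μbx) (hy : 0 ≤ p.μby)
    (q : Vec M₁ M₂ → S → ℝ) (s : ℕ → S) (z : Vec M₁ M₂) (n : ℕ) :
    ‖localIterate p q s z n - z‖ ≤ n * (p.μbx + p.μby) := by
  induction n with
  | zero => simp [localIterate]
  | succ n ih =>
    have h := norm_normalizedStep_sub_le hx hy (localIterate p q s z n)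
      (gradient (fun w => q w (s n)) (localIterate p q s z n))
    have := norm_add_le (localIterate p q s z (n + 1) - localIterate p q s z n)
      (localIterate p q s z n - z)
    rw [sub_add_sub_cancel] at this
    push_cast
    refine this.trans ?_
    have h' : ‖localIterate p q s z (n + 1) - localIterate p q s z n‖ ≤ p.μbx + p.μby := h
    linarith

theorem fst_centroid (v : Fin K → Vec M₁ M₂) : (centroid v).fst = centroid fun k => (v k).fst :=
  map_centroid (WithLp.fstL 2 ℝ _ _) v

theorem snd_centroid (v : Fin K → Vec M₁ M₂) : (centroid v).snd = centroid fun k => (v k).snd :=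
  map_centroid (WithLp.sndL 2 ℝ _ _) v

theorem inner_centroid_normalize_ge {V : Type*} [NormedAddCommGroup V] [InnerProductSpace ℝ V]
    (hK : 0 < K) (g : V) (u : Fin K → V) :
    ‖g‖ - 2 * ((K : ℝ)⁻¹ * ∑ k, ‖u k - g‖)
      ≤ inner ℝ g (centroid fun k => (‖u k‖)⁻¹ • u k) := by
  have hK' : (K : ℝ) ≠ 0 := by exact_mod_cast hK.ne'
  rw [centroid, inner_smul_right, inner_sum]
  calc ‖g‖ - 2 * ((K : ℝ)⁻¹ * ∑ k, ‖u k - g‖)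
      = (K : ℝ)⁻¹ * ∑ k, (‖g‖ - 2 * ‖u k - g‖) := by
        rw [Finset.sum_sub_distrib, ← Finset.mul_sum]
        simp
        field_simp
    _ ≤ _ := by
        gcongr
        exact inner_normalize_ge _ _

variable {c : Constants} {J : Vec M₁ M₂ → ℝ}

/-- One averaged normalized descent-ascent step controls the stationarity measure by the decrease
of the envelope, the decrease of the dual gap and the errors of the search directions. -/
theorem SmoothPL.gradNorms_le (h : SmoothPL c J) (hK : 0 < K) {μx μy : ℝ} (hμx : 0 < μx)
    (hμ : μx ≤ μy / (6 * c.κ)) (z u : Fin K → Vec M₁ M₂) (z' : Vec M₁ M₂)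
    (hz' : z' = centroid fun k => normalizedStep μx μy (z k) (u k)) :
    gradNorms J (centroid z) ≤
      (envelope J (centroid z).fst - envelope J z'.fst) / μx
      + 6 * c.κ * ((initialGap J (centroid z) - initialGap J z') / μy)
      + (c.L * μx + 6 * c.κ * (c.Lf * μx / 4 + 4 * c.Lf * μy))
      + 2 * ((K : ℝ)⁻¹ * ∑ k, ‖(u k).fst - gradX J (centroid z)‖)
      + 12 * c.κ * ((K : ℝ)⁻¹ * ∑ k, ‖(u k).snd - gradY J (centroid z)‖) := by
  have hκ := h.one_le_κ
  have hL := h.Lf_pos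
  have hμxy : 6 * c.κ * μx ≤ μy := by
    rw [le_div_iff₀ (by linarith)] at hμ; linarith
  have hμy : 0 < μy := by nlinarith
  have hμle : μx ≤ μy := by nlinarith
  set Ex := (K : ℝ)⁻¹ * ∑ k, ‖(u k).fst - gradX J (centroid z)‖
  set Ey := (K : ℝ)⁻¹ * ∑ k, ‖(u k).snd - gradY J (centroid z)‖
  set zc := centroid z with hzc
  set nx := centroid fun k => (‖(u k).fst‖)⁻¹ • (u k).fst with hnx
  set ny := centroid fun k => (‖(u k).snd‖)⁻¹ • (u k).snd with hny
  have hnx1 : ‖nx‖ ≤ 1 := norm_centroid_le_of_forall_le hK fun k => norm_normalize_le _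
  have hny1 : ‖ny‖ ≤ 1 := norm_centroid_le_of_forall_le hK fun k => norm_normalize_le _
  have hdiff : z' - zc = centroid fun k => normalizedStep μx μy (z k) (u k) - z k := by
    rw [centroid_sub, hz']
  have hfst : (z' - zc).fst = -(μx • nx) := by
    rw [hdiff, fst_centroid]
    simp only [normalizedStep_sub_fst, ← neg_smul μx]
    rw [centroid_smul]
  have hsnd : (z' - zc).snd = μy • ny := by
    rw [hdiff, snd_centroid]
    simp only [normalizedStep_sub_snd]
    rw [centroid_smul]
  have hfst' : z'.fst = zc.fst + -(μx • nx) := by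
    rw [← hfst, WithLp.sub_fst]; abel
  obtain ⟨ys, hys⟩ := h.cost.exists_max zc.fst
  have hG := h.norm_gradX_sub_le hys zc.snd
  rw [col_fst_snd] at hG
  have hP := h.envelope_step_le hys (-(μx • nx))
  rw [← hfst'] at hP
  have hJ := (abs_le.1 (h.quadratic_bound zc (z' - zc))).1
  rw [add_sub_cancel, hfst, hsnd] at hJ
  have hx := inner_centroid_normalize_ge hK (gradX J zc) fun k => (u k).fst
  have hy := inner_centroid_normalize_ge hK (gradY J zc) fun k => (u k).snd
  rw [← hnx] at hx
  rw [← hny] at hy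
  have hin : ∀ g : EuclideanSpace ℝ (Fin M₁), inner ℝ g (-(μx • nx)) = -(μx * inner ℝ g nx) :=
    fun g => by rw [inner_neg_right, inner_smul_right]
  rw [hin] at hP hJ
  rw [inner_smul_right] at hJ
  have hcross : -(inner ℝ (gradX J (col zc.fst ys)) nx) + inner ℝ (gradX J zc) nx
      ≤ 5 / 2 * c.κ * ‖gradY J zc‖ := by
    have h1 : -(inner ℝ (gradX J (col zc.fst ys)) nx) + inner ℝ (gradX J zc) nx
        = -inner ℝ (gradX J (col zc.fst ys) - gradX J zc) nx := by
      rw [inner_sub_left]; ring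
    rw [h1]
    refine (neg_le_abs _).trans ((abs_real_inner_le_norm _ _).trans ?_)
    exact (mul_le_of_le_one_right (norm_nonneg _) hnx1).trans hG
  have hd1 : ‖-(μx • nx)‖ ^ 2 ≤ μx ^ 2 := by
    rw [norm_neg, norm_smul, Real.norm_of_nonneg hμx.le]
    exact pow_le_pow_left₀ (by positivity) (mul_le_of_le_one_right hμx.le hnx1) 2
  have hd2 : ‖z' - zc‖ ^ 2 ≤ (2 * μy) ^ 2 := by
    refine pow_le_pow_left₀ (by positivity) ?_ 2
    rw [hdiff]
    refine (norm_centroid_le_of_forall_le hK fun k =>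
      norm_normalizedStep_sub_le hμx.le hμy.le _ _).trans (by linarith)
  have hLL : c.L * ‖-(μx • nx)‖ ^ 2 ≤ c.L * μx ^ 2 := by
    have : 0 ≤ c.L := by rw [Constants.L]; positivity
    gcongr
  have hLL2 : c.Lf * ‖z' - zc‖ ^ 2 ≤ c.Lf * (2 * μy) ^ 2 := by gcongr
  -- Uses L ≤ (3/2)κL_f and 6κμ_x ≤ μ_y, so that this term can later be divided by μ_y.
  have hLb : c.L * μx ^ 2 ≤ c.Lf * μx / 4 * μy := by
    have h1 := h.L_le
    calc c.L * μx ^ 2 ≤ (3 / 2 * c.κ * c.Lf) * μx ^ 2 := by gcongr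
      _ = c.Lf * μx / 4 * (6 * c.κ * μx) := by ring
      _ ≤ _ := by gcongr
  have hxm := mul_le_mul_of_nonneg_left hx hμx.le
  have hym := mul_le_mul_of_nonneg_left hy hμy.le
  have hcm := mul_le_mul_of_nonneg_left hcross hμx.le
  -- decrease of the envelope
  have hA : μx * ‖gradX J zc‖ ≤ envelope J zc.fst - envelope J z'.fst + 2 * μx * Ex
      + μx * (5 / 2 * c.κ * ‖gradY J zc‖) + c.L * μx ^ 2 := by
    linarith
  have hA' : ‖gradX J zc‖ ≤ (envelope J zc.fst - envelope J z'.fst) / μx + 2 * Ex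
      + 5 / 2 * c.κ * ‖gradY J zc‖ + c.L * μx := by
    refine le_of_mul_le_mul_left (hA.trans (le_of_eq ?_)) hμx
    field_simp
  -- decrease of the dual gap
  have hsmall : μx * (5 / 2 * c.κ * ‖gradY J zc‖) ≤ 5 / 12 * μy * ‖gradY J zc‖ := by
    have := mul_le_mul_of_nonneg_right hμxy (norm_nonneg (gradY J zc))
    linarith
  -- In the dual gap the two x-gradients cancel up to the cross term, so ‖∇_x J‖ does not appear.
  -- The cross term takes 5/12 of the gain μ_y‖∇_y J‖ and leaves 7/12.
  have hB : 7 / 12 * μy * ‖gradY J zc‖ ≤ initialGap J zc - initialGap J z' + 2 * μy * Ey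
      + c.Lf * μx / 4 * μy + 4 * c.Lf * μy * μy := by
    unfold initialGap
    linarith
  have hB' : 7 / 12 * ‖gradY J zc‖ ≤ (initialGap J zc - initialGap J z') / μy + 2 * Ey
      + (c.Lf * μx / 4 + 4 * c.Lf * μy) := by
    refine le_of_mul_le_mul_left ((le_of_eq ?_).trans (hB.trans (le_of_eq ?_))) hμy
    · ring
    · field_simp
      ring
  -- The weight 6κ is chosen so that 6κ · 7/12 = (5/2)κ + κ. The first part cancels the cross term
  -- of the envelope inequality, the second covers ‖∇_y J‖ itself since κ ≥ 1.
  have hC := mul_le_mul_of_nonneg_left hB' (by linarith : 0 ≤ 6 * c.κ)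
  have hD : ‖gradY J zc‖ ≤ c.κ * ‖gradY J zc‖ := le_mul_of_one_le_left (norm_nonneg _) hκ
  unfold gradNorms
  linarith

end Step

end LocalDiMA

end

noncomputable section

namespace LocalDiMA

variable {K M₁ M₂ : ℕ} {S : Type*}

/-! ### Summing linear recursions -/

section Recursions

/-- Telescoping. The factor β stays with the sum, so the forcing terms are not amplified by 1/β. -/
theorem mul_sum_le_of_contraction {β : ℝ} {e w : ℕ → ℝ} (he : ∀ i, 0 ≤ e i)
    (h : ∀ i, e (i + 1) ≤ (1 - β) * e i + w i) (T : ℕ) :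
    β * ∑ i ∈ Finset.range T, e i ≤ e 0 + ∑ i ∈ Finset.range T, w i := by
  suffices β * ∑ i ∈ Finset.range T, e i + e T ≤ e 0 + ∑ i ∈ Finset.range T, w i by
    linarith [he T]
  induction T with
  | zero => simp
  | succ T ih =>
    rw [Finset.sum_range_succ, Finset.sum_range_succ, mul_add]
    linarith [h T]

/-- Sum the recursion, compare the sum of t_i with the shifted sum, and solve for the latter. -/
theorem sum_le_of_tracking {r : ℝ} (hr0 : 0 ≤ r) (hr : r < 1) {t v : ℕ → ℝ} (ht : ∀ i, 0 ≤ t i)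
    (h : ∀ i, t (i + 1) ≤ r * (t i + v i)) (T : ℕ) :
    ∑ i ∈ Finset.range T, t (i + 1) ≤ r / (1 - r) * (t 0 + ∑ i ∈ Finset.range T, v i) := by
  have h1 : ∑ i ∈ Finset.range T, t (i + 1)
      ≤ r * (∑ i ∈ Finset.range T, t i + ∑ i ∈ Finset.range T, v i) := by
    rw [← Finset.sum_add_distrib, Finset.mul_sum]
    exact Finset.sum_le_sum fun i _ => h i
  have h2 : ∑ i ∈ Finset.range T, t i ≤ t 0 + ∑ i ∈ Finset.range T, t (i + 1) := by
    have := Finset.sum_range_succ t T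
    rw [Finset.sum_range_succ'] at this
    linarith [ht T]
  have h3 := mul_le_mul_of_nonneg_left h2 hr0
  rw [div_mul_eq_mul_div, le_div_iff₀ (by linarith)]
  linarith

/-- The solution `∑_{j<i} (1 - β)^{i-1-j} X_j` of the recursion `S_{i+1} = (1 - β) S_i + X_i`. -/
def discountedSum {V : Type*} [AddCommGroup V] [Module ℝ V] (β : ℝ) (X : ℕ → V) (i : ℕ) : V :=
  ∑ j ∈ Finset.range i, (1 - β) ^ (i - 1 - j) • X j

theorem discountedSum_succ {V : Type*} [AddCommGroup V] [Module ℝ V] (β : ℝ) (X : ℕ → V) (i : ℕ) :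
    discountedSum β X (i + 1) = (1 - β) • discountedSum β X i + X i := by
  rw [discountedSum, Finset.sum_range_succ, discountedSum, Finset.smul_sum]
  congr 1
  · refine Finset.sum_congr rfl fun j hj => ?_
    rw [Finset.mem_range] at hj
    rw [smul_smul, ← pow_succ']
    congr 2
    omega
  · simp

end Recursions

/-! ### Splitting the local averages into mean, noise and bias -/

section Noise

/-- The averaged gradient noise `(1/N) ∑ₙ (∇q(z_n; ξ_n) - ∇J(z_n))` of one agent in one round. -/
def gradNoise (p : Params) (q : Vec M₁ M₂ → S → ℝ) (J : Vec M₁ M₂ → ℝ) (s : ℕ → S)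
    (z : Vec M₁ M₂) : Vec M₁ M₂ :=
  (p.N : ℝ)⁻¹ • ∑ n ∈ Finset.range p.N,
    (gradient (fun w => q w (s n)) (localIterate p q s z n)
      - gradient J (localIterate p q s z n))

/-- The bias `(1/N) ∑ₙ (∇J(z_n) - ∇J(z))` caused by the local steps. -/
def localBias (p : Params) (q : Vec M₁ M₂ → S → ℝ) (J : Vec M₁ M₂ → ℝ) (s : ℕ → S)
    (z : Vec M₁ M₂) : Vec M₁ M₂ :=
  (p.N : ℝ)⁻¹ • ∑ n ∈ Finset.range p.N, (gradient J (localIterate p q s z n) - gradient J z)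

/-- The averaged noise of the Hessian-vector products of one agent in one round. -/
def hessNoise (p : Params) (q : Vec M₁ M₂ → S → ℝ) (J : Vec M₁ M₂ → ℝ) (s : ℕ → S)
    (z z' : Vec M₁ M₂) : Vec M₁ M₂ :=
  (p.N : ℝ)⁻¹ • ∑ n ∈ Finset.range p.N, (hvp (fun w => q w (s n)) z z' - hvp J z z')

variable {p : Params}

theorem inv_smul_sum_const {V : Type*} [AddCommGroup V] [Module ℝ V] {N : ℕ} (hN : 0 < N) (v : V) :
    (N : ℝ)⁻¹ • ∑ _n ∈ Finset.range N, v = v := by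
  have : (N : ℝ) ≠ 0 := by exact_mod_cast hN.ne'
  rw [Finset.sum_const, Finset.card_range, ← Nat.cast_smul_eq_nsmul ℝ, smul_smul,
    inv_mul_cancel₀ this, one_smul]

theorem localGrad_eq (hN : 0 < p.N) (q : Vec M₁ M₂ → S → ℝ) (J : Vec M₁ M₂ → ℝ) (s : ℕ → S)
    (z : Vec M₁ M₂) :
    localGrad p q s z = gradient J z + gradNoise p q J s z + localBias p q J s z := by
  rw [gradNoise, localBias, localGrad, add_assoc, ← smul_add, ← Finset.sum_add_distrib]
  simp only [sub_add_sub_cancel]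
  rw [Finset.sum_sub_distrib, smul_sub, inv_smul_sum_const hN, add_sub_cancel]

theorem localCorrection_eq (hN : 0 < p.N) (q : Vec M₁ M₂ → S → ℝ) (J : Vec M₁ M₂ → ℝ) (s : ℕ → S)
    (z z' : Vec M₁ M₂) :
    localCorrection p q s z z' = hvp J z z' + hessNoise p q J s z z' := by
  rw [hessNoise, localCorrection, Finset.sum_sub_distrib, smul_sub, inv_smul_sum_const hN,
    add_sub_cancel]

/-- Normalized local steps cannot leave the ball of radius N(μ̄_x + μ̄_y) ≤ 2Nμ̄_y, whatever the
samples are, so the bias has a deterministic bound. -/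
theorem norm_localBias_le {L : ℝ} (hL : 0 ≤ L) (hN : 0 < p.N) (hx : 0 ≤ p.μbx)
    (hxy : p.μbx ≤ p.μby) {J : Vec M₁ M₂ → ℝ}
    (hJ : ∀ z w, ‖gradient J z - gradient J w‖ ≤ L * ‖z - w‖) (q : Vec M₁ M₂ → S → ℝ) (s : ℕ → S)
    (z : Vec M₁ M₂) : ‖localBias p q J s z‖ ≤ 2 * L * p.N * p.μby := by
  have hN' : (0 : ℝ) < p.N := by exact_mod_cast hN
  rw [localBias, norm_smul, norm_inv, Real.norm_natCast]
  have : ‖∑ n ∈ Finset.range p.N, (gradient J (localIterate p q s z n) - gradient J z)‖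
      ≤ p.N • (2 * L * p.N * p.μby) := by
    rw [← Finset.card_range p.N, ← Finset.sum_const, Finset.card_range]
    refine norm_sum_le_of_le _ fun n hn => (hJ _ _).trans ?_
    have h1 := norm_localIterate_sub_le hx (hx.trans hxy) q s z n
    have h2 : (n : ℝ) ≤ p.N := by exact_mod_cast (Finset.mem_range.1 hn).le
    calc L * ‖localIterate p q s z n - z‖ ≤ L * (n * (p.μbx + p.μby)) := by gcongr
      _ ≤ L * (p.N * (p.μby + p.μby)) := by
        have : 0 ≤ p.μby := hx.trans hxy
        gcongr
      _ = _ := by ring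
  rw [nsmul_eq_mul] at this
  rw [inv_mul_le_iff₀ hN']
  exact this

end Noise

/-- The conditions on costs, network and parameters under which the runs are analysed. -/
structure RunConditions (c : Constants) (p : Params) (A : Matrix (Fin K) (Fin K) ℝ)
    (J : Fin K → Vec M₁ M₂ → ℝ) : Prop where
  K_pos : 0 < K
  Lf_pos : 0 < c.Lf
  Lh_nonneg : 0 ≤ c.Lh
  lipschitz : ∀ k, LipschitzConditions c (J k)
  doublyStochastic : A ∈ doublyStochastic ℝ (Fin K)
  mixingRate_lt_one : mixingRate A < 1
  μx_nonneg : 0 ≤ p.μx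
  μx_le : p.μx ≤ p.μy
  μbx_nonneg : 0 ≤ p.μbx
  μbx_le : p.μbx ≤ p.μby
  γ_eq : p.γ = 1
  N_pos : 0 < p.N

/-! ### Deterministic bounds on the iterates -/

section Run

variable (p : Params) (Q : Fin K → Vec M₁ M₂ → S → ℝ) (A : Matrix (Fin K) (Fin K) ℝ)
  (z₀ zm : Vec M₁ M₂) (s : SampleIndex K → S) (J : Fin K → Vec M₁ M₂ → ℝ)

/-- The gradient noise of agent `k` in round `i`. -/
def runGradNoise (i : ℕ) (k : Fin K) : Vec M₁ M₂ :=
  gradNoise p (Q k) (J k) (fun n => s (k, some (i, n))) ((run p Q A z₀ zm s i).z k)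

/-- The Hessian noise of agent `k` in round `i`. -/
def runHessNoise (i : ℕ) (k : Fin K) : Vec M₁ M₂ :=
  hessNoise p (Q k) (J k) (fun n => s (k, some (i, n))) ((run p Q A z₀ zm s i).z k)
    ((run p Q A z₀ zm s i).zPrev k)

/-- The momentum error `m_{k,i-1} - ∇J_k(z_{k,i-1})` of agent `k`. -/
def momentumError (i : ℕ) (k : Fin K) : Vec M₁ M₂ :=
  (run p Q A z₀ zm s i).m k - gradient (J k) ((run p Q A z₀ zm s i).zPrev k)

/-- The error `∇J(z') + ∇²J(z)(z - z') - ∇J(z)` of the momentum correction of agent `k`. -/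
def taylorError (i : ℕ) (k : Fin K) : Vec M₁ M₂ :=
  gradient (J k) ((run p Q A z₀ zm s i).zPrev k)
    + hvp (J k) ((run p Q A z₀ zm s i).z k) ((run p Q A z₀ zm s i).zPrev k)
    - gradient (J k) ((run p Q A z₀ zm s i).z k)

/-- The local bias of agent `k` in round `i`. -/
def runBias (i : ℕ) (k : Fin K) : Vec M₁ M₂ :=
  localBias p (Q k) (J k) (fun n => s (k, some (i, n))) ((run p Q A z₀ zm s i).z k)

/-- The conservation law of tracking: mixing preserves averages, the momentum differences telescope,
and u = m at the start. -/
theorem centroid_u_eq_centroid_m (hA : A ∈ doublyStochastic ℝ (Fin K)) (i : ℕ) :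
    centroid (run p Q A z₀ zm s i).u = centroid (run p Q A z₀ zm s i).m := by
  induction i with
  | zero => rfl
  | succ i ih =>
    have h1 : centroid (run p Q A z₀ zm s (i + 1)).u
        = centroid fun k => (run p Q A z₀ zm s i).u k + (run p Q A z₀ zm s (i + 1)).m k
          - (run p Q A z₀ zm s i).m k := centroid_mix hA _
    rw [h1, centroid_sub, centroid_add, ih]
    exact add_sub_cancel_left _ _

/-- Mind the index: the state of round i stores u_{k,i-1}, so the direction used in round i is the
field `u` of the state i + 1. -/
theorem centroidIterate_succ (hA : A ∈ doublyStochastic ℝ (Fin K)) (i : ℕ) :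
    centroidIterate p Q A z₀ zm s (i + 1) = centroid fun k =>
      normalizedStep p.μx p.μy ((run p Q A z₀ zm s i).z k) ((run p Q A z₀ zm s (i + 1)).u k) :=
  centroid_mix hA _

variable {p Q A z₀ zm s J} {c : Constants}

theorem mixingRate_nonneg (A : Matrix (Fin K) (Fin K) ℝ) : 0 ≤ mixingRate A := norm_nonneg _

namespace RunConditions

variable (h : RunConditions c p A J)

include h

theorem K_pos' : (0 : ℝ) < K := by exact_mod_cast h.K_pos

theorem μy_nonneg : 0 ≤ p.μy := h.μx_nonneg.trans h.μx_le

theorem norm_centroidIterate_succ_sub_le (i : ℕ) :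
    ‖centroidIterate p Q A z₀ zm s (i + 1) - centroidIterate p Q A z₀ zm s i‖ ≤ 2 * p.μy := by
  rw [centroidIterate_succ p Q A z₀ zm s h.doublyStochastic, centroidIterate, ← centroid_sub]
  refine norm_centroid_le_of_forall_le h.K_pos fun k =>
    (norm_normalizedStep_sub_le h.μx_nonneg h.μy_nonneg _ _).trans ?_
  linarith [h.μx_le]

theorem norm_centroidIterate_sub_le (i : ℕ) :
    ‖centroidIterate p Q A z₀ zm s i - z₀‖ ≤ i * (2 * p.μy) := by
  induction i with
  | zero =>
    have : centroidIterate p Q A z₀ zm s 0 = z₀ := centroid_const h.K_pos z₀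
    simp [this]
  | succ i ih =>
    have h1 := h.norm_centroidIterate_succ_sub_le (Q := Q) (z₀ := z₀) (zm := zm) (s := s) i
    have := norm_add_le (centroidIterate p Q A z₀ zm s (i + 1) - centroidIterate p Q A z₀ zm s i)
      (centroidIterate p Q A z₀ zm s i - z₀)
    rw [sub_add_sub_cancel] at this
    push_cast
    linarith

/-- One round gives e ↦ λ(e + 2√K μ_y), since a normalized step has length at most 2μ_y. The bound
is the fixed point of this map, and the common start gives e = 0. -/
theorem consensusError_z_le (i : ℕ) :
    consensusError (run p Q A z₀ zm s i).z
      ≤ mixingRate A / (1 - mixingRate A) * (√K * (2 * p.μy)) := by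
  have hl := mixingRate_nonneg A
  have hl1 : 0 < 1 - mixingRate A := by linarith [h.mixingRate_lt_one]
  have hm := h.μy_nonneg
  induction i with
  | zero =>
    have : consensusError (run p Q A z₀ zm s 0).z = 0 := consensusError_const h.K_pos z₀
    rw [this]
    positivity
  | succ i ih =>
    set st := run p Q A z₀ zm s i
    set st' := run p Q A z₀ zm s (i + 1)
    have h1 : consensusError st'.z ≤ mixingRate A *
        consensusError (fun k => normalizedStep p.μx p.μy (st.z k) (st'.u k)) :=
      consensusError_mix_le h.doublyStochastic _
    have h2 := consensusError_add_le st.z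
      (fun k => normalizedStep p.μx p.μy (st.z k) (st'.u k) - st.z k)
    simp only [add_sub_cancel] at h2
    have h3 : consensusError (fun k => normalizedStep p.μx p.μy (st.z k) (st'.u k) - st.z k)
        ≤ √K * (2 * p.μy) := by
      refine (consensusError_le_netNorm h.K_pos _).trans
        (netNorm_le_of_forall_le (by linarith) fun k =>
          (norm_normalizedStep_sub_le h.μx_nonneg hm _ _).trans ?_)
      linarith [h.μx_le]
    calc consensusError st'.z
        ≤ mixingRate A * (mixingRate A / (1 - mixingRate A) * (√K * (2 * p.μy))
            + √K * (2 * p.μy)) := h1.trans (by gcongr; linarith)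
      _ = _ := by field_simp; ring

/-- The displacement consists of the consensus errors before and after the round and of the motion
of the centroid, which add up to 2(1 + λ)/(1 - λ) ≤ 4/(1 - λ) in units of √K μ_y. In round 0 the
assumption on the two starting points takes the place of this argument. -/
theorem netNorm_z_sub_zPrev_le (hz : CloseStart p z₀ zm) (i : ℕ) :
    netNorm (fun k => (run p Q A z₀ zm s i).z k - (run p Q A z₀ zm s i).zPrev k)
      ≤ √K * (4 * p.μy / (1 - mixingRate A)) := by
  have hl := mixingRate_nonneg A
  have hl1 : 0 < 1 - mixingRate A := by linarith [h.mixingRate_lt_one]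
  have hm := h.μy_nonneg
  cases i with
  | zero =>
    refine netNorm_le_of_forall_le (by positivity) fun k => ?_
    have h1 : ‖z₀ - zm‖ ≤ 2 * p.μy := by
      refine (norm_le_fst_add_snd _).trans ?_
      have h1 := hz.fst_le
      have h2 := hz.snd_le
      have h3 := h.μx_le
      rw [WithLp.sub_fst, WithLp.sub_snd]
      linarith
    refine h1.trans ?_
    rw [le_div_iff₀ hl1]
    nlinarith
  | succ i =>
    have h1 := netNorm_le_consensusError_add (fun k =>
      (run p Q A z₀ zm s (i + 1)).z k - (run p Q A z₀ zm s i).z k)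
    have h2 : consensusError (fun k =>
        (run p Q A z₀ zm s (i + 1)).z k - (run p Q A z₀ zm s i).z k)
        ≤ consensusError (run p Q A z₀ zm s (i + 1)).z + consensusError (run p Q A z₀ zm s i).z := by
      have := consensusError_add_le (run p Q A z₀ zm s (i + 1)).z
        (fun k => -(run p Q A z₀ zm s i).z k)
      have e : consensusError (fun k => -(run p Q A z₀ zm s i).z k)
          = consensusError (run p Q A z₀ zm s i).z := by
        have hc : centroid (fun k => -(run p Q A z₀ zm s i).z k)
            = -centroid (run p Q A z₀ zm s i).z := by simp [centroid]
        unfold consensusError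
        rw [hc, ← netNorm_neg]
        congr 1
        funext k
        rw [neg_sub_neg, neg_sub]
      rw [e] at this
      simpa only [sub_eq_add_neg] using this
    have h3 := h.consensusError_z_le (Q := Q) (z₀ := z₀) (zm := zm) (s := s) i
    have h4 := h.consensusError_z_le (Q := Q) (z₀ := z₀) (zm := zm) (s := s) (i + 1)
    have h5 := h.norm_centroidIterate_succ_sub_le (Q := Q) (z₀ := z₀) (zm := zm) (s := s) i
    rw [centroidIterate, centroidIterate, ← centroid_sub] at h5
    have h6 := mul_le_mul_of_nonneg_left h5 (Real.sqrt_nonneg K)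
    have h7 : 2 * (mixingRate A / (1 - mixingRate A) * (√K * (2 * p.μy))) + √K * (2 * p.μy)
        ≤ √K * (4 * p.μy / (1 - mixingRate A)) := by
      have e1 : 2 * (mixingRate A / (1 - mixingRate A) * (√K * (2 * p.μy))) + √K * (2 * p.μy)
        = √K * ((1 + mixingRate A) * 2 * p.μy / (1 - mixingRate A)) := by field_simp; ring
      rw [e1]
      gcongr
      nlinarith
    exact (h1.trans (add_le_add (h2.trans (add_le_add h4 h3)) h6)).trans (by linarith)

end RunConditions

end Run

end LocalDiMA

end

noncomputable section

namespace LocalDiMA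

variable {K M₁ M₂ : ℕ} {S : Type*}

/-! ### Momentum errors and tracking errors along a run -/

section Errors

variable {p : Params} {Q : Fin K → Vec M₁ M₂ → S → ℝ} {A : Matrix (Fin K) (Fin K) ℝ}
  {z₀ zm : Vec M₁ M₂} {s : SampleIndex K → S} {J : Fin K → Vec M₁ M₂ → ℝ} {c : Constants}

namespace RunConditions

variable (h : RunConditions c p A J)

include h

theorem m_succ (i : ℕ) (k : Fin K) :
    (run p Q A z₀ zm s (i + 1)).m k =
      (1 - p.β) • ((run p Q A z₀ zm s i).m k
        + (hvp (J k) ((run p Q A z₀ zm s i).z k) ((run p Q A z₀ zm s i).zPrev k)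
          + runHessNoise p Q A z₀ zm s J i k))
      + p.β • (gradient (J k) ((run p Q A z₀ zm s i).z k) + runGradNoise p Q A z₀ zm s J i k
          + runBias p Q A z₀ zm s J i k) := by
  have h1 : (run p Q A z₀ zm s (i + 1)).m k
      = newMomentum p Q (fun k n => s (k, some (i, n))) (run p Q A z₀ zm s i) k := rfl
  rw [h1, newMomentum, h.γ_eq, one_smul, localCorrection_eq h.N_pos (Q k) (J k),
    localGrad_eq h.N_pos (Q k) (J k)]
  rfl

/-- The correction moves the target of the old momentum from the gradient at the previous iterate to
the gradient at the current one. What remains of the change of gradients is the Taylor error. -/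
theorem momentumError_succ (i : ℕ) (k : Fin K) :
    momentumError p Q A z₀ zm s J (i + 1) k =
      (1 - p.β) • momentumError p Q A z₀ zm s J i k
      + ((1 - p.β) • runHessNoise p Q A z₀ zm s J i k + p.β • runGradNoise p Q A z₀ zm s J i k)
      + ((1 - p.β) • taylorError p Q A z₀ zm s J i k + p.β • runBias p Q A z₀ zm s J i k) := by
  have h1 : momentumError p Q A z₀ zm s J (i + 1) k
      = (run p Q A z₀ zm s (i + 1)).m k - gradient (J k) ((run p Q A z₀ zm s i).z k) := rfl
  rw [h1, h.m_succ, momentumError, taylorError]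
  module

/-- Here the old momentum error enters only with the factor β, which is exactly the weight for which
its sum over the rounds is controlled without 1/β. -/
theorem m_succ_sub (i : ℕ) (k : Fin K) :
    (run p Q A z₀ zm s (i + 1)).m k - (run p Q A z₀ zm s i).m k =
      -(p.β • momentumError p Q A z₀ zm s J i k)
      + ((1 - p.β) • runHessNoise p Q A z₀ zm s J i k + p.β • runGradNoise p Q A z₀ zm s J i k)
      + ((1 - p.β) • hvp (J k) ((run p Q A z₀ zm s i).z k) ((run p Q A z₀ zm s i).zPrev k)
        + p.β • (gradient (J k) ((run p Q A z₀ zm s i).z k)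
          - gradient (J k) ((run p Q A z₀ zm s i).zPrev k)))
      + p.β • runBias p Q A z₀ zm s J i k := by
  rw [h.m_succ, momentumError]
  module

theorem norm_runBias_le (i : ℕ) (k : Fin K) :
    ‖runBias p Q A z₀ zm s J i k‖ ≤ 2 * c.Lf * p.N * p.μby :=
  norm_localBias_le h.Lf_pos.le h.N_pos h.μbx_nonneg h.μbx_le (h.lipschitz k).gradient_lipschitz
    _ _ _

theorem netNorm_taylorError_le (hz : CloseStart p z₀ zm) (i : ℕ) :
    netNorm (taylorError p Q A z₀ zm s J i)
      ≤ 2 * c.Lf * (√K * (4 * p.μy / (1 - mixingRate A))) := by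
  have hL := h.Lf_pos
  have h1 : netNorm (taylorError p Q A z₀ zm s J i) ≤ netNorm (fun k => (2 * c.Lf) •
      ((run p Q A z₀ zm s i).z k - (run p Q A z₀ zm s i).zPrev k)) :=
    netNorm_mono fun k => by
      rw [norm_smul, Real.norm_of_nonneg (by positivity)]
      exact (h.lipschitz k).gradient_taylor' hL.le _ _
  rw [netNorm_smul, abs_of_pos (by positivity)] at h1
  exact h1.trans (mul_le_mul_of_nonneg_left (h.netNorm_z_sub_zPrev_le hz i) (by positivity))

/-- In the network average the quadratic Taylor bound produces the mean of the squared
displacements, for which the network norm is sharp. No power of K is lost, unlike in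
`netNorm_taylorError_le`. -/
theorem norm_centroid_taylorError_le (hz : CloseStart p z₀ zm) (i : ℕ) :
    ‖centroid (taylorError p Q A z₀ zm s J i)‖
      ≤ c.Lh * (4 * p.μy / (1 - mixingRate A)) ^ 2 := by
  have hK := h.K_pos'
  have h1 := h.netNorm_z_sub_zPrev_le (Q := Q) (s := s) hz i
  have h2 := pow_le_pow_left₀ (netNorm_nonneg _) h1 2
  rw [netNorm_sq, mul_pow, Real.sq_sqrt hK.le] at h2
  refine (norm_centroid_le _).trans ?_
  calc (K : ℝ)⁻¹ * ∑ k, ‖taylorError p Q A z₀ zm s J i k‖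
      ≤ (K : ℝ)⁻¹ * ∑ k, c.Lh * ‖(run p Q A z₀ zm s i).z k - (run p Q A z₀ zm s i).zPrev k‖ ^ 2 := by
        gcongr with k _
        exact (h.lipschitz k).gradient_taylor h.Lh_nonneg _ _
    _ ≤ (K : ℝ)⁻¹ * (c.Lh * (K * (4 * p.μy / (1 - mixingRate A)) ^ 2)) := by
        rw [← Finset.mul_sum]
        have := h.Lh_nonneg
        gcongr
    _ = _ := by field_simp

variable (hβ : 0 < p.β) (hβ1 : p.β ≤ 1)

include hβ hβ1

section Projected

variable {W : Type*} [NormedAddCommGroup W] [InnerProductSpace ℝ W]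
  {L : Vec M₁ M₂ →L[ℝ] W} (hL : ∀ v, ‖L v‖ ≤ ‖v‖)

include hL

omit h in
theorem netNorm_noise_le (i : ℕ) :
    netNorm (fun k => L ((1 - p.β) • runHessNoise p Q A z₀ zm s J i k
      + p.β • runGradNoise p Q A z₀ zm s J i k))
    ≤ netNorm (runHessNoise p Q A z₀ zm s J i) + p.β * netNorm (runGradNoise p Q A z₀ zm s J i) := by
  refine (netNorm_mono (w := fun k => (1 - p.β) • runHessNoise p Q A z₀ zm s J i k
      + p.β • runGradNoise p Q A z₀ zm s J i k) fun k => hL _).trans ((netNorm_add_le _ _).trans ?_)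
  rw [netNorm_smul, netNorm_smul, abs_of_pos hβ, abs_of_nonneg (by linarith)]
  gcongr
  exact mul_le_of_le_one_left (netNorm_nonneg _) (by linarith)

/-- The map `L` stands for the projection to the x-block or to the y-block, which carry different
weights in the final bound. Any linear map of norm at most one works. -/
theorem netNorm_momentumError_succ_le (hz : CloseStart p z₀ zm) (i : ℕ) :
    netNorm (fun k => L (momentumError p Q A z₀ zm s J (i + 1) k))
      ≤ (1 - p.β) * netNorm (fun k => L (momentumError p Q A z₀ zm s J i k))
        + (netNorm (runHessNoise p Q A z₀ zm s J i)
          + p.β * netNorm (runGradNoise p Q A z₀ zm s J i)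
          + 2 * c.Lf * (√K * (4 * p.μy / (1 - mixingRate A)))
          + p.β * (√K * (2 * c.Lf * p.N * p.μby))) := by
  have hLf := h.Lf_pos
  simp only [h.momentumError_succ, map_add, map_smul]
  have h1 := netNorm_add_le
    (fun k => (1 - p.β) • L (momentumError p Q A z₀ zm s J i k)
      + ((1 - p.β) • L (runHessNoise p Q A z₀ zm s J i k)
        + p.β • L (runGradNoise p Q A z₀ zm s J i k)))
    (fun k => (1 - p.β) • L (taylorError p Q A z₀ zm s J i k)
      + p.β • L (runBias p Q A z₀ zm s J i k))
  have h2 := netNorm_add_le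
    (fun k => (1 - p.β) • L (momentumError p Q A z₀ zm s J i k))
    (fun k => (1 - p.β) • L (runHessNoise p Q A z₀ zm s J i k)
        + p.β • L (runGradNoise p Q A z₀ zm s J i k))
  have h3 := netNorm_add_le (fun k => (1 - p.β) • L (taylorError p Q A z₀ zm s J i k))
    (fun k => p.β • L (runBias p Q A z₀ zm s J i k))
  have h4 := netNorm_noise_le (A := A) (J := J) (Q := Q) (z₀ := z₀) (zm := zm) (s := s) hβ hβ1 hL i
  simp only [map_add, map_smul] at h4
  rw [netNorm_smul, abs_of_nonneg (by linarith)] at h2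
  rw [netNorm_smul, netNorm_smul, abs_of_nonneg (by linarith), abs_of_pos hβ] at h3
  have h5 : netNorm (fun k => L (taylorError p Q A z₀ zm s J i k))
      ≤ 2 * c.Lf * (√K * (4 * p.μy / (1 - mixingRate A))) :=
    (netNorm_mono fun k => hL _).trans (h.netNorm_taylorError_le hz i)
  have h6 : netNorm (fun k => L (runBias p Q A z₀ zm s J i k))
      ≤ √K * (2 * c.Lf * p.N * p.μby) := by
    refine netNorm_le_of_forall_le ?_ fun k => (hL _).trans (h.norm_runBias_le i k)
    have := h.μbx_nonneg.trans h.μbx_le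
    positivity
  have h7 := mul_le_mul_of_nonneg_left h6 hβ.le
  have h8 := (mul_le_of_le_one_left (netNorm_nonneg fun k => L (taylorError p Q A z₀ zm s J i k))
    (by linarith : 1 - p.β ≤ 1)).trans h5
  linarith

theorem netNorm_m_succ_sub_le (hz : CloseStart p z₀ zm) (i : ℕ) :
    netNorm (fun k => L ((run p Q A z₀ zm s (i + 1)).m k - (run p Q A z₀ zm s i).m k))
      ≤ p.β * netNorm (fun k => L (momentumError p Q A z₀ zm s J i k))
        + (netNorm (runHessNoise p Q A z₀ zm s J i)
          + p.β * netNorm (runGradNoise p Q A z₀ zm s J i)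
          + c.Lf * (√K * (4 * p.μy / (1 - mixingRate A)))
          + p.β * (√K * (2 * c.Lf * p.N * p.μby))) := by
  have hLf := h.Lf_pos
  simp only [h.m_succ_sub (J := J)]
  set D : Fin K → Vec M₁ M₂ := fun k =>
    (1 - p.β) • hvp (J k) ((run p Q A z₀ zm s i).z k) ((run p Q A z₀ zm s i).zPrev k)
        + p.β • (gradient (J k) ((run p Q A z₀ zm s i).z k)
          - gradient (J k) ((run p Q A z₀ zm s i).zPrev k)) with hD
  set E : Fin K → Vec M₁ M₂ := fun k => (1 - p.β) • runHessNoise p Q A z₀ zm s J i k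
    + p.β • runGradNoise p Q A z₀ zm s J i k with hE
  -- Each `D k` is a convex combination, with weights 1 - β and β, of two vectors of norm at most
  -- L_f times the displacement.
  have h0 : netNorm (fun k => L (D k)) ≤ c.Lf * (√K * (4 * p.μy / (1 - mixingRate A))) := by
    have h1 : netNorm (fun k => L (D k)) ≤ netNorm (fun k => c.Lf •
        ((run p Q A z₀ zm s i).z k - (run p Q A z₀ zm s i).zPrev k)) :=
      netNorm_mono fun k => by
        refine (hL _).trans ?_
        rw [norm_smul, Real.norm_of_nonneg hLf.le]
        have e1 := (h.lipschitz k).gradient_lipschitz ((run p Q A z₀ zm s i).z k)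
          ((run p Q A z₀ zm s i).zPrev k)
        have e2 : ‖hvp (J k) ((run p Q A z₀ zm s i).z k) ((run p Q A z₀ zm s i).zPrev k)‖
            ≤ c.Lf * ‖(run p Q A z₀ zm s i).z k - (run p Q A z₀ zm s i).zPrev k‖ :=
          ((hess (J k) _).le_opNorm _).trans
            (mul_le_mul_of_nonneg_right ((h.lipschitz k).norm_hess_le hLf.le _) (norm_nonneg _))
        refine (norm_add_le _ _).trans ?_
        rw [norm_smul, norm_smul, Real.norm_of_nonneg hβ.le,
          Real.norm_of_nonneg (by linarith : 0 ≤ 1 - p.β)]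
        have e3 := mul_le_mul_of_nonneg_left e1 hβ.le
        have e4 := mul_le_mul_of_nonneg_left e2 (by linarith : 0 ≤ 1 - p.β)
        linarith
    rw [netNorm_smul, abs_of_pos hLf] at h1
    exact h1.trans (mul_le_mul_of_nonneg_left (h.netNorm_z_sub_zPrev_le hz i) hLf.le)
  have h1 := netNorm_add_le
    (fun k => L (-(p.β • momentumError p Q A z₀ zm s J i k) + E k + D k))
    (fun k => p.β • L (runBias p Q A z₀ zm s J i k))
  have h2 := netNorm_add_le
    (fun k => L (-(p.β • momentumError p Q A z₀ zm s J i k) + E k)) (fun k => L (D k))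
  have h3 := netNorm_add_le
    (fun k => L (-(p.β • momentumError p Q A z₀ zm s J i k))) (fun k => L (E k))
  have h4 : netNorm (fun k => L (-(p.β • momentumError p Q A z₀ zm s J i k)))
      = p.β * netNorm (fun k => L (momentumError p Q A z₀ zm s J i k)) := by
    simp only [map_neg, map_smul, netNorm_neg]
    rw [netNorm_smul, abs_of_pos hβ]
  have h5 : netNorm (fun k => L (E k)) ≤ _ :=
    netNorm_noise_le (A := A) (J := J) (Q := Q) (z₀ := z₀) (zm := zm) (s := s) hβ hβ1 hL i
  have h6 : netNorm (fun k => L (runBias p Q A z₀ zm s J i k))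
      ≤ √K * (2 * c.Lf * p.N * p.μby) := by
    refine netNorm_le_of_forall_le ?_ fun k => (hL _).trans (h.norm_runBias_le i k)
    have := h.μbx_nonneg.trans h.μbx_le
    positivity
  have h7 := mul_le_mul_of_nonneg_left h6 hβ.le
  rw [netNorm_smul, abs_of_pos hβ] at h1
  simp only [← map_add, ← map_smul] at h1 h2 h3 ⊢
  linarith

variable [FiniteDimensional ℝ W]

omit h hβ hβ1 hL in
theorem consensusError_u_succ_le (h : RunConditions c p A J) (i : ℕ) :
    consensusError (fun k => L ((run p Q A z₀ zm s (i + 1)).u k))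
      ≤ mixingRate A * (consensusError (fun k => L ((run p Q A z₀ zm s i).u k))
        + netNorm fun k => L ((run p Q A z₀ zm s (i + 1)).m k - (run p Q A z₀ zm s i).m k)) := by
  have e : (fun k => L ((run p Q A z₀ zm s (i + 1)).u k)) = fun k => ∑ l, A k l •
      (L ((run p Q A z₀ zm s i).u l)
        + L ((run p Q A z₀ zm s (i + 1)).m l - (run p Q A z₀ zm s i).m l)) := by
    funext k
    have h1 : (run p Q A z₀ zm s (i + 1)).u k = ∑ l, A k l • ((run p Q A z₀ zm s i).u l
      + (run p Q A z₀ zm s (i + 1)).m l - (run p Q A z₀ zm s i).m l) := rfl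
    rw [h1, map_sum]
    simp only [map_smul, ← map_add, add_sub_assoc]
  rw [e]
  refine (consensusError_mix_le h.doublyStochastic _).trans
    (mul_le_mul_of_nonneg_left ?_ (mixingRate_nonneg A))
  exact (consensusError_add_le _ _).trans
    (add_le_add le_rfl (consensusError_le_netNorm h.K_pos _))

/-- The accumulated consensus error of the tracking variables. -/
theorem sum_consensusError_u_le (hz : CloseStart p z₀ zm) (T : ℕ) :
    ∑ i ∈ Finset.range T, consensusError (fun k => L ((run p Q A z₀ zm s (i + 1)).u k))
      ≤ mixingRate A / (1 - mixingRate A) *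
        (consensusError (fun k => L ((run p Q A z₀ zm s 0).u k))
          + netNorm (fun k => L (momentumError p Q A z₀ zm s J 0 k))
          + ∑ i ∈ Finset.range T, (2 * netNorm (runHessNoise p Q A z₀ zm s J i)
            + 2 * p.β * netNorm (runGradNoise p Q A z₀ zm s J i)
            + 3 * c.Lf * (√K * (4 * p.μy / (1 - mixingRate A)))
            + 2 * p.β * (√K * (2 * c.Lf * p.N * p.μby)))) := by
  have hl := mixingRate_nonneg A
  have hl1 : 0 < 1 - mixingRate A := by linarith [h.mixingRate_lt_one]
  have h1 := sum_le_of_tracking hl h.mixingRate_lt_one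
    (t := fun i => consensusError (fun k => L ((run p Q A z₀ zm s i).u k)))
    (v := fun i => netNorm fun k => L ((run p Q A z₀ zm s (i + 1)).m k - (run p Q A z₀ zm s i).m k))
    (fun i => consensusError_nonneg _) (fun i => h.consensusError_u_succ_le i) T
  -- This bounds β∑e by the initial error and the forcing terms, and `h3` contains precisely β∑e.
  -- Noise and bias are thus counted twice, and the displacement with 2L_f + L_f = 3L_f.
  have h2 := mul_sum_le_of_contraction
    (e := fun i => netNorm (fun k => L (momentumError p Q A z₀ zm s J i k)))
    (fun i => netNorm_nonneg _)
    (fun i => h.netNorm_momentumError_succ_le (Q := Q) (s := s) hβ hβ1 hL hz i) T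
  have h3 := Finset.sum_le_sum fun i (_ : i ∈ Finset.range T) =>
    h.netNorm_m_succ_sub_le (Q := Q) (s := s) hβ hβ1 hL hz i
  rw [Finset.sum_add_distrib, ← Finset.mul_sum] at h3
  refine h1.trans (mul_le_mul_of_nonneg_left ?_ (by positivity))
  have h4 := h3.trans (add_le_add h2 le_rfl)
  rw [add_assoc, ← Finset.sum_add_distrib] at h4
  rw [add_assoc]
  refine add_le_add le_rfl (h4.trans (add_le_add le_rfl (Finset.sum_le_sum fun i _ => le_of_eq ?_)))
  ring

end Projected

/-- The averaged momentum error is a discounted sum of noise terms up to a bias. -/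
theorem norm_centroid_momentumError_le (hz : CloseStart p z₀ zm) (i : ℕ) :
    ‖centroid (momentumError p Q A z₀ zm s J i)‖
      ≤ (1 - p.β) ^ i * ‖centroid (momentumError p Q A z₀ zm s J 0)‖
        + ‖discountedSum p.β (fun j => centroid (runHessNoise p Q A z₀ zm s J j)) i‖
        + p.β * ‖discountedSum p.β (fun j => centroid (runGradNoise p Q A z₀ zm s J j)) i‖
        + (c.Lh * (4 * p.μy / (1 - mixingRate A)) ^ 2 / p.β + 2 * c.Lf * p.N * p.μby) := by
  have hβ' : 0 ≤ 1 - p.β := by linarith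
  set H := fun j => centroid (runHessNoise p Q A z₀ zm s J j)
  set G := fun j => centroid (runGradNoise p Q A z₀ zm s J j)
  set B := c.Lh * (4 * p.μy / (1 - mixingRate A)) ^ 2 / p.β + 2 * c.Lf * p.N * p.μby with hB
  -- The deviation from the explicit solution of the noise recursion starts at 0 and obeys d ↦ (1 -
  -- β)d + Taylor error + β·bias. The bound `B` is the fixed point of this recursion, so it persists
  -- by induction.
  suffices key : ‖centroid (momentumError p Q A z₀ zm s J i)
      - ((1 - p.β) ^ i • centroid (momentumError p Q A z₀ zm s J 0)
        + (1 - p.β) • discountedSum p.β H i + p.β • discountedSum p.β G i)‖ ≤ B by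
    have h1 := norm_sub_norm_le (centroid (momentumError p Q A z₀ zm s J i))
      ((1 - p.β) ^ i • centroid (momentumError p Q A z₀ zm s J 0)
        + (1 - p.β) • discountedSum p.β H i + p.β • discountedSum p.β G i)
    have h2 := norm_add₃_le (a := (1 - p.β) ^ i • centroid (momentumError p Q A z₀ zm s J 0))
      (b := (1 - p.β) • discountedSum p.β H i) (c := p.β • discountedSum p.β G i)
    rw [norm_smul, norm_smul, norm_smul, Real.norm_of_nonneg hβ.le, Real.norm_of_nonneg hβ',
      Real.norm_of_nonneg (pow_nonneg hβ' i)] at h2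
    have h3 := mul_le_of_le_one_left (norm_nonneg (discountedSum p.β H i))
      (by linarith : 1 - p.β ≤ 1)
    linarith
  induction i with
  | zero =>
    have := h.Lh_nonneg
    have := h.Lf_pos
    have := h.μbx_nonneg.trans h.μbx_le
    have : 0 ≤ B := by positivity
    simpa [discountedSum] using this
  | succ i ih =>
    have e : centroid (momentumError p Q A z₀ zm s J (i + 1))
        = (1 - p.β) • centroid (momentumError p Q A z₀ zm s J i)
          + ((1 - p.β) • H i + p.β • G i)
          + ((1 - p.β) • centroid (taylorError p Q A z₀ zm s J i)
            + p.β • centroid (runBias p Q A z₀ zm s J i)) := by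
      have : momentumError p Q A z₀ zm s J (i + 1) = fun k => _ :=
        funext fun k => h.momentumError_succ i k
      rw [this]
      simp only [centroid_add, centroid_smul]
      rfl
    rw [e, discountedSum_succ, discountedSum_succ, pow_succ]
    have e2 : (1 - p.β) • centroid (momentumError p Q A z₀ zm s J i)
          + ((1 - p.β) • H i + p.β • G i)
          + ((1 - p.β) • centroid (taylorError p Q A z₀ zm s J i)
            + p.β • centroid (runBias p Q A z₀ zm s J i))
        - (((1 - p.β) ^ i * (1 - p.β)) • centroid (momentumError p Q A z₀ zm s J 0)
          + (1 - p.β) • ((1 - p.β) • discountedSum p.β H i + H i)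
          + p.β • ((1 - p.β) • discountedSum p.β G i + G i))
        = (1 - p.β) • (centroid (momentumError p Q A z₀ zm s J i)
          - ((1 - p.β) ^ i • centroid (momentumError p Q A z₀ zm s J 0)
            + (1 - p.β) • discountedSum p.β H i + p.β • discountedSum p.β G i))
          + (1 - p.β) • centroid (taylorError p Q A z₀ zm s J i)
          + p.β • centroid (runBias p Q A z₀ zm s J i) := by module
    rw [e2]
    refine norm_add₃_le.trans ?_
    rw [norm_smul, norm_smul, norm_smul, Real.norm_of_nonneg hβ.le, Real.norm_of_nonneg hβ']
    have h1 := h.norm_centroid_taylorError_le (Q := Q) (s := s) hz i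
    have h2 : ‖centroid (runBias p Q A z₀ zm s J i)‖ ≤ 2 * c.Lf * p.N * p.μby :=
      norm_centroid_le_of_forall_le h.K_pos fun k => h.norm_runBias_le i k
    have h3 := (mul_le_of_le_one_left (norm_nonneg (centroid (taylorError p Q A z₀ zm s J i)))
      (by linarith : 1 - p.β ≤ 1)).trans h1
    have h4 := mul_le_mul_of_nonneg_left h2 hβ.le
    have h5 := mul_le_mul_of_nonneg_left ih hβ'
    have h6 : p.β * (c.Lh * (4 * p.μy / (1 - mixingRate A)) ^ 2 / p.β)
        = c.Lh * (4 * p.μy / (1 - mixingRate A)) ^ 2 := by field_simp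
    have h7 : (1 - p.β) * B = B - (p.β * (c.Lh * (4 * p.μy / (1 - mixingRate A)) ^ 2 / p.β)
        + p.β * (2 * c.Lf * p.N * p.μby)) := by rw [hB]; ring
    linarith

omit hβ hβ1 in
/-- The error of the search directions at the centroid. -/
theorem avg_direction_error_le {W : Type*} [NormedAddCommGroup W] [InnerProductSpace ℝ W]
    {L : Vec M₁ M₂ →L[ℝ] W} (hL : ∀ v, ‖L v‖ ≤ ‖v‖) (i : ℕ) :
    (K : ℝ)⁻¹ * ∑ k, ‖L ((run p Q A z₀ zm s (i + 1)).u k)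
        - L (centroid fun k => gradient (J k) (centroidIterate p Q A z₀ zm s i))‖
      ≤ consensusError (fun k => L ((run p Q A z₀ zm s (i + 1)).u k)) / √K
        + ‖centroid (momentumError p Q A z₀ zm s J (i + 1))‖
        + c.Lf * (mixingRate A / (1 - mixingRate A) * (2 * p.μy)) := by
  have hK := h.K_pos'
  have hLf := h.Lf_pos
  set zc := centroidIterate p Q A z₀ zm s i
  set u := (run p Q A z₀ zm s (i + 1)).u
  set z := (run p Q A z₀ zm s i).z
  -- The tracking and momentum averages agree, and the previous iterates of the state i + 1 are the
  -- iterates of round i.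
  have e1 : centroid (momentumError p Q A z₀ zm s J (i + 1))
      = centroid u - centroid fun k => gradient (J k) (z k) := by
    rw [centroid_u_eq_centroid_m p Q A z₀ zm s h.doublyStochastic, ← centroid_sub]
    rfl
  have hb : ‖centroid (fun k => gradient (J k) (z k)) - centroid fun k => gradient (J k) zc‖
      ≤ c.Lf * (mixingRate A / (1 - mixingRate A) * (2 * p.μy)) := by
    rw [← centroid_sub]
    refine (norm_centroid_le _).trans ?_
    calc (K : ℝ)⁻¹ * ∑ k, ‖gradient (J k) (z k) - gradient (J k) zc‖
        ≤ (K : ℝ)⁻¹ * ∑ k, c.Lf * ‖z k - zc‖ := by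
          gcongr with k _
          exact (h.lipschitz k).gradient_lipschitz _ _
      _ = c.Lf * ((K : ℝ)⁻¹ * ∑ k, ‖z k - zc‖) := by rw [← Finset.mul_sum]; ring
      _ ≤ c.Lf * (consensusError z / √K) := by
          gcongr
          exact avg_norm_le h.K_pos fun k => z k - zc
      _ ≤ _ := by
          gcongr
          rw [div_le_iff₀ (Real.sqrt_pos.2 hK)]
          refine (h.consensusError_z_le i).trans (le_of_eq ?_)
          ring
  have hp : ∀ k, ‖L (u k) - L (centroid fun k => gradient (J k) zc)‖
      ≤ ‖L (u k) - centroid (fun k => L (u k))‖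
        + (‖centroid (momentumError p Q A z₀ zm s J (i + 1))‖
          + c.Lf * (mixingRate A / (1 - mixingRate A) * (2 * p.μy))) := fun k => by
    -- Three contributions: disagreement of the tracking variables, averaged momentum error, and
    -- evaluation of the local gradients at z_k instead of at the centroid.
    have e2 : L (u k) - L (centroid fun k => gradient (J k) zc)
        = (L (u k) - centroid (fun k => L (u k)))
          + L (centroid (momentumError p Q A z₀ zm s J (i + 1))
            + (centroid (fun k => gradient (J k) (z k)) - centroid fun k => gradient (J k) zc)) := by
      rw [e1, sub_add_sub_cancel, map_sub, map_centroid L u, sub_add_sub_cancel]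
    rw [e2]
    exact (norm_add_le _ _).trans (add_le_add le_rfl ((hL _).trans
      ((norm_add_le _ _).trans (add_le_add le_rfl hb))))
  calc _ ≤ (K : ℝ)⁻¹ * ∑ k, (‖L (u k) - centroid (fun k => L (u k))‖
        + (‖centroid (momentumError p Q A z₀ zm s J (i + 1))‖
          + c.Lf * (mixingRate A / (1 - mixingRate A) * (2 * p.μy)))) := by
        gcongr with k _
        exact hp k
    _ = (K : ℝ)⁻¹ * ∑ k, ‖L (u k) - centroid (fun k => L (u k))‖
        + (‖centroid (momentumError p Q A z₀ zm s J (i + 1))‖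
          + c.Lf * (mixingRate A / (1 - mixingRate A) * (2 * p.μy))) := by
        rw [Finset.sum_add_distrib, mul_add]
        simp
        field_simp
    _ ≤ _ := by
        rw [add_assoc]
        gcongr
        exact avg_norm_le h.K_pos fun k => L (u k) - centroid (fun k => L (u k))

end RunConditions

end Errors

end LocalDiMA

end

/-! ### The summed bound along one realization of the samples -/

noncomputable section

namespace LocalDiMA

variable {K M₁ M₂ : ℕ} {S : Type*}

theorem gradient_const_mul_sum {E : Type*} [NormedAddCommGroup E] [InnerProductSpace ℝ E]
    [CompleteSpace E] (a : ℝ) {f : Fin K → E → ℝ} (hf : ∀ k, Differentiable ℝ (f k)) (z : E) :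
    gradient (fun w => a * ∑ k, f k w) z = a • ∑ k, gradient (f k) z := by
  have h1 : HasFDerivAt (fun w => a * ∑ k, f k w) (a • ∑ k, fderiv ℝ (f k) z) z :=
    (HasFDerivAt.fun_sum fun k _ => (hf k z).hasFDerivAt).const_mul _
  simp [gradient, h1.fderiv]

section Pathwise

variable [MeasurableSpace S] {c : Constants} {p : Params} {Q : Fin K → Vec M₁ M₂ → S → ℝ}
  {𝒟 : Fin K → Measure S} {A : Matrix (Fin K) (Fin K) ℝ}

theorem gradient_globalCost (hJ : ∀ k, Differentiable ℝ (localCost Q 𝒟 k)) (z : Vec M₁ M₂) :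
    gradient (globalCost Q 𝒟) z = centroid fun k => gradient (localCost Q 𝒟 k) z := by
  exact gradient_const_mul_sum _ hJ z

theorem Assumptions.smoothPL (h : Assumptions c Q 𝒟 A) : SmoothPL c (globalCost Q 𝒟) where
  ν_pos := h.ν_pos
  one_le_κ := h.one_le_κ
  differentiable := by
    have : ∀ k, Differentiable ℝ (localCost Q 𝒟 k) := fun k => (h.lipschitz k).differentiable
    exact (Differentiable.fun_sum fun k _ => this k).const_mul _
  gradient_lipschitz z w := by
    rw [gradient_globalCost fun k => (h.lipschitz k).differentiable,
      gradient_globalCost fun k => (h.lipschitz k).differentiable, ← centroid_sub]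
    exact norm_centroid_le_of_forall_le h.agents_pos fun k => (h.lipschitz k).gradient_lipschitz z w
  cost := h.cost

theorem Assumptions.runConditions (h : Assumptions c Q 𝒟 A) (hp : StepConditions c p) :
    RunConditions c p A (localCost Q 𝒟) where
  K_pos := h.agents_pos
  Lf_pos := Lf_pos_of h.ν_pos h.one_le_κ
  Lh_nonneg := h.Lh_nonneg
  lipschitz := h.lipschitz
  doublyStochastic := h.mixing.doublyStochastic
  mixingRate_lt_one := h.mixing.mixingRate_lt_one
  μx_nonneg := hp.μx_pos.le
  μx_le := by
    have h1 := hp.μx_le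
    have h2 := h.one_le_κ
    have h3 := hp.μx_pos
    rw [le_div_iff₀ (by linarith)] at h1
    nlinarith
  μbx_nonneg := hp.μbx_pos.le
  μbx_le := hp.μbx_le
  γ_eq := hp.γ_eq
  N_pos := hp.N_pos

theorem sum_one_sub_pow_le {β : ℝ} (hβ : 0 < β) (hβ1 : β ≤ 1) (T : ℕ) :
    ∑ i ∈ Finset.range T, (1 - β) ^ i ≤ 1 / β := by
  have := mul_sum_le_of_contraction (β := β) (e := fun i => (1 - β) ^ i) (w := fun _ => 0)
    (fun i => pow_nonneg (by linarith) i) (fun i => by rw [pow_succ, add_zero, mul_comm]) T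
  rw [le_div_iff₀ hβ]
  simp only [pow_zero, Finset.sum_const_zero, add_zero] at this
  linarith

/-- The stationarity measure along one realization of the samples. -/
theorem Assumptions.sum_gradNorms_le (h : Assumptions c Q 𝒟 A) (hp : StepConditions c p)
    (hβ1 : p.β ≤ 1) {z₀ zm : Vec M₁ M₂} (hz : CloseStart p z₀ zm) (s : SampleIndex K → S) (T : ℕ) :
    ∑ i ∈ Finset.range T, gradNorms (globalCost Q 𝒟) (centroidIterate p Q A z₀ zm s i) ≤
      (envelope (globalCost Q 𝒟) z₀.fst - optValue (globalCost Q 𝒟)) / p.μx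
      + 6 * c.κ * (initialGap (globalCost Q 𝒟) z₀ / p.μy)
      + T * (c.L * p.μx + 6 * c.κ * (c.Lf * p.μx / 4 + 4 * c.Lf * p.μy))
      + mixingRate A / (1 - mixingRate A) / √K *
        (2 * (consensusError (fun k => ((run p Q A z₀ zm s 0).u k).fst)
            + netNorm (fun k => (momentumError p Q A z₀ zm s (localCost Q 𝒟) 0 k).fst))
          + 12 * c.κ * (consensusError (fun k => ((run p Q A z₀ zm s 0).u k).snd)
            + netNorm (fun k => (momentumError p Q A z₀ zm s (localCost Q 𝒟) 0 k).snd)))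
      + 14 * c.κ * ∑ i ∈ Finset.range T,
        (mixingRate A / (1 - mixingRate A) / √K *
          (2 * netNorm (runHessNoise p Q A z₀ zm s (localCost Q 𝒟) i)
            + 2 * p.β * netNorm (runGradNoise p Q A z₀ zm s (localCost Q 𝒟) i)
            + 3 * c.Lf * (√K * (4 * p.μy / (1 - mixingRate A)))
            + 2 * p.β * (√K * (2 * c.Lf * p.N * p.μby)))
        + (1 - p.β) ^ (i + 1) * ‖centroid (momentumError p Q A z₀ zm s (localCost Q 𝒟) 0)‖
        + ‖discountedSum p.β (fun j => centroid (runHessNoise p Q A z₀ zm s (localCost Q 𝒟) j))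
            (i + 1)‖
        + p.β * ‖discountedSum p.β
            (fun j => centroid (runGradNoise p Q A z₀ zm s (localCost Q 𝒟) j)) (i + 1)‖
        + (c.Lh * (4 * p.μy / (1 - mixingRate A)) ^ 2 / p.β + 2 * c.Lf * p.N * p.μby)
        + c.Lf * (mixingRate A / (1 - mixingRate A) * (2 * p.μy))) := by
  have hr := h.runConditions hp
  have hs := h.smoothPL
  have hκ := h.one_le_κ
  have hK := hr.K_pos'
  have hl := mixingRate_nonneg A
  have hl1 : 0 < 1 - mixingRate A := by linarith [hr.mixingRate_lt_one]
  have hμx := hp.μx_pos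
  have hμy : 0 < p.μy := hμx.trans_le hr.μx_le
  set J := localCost Q 𝒟
  set F := globalCost Q 𝒟
  set zc := centroidIterate p Q A z₀ zm s
  have hzc0 : zc 0 = z₀ := centroid_const h.agents_pos z₀
  have hstep : ∀ i, gradNorms F (zc i) ≤
      (envelope F (zc i).fst - envelope F (zc (i + 1)).fst) / p.μx
      + 6 * c.κ * ((initialGap F (zc i) - initialGap F (zc (i + 1))) / p.μy)
      + (c.L * p.μx + 6 * c.κ * (c.Lf * p.μx / 4 + 4 * c.Lf * p.μy))
      + 2 * ((K : ℝ)⁻¹ * ∑ k, ‖((run p Q A z₀ zm s (i + 1)).u k).fst - gradX F (zc i)‖)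
      + 12 * c.κ * ((K : ℝ)⁻¹ * ∑ k, ‖((run p Q A z₀ zm s (i + 1)).u k).snd - gradY F (zc i)‖) :=
    fun i => hs.gradNorms_le h.agents_pos hμx hp.μx_le _ _ _
      (centroidIterate_succ p Q A z₀ zm s hr.doublyStochastic i)
  have hgX : ∀ z, gradX F z = (centroid fun k => gradient (J k) z).fst := fun z => by
    rw [← gradient_globalCost fun k => (h.lipschitz k).differentiable]; rfl
  have hgY : ∀ z, gradY F z = (centroid fun k => gradient (J k) z).snd := fun z => by
    rw [← gradient_globalCost fun k => (h.lipschitz k).differentiable]; rfl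
  set ρ := mixingRate A / (1 - mixingRate A) with hρ
  set D := c.Lf * (ρ * (2 * p.μy)) with hD
  set m := fun i => ‖centroid (momentumError p Q A z₀ zm s J i)‖ with hm
  set tx := fun i => consensusError (fun k => ((run p Q A z₀ zm s i).u k).fst) with htx
  set ty := fun i => consensusError (fun k => ((run p Q A z₀ zm s i).u k).snd) with hty
  have hEx : ∀ i, (K : ℝ)⁻¹ * ∑ k, ‖((run p Q A z₀ zm s (i + 1)).u k).fst - gradX F (zc i)‖
      ≤ tx (i + 1) / √K + m (i + 1) + D := fun i => by
    rw [hgX]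
    exact hr.avg_direction_error_le (L := WithLp.fstL 2 ℝ _ _) norm_fst_le i
  have hEy : ∀ i, (K : ℝ)⁻¹ * ∑ k, ‖((run p Q A z₀ zm s (i + 1)).u k).snd - gradY F (zc i)‖
      ≤ ty (i + 1) / √K + m (i + 1) + D := fun i => by
    rw [hgY]
    exact hr.avg_direction_error_le (L := WithLp.sndL 2 ℝ _ _) norm_snd_le i
  set Z := fun i => 2 * netNorm (runHessNoise p Q A z₀ zm s J i)
            + 2 * p.β * netNorm (runGradNoise p Q A z₀ zm s J i)
            + 3 * c.Lf * (√K * (4 * p.μy / (1 - mixingRate A)))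
            + 2 * p.β * (√K * (2 * c.Lf * p.N * p.μby)) with hZ
  set Y := fun i => (1 - p.β) ^ (i + 1) * ‖centroid (momentumError p Q A z₀ zm s J 0)‖
        + ‖discountedSum p.β (fun j => centroid (runHessNoise p Q A z₀ zm s J j)) (i + 1)‖
        + p.β * ‖discountedSum p.β
            (fun j => centroid (runGradNoise p Q A z₀ zm s J j)) (i + 1)‖
        + (c.Lh * (4 * p.μy / (1 - mixingRate A)) ^ 2 / p.β + 2 * c.Lf * p.N * p.μby) with hY
  have hmY : ∀ i, m (i + 1) ≤ Y i := fun i =>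
    hr.norm_centroid_momentumError_le hp.β_pos hβ1 hz (i + 1)
  set εx := netNorm (fun k => (momentumError p Q A z₀ zm s J 0 k).fst)
  set εy := netNorm (fun k => (momentumError p Q A z₀ zm s J 0 k).snd)
  have htxs : ∑ i ∈ Finset.range T, tx (i + 1)
      ≤ ρ * (tx 0 + εx + ∑ i ∈ Finset.range T, Z i) :=
    hr.sum_consensusError_u_le hp.β_pos hβ1 (L := WithLp.fstL 2 ℝ _ _) norm_fst_le hz T
  have htys : ∑ i ∈ Finset.range T, ty (i + 1)
      ≤ ρ * (ty 0 + εy + ∑ i ∈ Finset.range T, Z i) :=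
    hr.sum_consensusError_u_le hp.β_pos hβ1 (L := WithLp.sndL 2 ℝ _ _) norm_snd_le hz T
  have hsK : 0 < √(K : ℝ) := Real.sqrt_pos.2 hK
  have hgoal : ∑ i ∈ Finset.range T, gradNorms F (zc i) ≤
      (envelope F z₀.fst - optValue F) / p.μx + 6 * c.κ * (initialGap F z₀ / p.μy)
      + T * (c.L * p.μx + 6 * c.κ * (c.Lf * p.μx / 4 + 4 * c.Lf * p.μy))
      + (2 * ((∑ i ∈ Finset.range T, tx (i + 1)) / √K)
        + 12 * c.κ * ((∑ i ∈ Finset.range T, ty (i + 1)) / √K)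
        + (2 + 12 * c.κ) * ∑ i ∈ Finset.range T, (Y i + D)) := by
    have h1 : ∑ i ∈ Finset.range T, gradNorms F (zc i) ≤ ∑ i ∈ Finset.range T,
        ((envelope F (zc i).fst - envelope F (zc (i + 1)).fst) / p.μx
        + 6 * c.κ * ((initialGap F (zc i) - initialGap F (zc (i + 1))) / p.μy)
        + (c.L * p.μx + 6 * c.κ * (c.Lf * p.μx / 4 + 4 * c.Lf * p.μy))
        + (2 * (tx (i + 1) / √K) + 12 * c.κ * (ty (i + 1) / √K)
          + (2 + 12 * c.κ) * (Y i + D))) := by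
      refine Finset.sum_le_sum fun i _ => (hstep i).trans ?_
      have e1 := hEx i
      have e2 := mul_le_mul_of_nonneg_left (hEy i) (by linarith : 0 ≤ 12 * c.κ)
      have e3 := mul_le_mul_of_nonneg_left (hmY i) (by linarith : 0 ≤ 2 + 12 * c.κ)
      linarith
    refine h1.trans ?_
    simp only [Finset.sum_add_distrib, ← Finset.mul_sum, ← Finset.sum_div,
      Finset.sum_range_sub', Finset.sum_const, Finset.card_range, nsmul_eq_mul]
    rw [hzc0]
    -- After telescoping, the final values survive with negative sign. They are removed by P ≥ P⋆
    -- and by the nonnegativity of the dual gap.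
    have e1 : optValue F ≤ envelope F (zc T).fst := ciInf_le h.cost.bddBelow _
    have e2 : 0 ≤ initialGap F (zc T) := sub_nonneg.2 (hs.le_envelope (zc T).fst (zc T).snd)
    have e3 : (envelope F z₀.fst - envelope F (zc T).fst) / p.μx
        ≤ (envelope F z₀.fst - optValue F) / p.μx := by gcongr
    have e4 : 6 * c.κ * ((initialGap F z₀ - initialGap F (zc T)) / p.μy)
        ≤ 6 * c.κ * (initialGap F z₀ / p.μy) := by
      gcongr
      linarith
    linarith
  refine hgoal.trans ?_
  rw [add_assoc (_ + _) (ρ / √K * _)]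
  refine add_le_add le_rfl ?_
  have e1 : (∑ i ∈ Finset.range T, tx (i + 1)) / √K
      ≤ ρ / √K * (tx 0 + εx) + ∑ i ∈ Finset.range T, ρ / √K * Z i := by
    rw [← Finset.mul_sum, ← mul_add, div_mul_eq_mul_div]
    gcongr
  have e2 : (∑ i ∈ Finset.range T, ty (i + 1)) / √K
      ≤ ρ / √K * (ty 0 + εy) + ∑ i ∈ Finset.range T, ρ / √K * Z i := by
    rw [← Finset.mul_sum, ← mul_add, div_mul_eq_mul_div]
    gcongr
  -- Nonnegativity permits the weights 2 of the x-block and 12κ of the y-block to be merged into the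
  -- single weight 14κ ≥ 2 + 12κ.
  have hYD : ∀ i, 0 ≤ Y i + D := fun i => by
    have : 0 ≤ m (i + 1) := norm_nonneg _
    have : 0 ≤ D := by have := hr.Lf_pos; positivity
    linarith [hmY i]
  have hZn : ∀ i, 0 ≤ ρ / √K * Z i := fun i => by
    have := netNorm_nonneg (runHessNoise p Q A z₀ zm s J i)
    have := netNorm_nonneg (runGradNoise p Q A z₀ zm s J i)
    have := hr.Lf_pos
    have := hp.β_pos
    have := hr.μbx_nonneg.trans hr.μbx_le
    have : 0 ≤ Z i := by positivity
    positivity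
  have e3 : ∑ i ∈ Finset.range T, (ρ / √K * Z i + Y i + D)
      = ∑ i ∈ Finset.range T, ρ / √K * Z i + ∑ i ∈ Finset.range T, (Y i + D) := by
    rw [← Finset.sum_add_distrib]
    exact Finset.sum_congr rfl fun i _ => by ring
  have e4 : ∑ i ∈ Finset.range T, (ρ / √K *
          (2 * netNorm (runHessNoise p Q A z₀ zm s J i)
            + 2 * p.β * netNorm (runGradNoise p Q A z₀ zm s J i)
            + 3 * c.Lf * (√K * (4 * p.μy / (1 - mixingRate A)))
            + 2 * p.β * (√K * (2 * c.Lf * p.N * p.μby)))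
        + (1 - p.β) ^ (i + 1) * ‖centroid (momentumError p Q A z₀ zm s J 0)‖
        + ‖discountedSum p.β (fun j => centroid (runHessNoise p Q A z₀ zm s J j)) (i + 1)‖
        + p.β * ‖discountedSum p.β
            (fun j => centroid (runGradNoise p Q A z₀ zm s J j)) (i + 1)‖
        + (c.Lh * (4 * p.μy / (1 - mixingRate A)) ^ 2 / p.β + 2 * c.Lf * p.N * p.μby) + D)
      = ∑ i ∈ Finset.range T, (ρ / √K * Z i + Y i + D) :=
    Finset.sum_congr rfl fun i _ => by rw [hZ, hY]; ring
  rw [e4, e3]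
  have e5 := Finset.sum_nonneg fun i (_ : i ∈ Finset.range T) => hYD i
  have e6 := Finset.sum_nonneg fun i (_ : i ∈ Finset.range T) => hZn i
  set SY := ∑ i ∈ Finset.range T, (Y i + D)
  set SZ := ∑ i ∈ Finset.range T, ρ / √K * Z i
  have e7 := mul_le_mul_of_nonneg_left e2 (by linarith : 0 ≤ 12 * c.κ)
  have e8 : (2 + 12 * c.κ) * (SZ + SY) ≤ 14 * c.κ * (SZ + SY) := by
    gcongr
    linarith
  linarith

end Pathwise

end LocalDiMA

end

/-! ### Orthogonality in L² by resampling one coordinate -/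

noncomputable section

namespace LocalDiMA

theorem sqBound_of_lintegral_le {Ω V : Type*} [NormedAddCommGroup V] [MeasurableSpace Ω] {μ : Measure Ω} {D : Ω → V}
    (hD : AEStronglyMeasurable D μ) {v : ℝ} (h : ∫⁻ s, ‖D s‖ₑ ^ 2 ∂μ ≤ ENNReal.ofReal v) :
    MemLp D 2 μ := by
  refine ⟨hD, ?_⟩
  rw [eLpNorm_lt_top_iff_lintegral_rpow_enorm_lt_top (by norm_num) (by norm_num)]
  have : ∀ s, ‖D s‖ₑ ^ (2 : ENNReal).toReal = ‖D s‖ₑ ^ 2 := fun s => by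
    rw [ENNReal.toReal_ofNat, ENNReal.rpow_ofNat]
  simp only [this]
  exact h.trans_lt ENNReal.ofReal_lt_top

theorem integral_sq_le_of_lintegral_le {Ω V : Type*} [NormedAddCommGroup V] [MeasurableSpace Ω] {μ : Measure Ω} {D : Ω → V}
    (hD : AEStronglyMeasurable D μ) {v : ℝ} (hv : 0 ≤ v)
    (h : ∫⁻ s, ‖D s‖ₑ ^ 2 ∂μ ≤ ENNReal.ofReal v) :
    ∫ s, ‖D s‖ ^ 2 ∂μ ≤ v := by
  rw [integral_eq_lintegral_of_nonneg_ae (Filter.Eventually.of_forall fun s => sq_nonneg _)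
    (hD.norm.pow 2)]
  refine ENNReal.toReal_le_of_le_ofReal hv (le_trans (le_of_eq ?_) h)
  refine lintegral_congr fun s => ?_
  rw [ENNReal.ofReal_pow (norm_nonneg _), ofReal_norm]

theorem integrable_inner_of_memLp {Ω V : Type*} [MeasurableSpace Ω] {μ : Measure Ω}
    [NormedAddCommGroup V] [InnerProductSpace ℝ V] {X Y : Ω → V} (hX : MemLp X 2 μ)
    (hY : MemLp Y 2 μ) : Integrable (fun s => inner ℝ (X s) (Y s)) μ :=
  Integrable.mono' (hX.norm.integrable_mul hY.norm) (hX.1.inner hY.1)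
    (Filter.Eventually.of_forall fun _ => norm_inner_le_norm _ _)

theorem integral_norm_sq_sum {Ω α V : Type*} [NormedAddCommGroup V]
    [InnerProductSpace ℝ V] [MeasurableSpace Ω] {μ : Measure Ω}
    {D : α → Ω → V} (F : Finset α) (hD : ∀ a ∈ F, MemLp (D a) 2 μ)
    (horth : ∀ a ∈ F, ∀ b ∈ F, a ≠ b → ∫ s, inner ℝ (D a s) (D b s) ∂μ = 0) :
    ∫ s, ‖∑ a ∈ F, D a s‖ ^ 2 ∂μ = ∑ a ∈ F, ∫ s, ‖D a s‖ ^ 2 ∂μ := by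
  classical
  have hi : ∀ a ∈ F, ∀ b ∈ F, Integrable (fun s => inner ℝ (D a s) (D b s)) μ :=
    fun a ha b hb => integrable_inner_of_memLp (hD a ha) (hD b hb)
  have e : ∀ s, ‖∑ a ∈ F, D a s‖ ^ 2 = ∑ a ∈ F, ∑ b ∈ F, inner ℝ (D a s) (D b s) := fun s => by
    rw [← real_inner_self_eq_norm_sq, sum_inner]
    simp only [inner_sum]
  simp only [e]
  rw [integral_finsetSum _ fun a ha => integrable_finsetSum _ fun b hb => hi a ha b hb]
  refine Finset.sum_congr rfl fun a ha => ?_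
  rw [integral_finsetSum _ fun b hb => hi a ha b hb, Finset.sum_eq_single a]
  · simp only [real_inner_self_eq_norm_sq]
  · exact fun b hb hba => horth a ha b hb hba.symm
  · exact fun h => absurd ha h

section Resampling

variable {ι S : Type*} [MeasurableSpace S] {ν : ι → Measure S} [∀ i, IsProbabilityMeasure (ν i)]
  [DecidableEq ι]

theorem measurable_update_prod (j : ι) :
    Measurable fun x : (ι → S) × S => Function.update x.1 j x.2 := by
  refine measurable_pi_lambda _ fun i => ?_
  by_cases h : i = j
  · subst h
    simpa using measurable_snd
  · simp only [Function.update_of_ne h]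
    exact (measurable_pi_apply i).comp measurable_fst

/-- Replacing one sample by an independent copy preserves the product law. -/
theorem measurePreserving_update (j : ι) :
    MeasurePreserving (fun x : (ι → S) × S => Function.update x.1 j x.2)
      ((Measure.infinitePi ν).prod (ν j)) (Measure.infinitePi ν) := by
  refine ⟨measurable_update_prod j, Measure.eq_infinitePi ν fun s t ht => ?_⟩
  rw [Measure.map_apply (measurable_update_prod j)
    (MeasurableSet.pi s.countable_toSet fun i _ => ht i)]
  -- The preimage of a box is again a box: the resampled coordinate no longer constrains the path
  -- but only the new sample, and only if `j` belongs to the index set of the box.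
  have e : (fun x : (ι → S) × S => Function.update x.1 j x.2) ⁻¹' ((s : Set ι).pi t)
      = (((s.erase j : Finset ι) : Set ι).pi t) ×ˢ (if j ∈ s then t j else Set.univ) := by
    ext ⟨x, y⟩
    simp only [Set.mem_preimage, Set.mem_pi, Finset.mem_coe, Set.mem_prod, Finset.mem_erase]
    constructor
    · intro h
      refine ⟨fun i hi => by simpa [Function.update_of_ne hi.1] using h i hi.2, ?_⟩
      split_ifs with hj
      · simpa using h j hj
      · trivial
    · rintro ⟨h1, h2⟩ i hi
      by_cases hij : i = j
      · subst hij
        simpa [hi] using h2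
      · simpa [Function.update_of_ne hij] using h1 i ⟨hij, hi⟩
  rw [e, Measure.prod_prod, Measure.infinitePi_pi ν fun i _ => ht i]
  by_cases hj : j ∈ s
  · rw [if_pos hj, mul_comm, Finset.mul_prod_erase s (fun i => ν i (t i)) hj]
  · simp [hj]

/-- A random vector whose conditional second moment given the other samples is at most `v`. -/
theorem second_moment_of_update {V : Type*} [NormedAddCommGroup V] [MeasurableSpace V]
    [BorelSpace V] [SecondCountableTopology V] {D : (ι → S) → V} (hD : Measurable D) {v : (ι → S) → ℝ}
    (hv : Integrable v (Measure.infinitePi ν)) (hv0 : ∀ s, 0 ≤ v s) (j : ι)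
    (h : ∀ s, ∫⁻ t, ‖D (Function.update s j t)‖ₑ ^ 2 ∂ν j ≤ ENNReal.ofReal (v s)) :
    MemLp D 2 (Measure.infinitePi ν) ∧
      ∫ s, ‖D s‖ ^ 2 ∂Measure.infinitePi ν ≤ ∫ s, v s ∂Measure.infinitePi ν := by
  have h1 : ∫⁻ s, ‖D s‖ₑ ^ 2 ∂Measure.infinitePi ν
      ≤ ENNReal.ofReal (∫ s, v s ∂Measure.infinitePi ν) := by
    have hm : Measurable fun s => ‖D s‖ₑ ^ 2 := hD.enorm.pow_const 2
    rw [← (measurePreserving_update (ν := ν) j).lintegral_comp hm,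
      lintegral_prod (fun x : (ι → S) × S => ‖D (Function.update x.1 j x.2)‖ₑ ^ 2)
        ((hm.comp (measurable_update_prod j)).aemeasurable),
      ofReal_integral_eq_lintegral_ofReal hv (Filter.Eventually.of_forall hv0)]
    exact lintegral_mono h
  exact ⟨sqBound_of_lintegral_le hD.aestronglyMeasurable h1,
    integral_sq_le_of_lintegral_le hD.aestronglyMeasurable (integral_nonneg hv0) h1⟩

/-- Resample the coordinate `j` and integrate over it first: `X` is then constant and `D` has mean
zero. Fubini on the product law plays the role of conditional expectations. -/
theorem integral_inner_eq_zero_of_update {V : Type*} [NormedAddCommGroup V]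
    [InnerProductSpace ℝ V] [CompleteSpace V] {X D : (ι → S) → V}
    (hX : MemLp X 2 (Measure.infinitePi ν)) (hD : MemLp D 2 (Measure.infinitePi ν)) (j : ι)
    (hXj : ∀ s t, X (Function.update s j t) = X s)
    (hDj : ∀ s, ∫ t, D (Function.update s j t) ∂ν j = 0) :
    ∫ s, inner ℝ (X s) (D s) ∂Measure.infinitePi ν = 0 := by
  have hmp := measurePreserving_update (ν := ν) j
  have hint : Integrable (fun s => inner ℝ (X s) (D s)) (Measure.infinitePi ν) := 
    integrable_inner_of_memLp hX hD
  have h1 : Integrable (fun x : (ι → S) × S => inner ℝ (X (Function.update x.1 j x.2))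
      (D (Function.update x.1 j x.2))) ((Measure.infinitePi ν).prod (ν j)) :=
    hmp.integrable_comp_of_integrable hint
  have h2 : Integrable (fun x : (ι → S) × S => D (Function.update x.1 j x.2))
      ((Measure.infinitePi ν).prod (ν j)) :=
    hmp.integrable_comp_of_integrable (hD.integrable (by norm_num))
  rw [← hmp.map_eq, integral_map hmp.measurable.aemeasurable (by
    rw [hmp.map_eq]; exact hint.aestronglyMeasurable), integral_prod _ h1]
  refine integral_eq_zero_of_ae ?_
  filter_upwards [h2.prod_right_ae] with s hs
  simp only [hXj]
  rw [integral_inner hs, hDj, inner_zero_right]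
  rfl

end Resampling

/-- This is the nonnegativity of the variance of ‖X‖. -/
theorem integral_norm_le_sqrt {Ω V : Type*} [MeasurableSpace Ω] {μ : Measure Ω}
    [IsProbabilityMeasure μ] [NormedAddCommGroup V] {X : Ω → V} (hX : MemLp X 2 μ) :
    ∫ s, ‖X s‖ ∂μ ≤ √(∫ s, ‖X s‖ ^ 2 ∂μ) := by
  have h := variance_nonneg (fun s => ‖X s‖) μ
  rw [variance_eq_sub hX.norm] at h
  apply Real.le_sqrt_of_sq_le
  simpa using h

end LocalDiMA

end

/-! ### Measurability of the oracles and of the run -/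

noncomputable section

namespace LocalDiMA

variable {K M₁ M₂ : ℕ} {S : Type*}

section Limits

theorem tendsto_norm_natCast_add_one :
    Filter.Tendsto (fun n : ℕ => ‖((n : ℝ) + 1)‖) Filter.atTop Filter.atTop := by
  have : Filter.Tendsto (fun n : ℕ => ((n : ℝ) + 1)) Filter.atTop Filter.atTop :=
    Filter.tendsto_atTop_add_const_right _ _ tendsto_natCast_atTop_atTop
  exact tendsto_norm_atTop_atTop.comp this

/-- Derivatives become limits of sequences of difference quotients, so measurability passes to them.
-/
theorem HasFDerivAt.tendsto_diffQuot {E F : Type*} [NormedAddCommGroup E] [NormedSpace ℝ E]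
    [NormedAddCommGroup F] [NormedSpace ℝ F] {f : E → F} {f' : E →L[ℝ] F} {x : E}
    (h : HasFDerivAt f f' x) (v : E) :
    Filter.Tendsto (fun n : ℕ => ((n : ℝ) + 1) • (f (x + ((n : ℝ) + 1)⁻¹ • v) - f x))
      Filter.atTop (nhds (f' v)) :=
  h.lim v tendsto_norm_natCast_add_one

end Limits

section General

variable {E Ω : Type*} [NormedAddCommGroup E] [InnerProductSpace ℝ E] [FiniteDimensional ℝ E]
  [MeasurableSpace E] [BorelSpace E] [MeasurableSpace Ω] [MeasurableSpace S]

omit [FiniteDimensional ℝ E] in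
theorem measurable_smul_const {f : Ω → E} (hf : Measurable f) (r : ℝ) :
    Measurable fun x => r • f x :=
  hf.const_smul r

/-- Each coordinate of the gradient in an orthonormal basis is a limit of difference quotients at
fixed points. Measurability in the sample for each fixed point suffices. -/
theorem measurable_gradient_of_differentiable {q : E → S → ℝ} (hq : ∀ z, Measurable (q z))
    (hd : ∀ s, Differentiable ℝ fun z => q z s) (z : E) :
    Measurable fun s => gradient (fun w => q w s) z := by
  let b := stdOrthonormalBasis ℝ E
  have e : (fun s => gradient (fun w => q w s) z)
      = fun s => ∑ i, (fderiv ℝ (fun w => q w s) z (b i)) • b i := by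
    funext s
    rw [← b.sum_repr' (gradient (fun w => q w s) z)]
    refine Finset.sum_congr rfl fun i _ => ?_
    rw [real_inner_comm, inner_gradient]
  rw [e]
  refine Finset.measurable_fun_sum _ fun i _ => Measurable.smul_const ?_ _
  refine measurable_of_tendsto_metrizable (f := fun (n : ℕ) s =>
    ((n : ℝ) + 1) • (q (z + ((n : ℝ) + 1)⁻¹ • b i) s - q z s)) (fun n => ?_) ?_
  · exact ((hq _).sub (hq _)).const_smul ((n : ℝ) + 1)
  · rw [tendsto_pi_nhds]
    exact fun s => HasFDerivAt.tendsto_diffQuot ((hd s) z).hasFDerivAt (b i)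

/-- A Carathéodory argument: continuity in the point and measurability in the sample give joint
measurability, which is needed because the evaluation points are random. -/
theorem measurable_uncurry_of_differentiable {g : E → S → E} (hg : ∀ z, Measurable (g z))
    (hd : ∀ s, Differentiable ℝ fun z => g z s) : Measurable fun x : E × S => g x.1 x.2 :=
  (stronglyMeasurable_uncurry_of_continuous_of_stronglyMeasurable
    (u := g) (fun s => (hd s).continuous) fun z => (hg z).stronglyMeasurable).measurable

theorem measurable_fderiv_apply_of_differentiable {g : E → S → E} (hg : ∀ z, Measurable (g z))
    (hd : ∀ s, Differentiable ℝ fun z => g z s) {z v : Ω → E} {ξ : Ω → S} (hz : Measurable z)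
    (hv : Measurable v) (hξ : Measurable ξ) :
    Measurable fun ω => fderiv ℝ (fun w => g w (ξ ω)) (z ω) (v ω) := by
  have hg' := measurable_uncurry_of_differentiable hg hd
  refine measurable_of_tendsto_metrizable (f := fun (n : ℕ) ω =>
    ((n : ℝ) + 1) • (g (z ω + ((n : ℝ) + 1)⁻¹ • v ω) (ξ ω) - g (z ω) (ξ ω))) (fun n => ?_) ?_
  · have h1 : Measurable fun ω => g (z ω + ((n : ℝ) + 1)⁻¹ • v ω) (ξ ω) :=
      hg'.comp ((hz.add (measurable_smul_const hv _)).prodMk hξ)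
    have h2 : Measurable fun ω => g (z ω) (ξ ω) := hg'.comp (hz.prodMk hξ)
    exact measurable_smul_const (h1.sub h2) _
  · rw [tendsto_pi_nhds]
    exact fun ω => HasFDerivAt.tendsto_diffQuot ((hd (ξ ω)) (z ω)).hasFDerivAt (v ω)

/-- An operator on a finite-dimensional space is a finite sum of rank-one operators that depend
continuously on its values on a basis. -/
theorem stronglyMeasurable_clm_of_apply {L : Ω → E →L[ℝ] E}
    (hL : ∀ v, Measurable fun ω => L ω v) : StronglyMeasurable L := by
  let b := stdOrthonormalBasis ℝ E
  have e : L = fun ω => ∑ i, ContinuousLinearMap.smulRightL ℝ E E (innerSL ℝ (b i)) (L ω (b i)) := by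
    funext ω
    ext1 v
    conv_lhs => rw [← b.sum_repr' v, map_sum]
    simp
  rw [e]
  refine Finset.stronglyMeasurable_fun_sum _ fun i _ => ?_
  exact (ContinuousLinearMap.continuous _).comp_stronglyMeasurable (hL (b i)).stronglyMeasurable

end General

/-- The identity `hf` does not by itself provide integrability, because the integral of a
nonintegrable function is 0 by convention. Integrability comes from `h`, which the variance bounds
supply. -/
theorem integral_sub_const_eq_zero {Ω F : Type*} [MeasurableSpace Ω] {μ : Measure Ω}
    [IsProbabilityMeasure μ] [NormedAddCommGroup F] [NormedSpace ℝ F] [CompleteSpace F]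
    {f : Ω → F} {a : F} (h : Integrable (fun ω => f ω - a) μ) (hf : ∫ ω, f ω ∂μ = a) :
    ∫ ω, (f ω - a) ∂μ = 0 := by
  have h2 : Integrable f μ := by
    refine (h.add (integrable_const a)).congr (Filter.Eventually.of_forall fun s => ?_)
    simp
  rw [integral_sub h2 (integrable_const _), hf]
  simp

theorem integral_apply_sub_eq_zero {Ω E : Type*} [MeasurableSpace Ω] {μ : Measure Ω}
    [IsProbabilityMeasure μ] [NormedAddCommGroup E] [NormedSpace ℝ E] [CompleteSpace E]
    {f : Ω → E →L[ℝ] E} {a : E →L[ℝ] E} (h : Integrable (fun ω => f ω - a) μ)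
    (hf : ∫ ω, f ω ∂μ = a) (v : E) : ∫ ω, (f ω v - a v) ∂μ = 0 := by
  have h4 := ContinuousLinearMap.integral_apply h v
  rw [integral_sub_const_eq_zero h hf] at h4
  exact h4.symm

theorem lintegral_apply_sub_le {Ω E : Type*} [MeasurableSpace Ω] {μ : Measure Ω}
    [NormedAddCommGroup E] [NormedSpace ℝ E]
    {f : Ω → E →L[ℝ] E} {a : E →L[ℝ] E} {σ : ℝ}
    (h : ∫⁻ ω, ‖f ω - a‖ₑ ^ 2 ∂μ ≤ ENNReal.ofReal (σ ^ 2)) (v : E) :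
    ∫⁻ ω, ‖f ω v - a v‖ₑ ^ 2 ∂μ ≤ ENNReal.ofReal (σ ^ 2 * ‖v‖ ^ 2) := by
  calc ∫⁻ ω, ‖f ω v - a v‖ₑ ^ 2 ∂μ
      ≤ ∫⁻ ω, ‖f ω - a‖ₑ ^ 2 * ‖v‖ₑ ^ 2 ∂μ := by
        refine lintegral_mono fun ω => ?_
        rw [← mul_pow]
        gcongr
        exact (f ω - a).le_opENorm v
    _ = (∫⁻ ω, ‖f ω - a‖ₑ ^ 2 ∂μ) * ‖v‖ₑ ^ 2 := lintegral_mul_const' _ _ (by simp)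
    _ ≤ ENNReal.ofReal (σ ^ 2) * ‖v‖ₑ ^ 2 := by gcongr
    _ = _ := by
        rw [ENNReal.ofReal_mul (sq_nonneg _), ← ofReal_norm, ENNReal.ofReal_pow (norm_nonneg _)]

section Oracle

variable [MeasurableSpace S] {c : Constants} {q : Vec M₁ M₂ → S → ℝ} {μ : Measure S}
  {J : Vec M₁ M₂ → ℝ}

namespace BoundedVariance

variable (h : BoundedVariance c q μ J)

include h

theorem measurable_gradient (z : Vec M₁ M₂) :
    Measurable fun s => gradient (fun w => q w s) z :=
  measurable_gradient_of_differentiable h.measurable h.differentiable z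

theorem measurable_gradient_comp {Ω : Type*} [MeasurableSpace Ω] {z : Ω → Vec M₁ M₂} {ξ : Ω → S}
    (hz : Measurable z) (hξ : Measurable ξ) :
    Measurable fun ω => gradient (fun w => q w (ξ ω)) (z ω) := by
  have h1 := measurable_uncurry_of_differentiable (g := fun z s => gradient (fun w => q w s) z)
    h.measurable_gradient h.gradient_differentiable
  exact h1.comp (hz.prodMk hξ)

theorem measurable_hvp {Ω : Type*} [MeasurableSpace Ω] {z z' : Ω → Vec M₁ M₂} {ξ : Ω → S}
    (hz : Measurable z) (hz' : Measurable z') (hξ : Measurable ξ) :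
    Measurable fun ω => hvp (fun w => q w (ξ ω)) (z ω) (z' ω) :=
  measurable_fderiv_apply_of_differentiable (g := fun z s => gradient (fun w => q w s) z)
    h.measurable_gradient h.gradient_differentiable hz (hz.sub hz') hξ

theorem stronglyMeasurable_hess (z : Vec M₁ M₂) :
    StronglyMeasurable (fun s => hess (fun w => q w s) z) :=
  stronglyMeasurable_clm_of_apply fun _ =>
    measurable_fderiv_apply_of_differentiable (g := fun z s => gradient (fun w => q w s) z)
      h.measurable_gradient h.gradient_differentiable measurable_const measurable_const
      measurable_id

variable [IsProbabilityMeasure μ]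

theorem integral_gradient_sub (z : Vec M₁ M₂) :
    ∫ s, (gradient (fun w => q w s) z - gradient J z) ∂μ = 0 :=
  integral_sub_const_eq_zero ((sqBound_of_lintegral_le
    ((h.measurable_gradient z).sub_const _).aestronglyMeasurable
    (h.gradient_variance z)).integrable (by norm_num)) (h.gradient_unbiased z)

theorem integral_hvp_sub (z z' : Vec M₁ M₂) :
    ∫ s, (hvp (fun w => q w s) z z' - hvp J z z') ∂μ = 0 := by
  have h0 : Integrable (fun s => hess (fun w => q w s) z - hess J z) μ :=
    (sqBound_of_lintegral_le
      ((h.stronglyMeasurable_hess z).sub stronglyMeasurable_const).aestronglyMeasurable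
      (h.hess_variance z)).integrable (by norm_num)
  exact integral_apply_sub_eq_zero h0 (h.hess_unbiased z) _

omit [IsProbabilityMeasure μ] in
theorem lintegral_hvp_sub_le (z z' : Vec M₁ M₂) :
    ∫⁻ s, ‖hvp (fun w => q w s) z z' - hvp J z z'‖ₑ ^ 2 ∂μ
      ≤ ENNReal.ofReal (c.σh ^ 2 * ‖z - z'‖ ^ 2) :=
  lintegral_apply_sub_le (h.hess_variance z) _

end BoundedVariance

end Oracle

section RunMeasurable

variable [MeasurableSpace S] {c : Constants} {p : Params} {Q : Fin K → Vec M₁ M₂ → S → ℝ}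
  {𝒟 : Fin K → Measure S} {A : Matrix (Fin K) (Fin K) ℝ} {J : Fin K → Vec M₁ M₂ → ℝ}

theorem measurable_fst_vec : Measurable fun z : Vec M₁ M₂ => z.fst :=
  (WithLp.fstL 2 ℝ (EuclideanSpace ℝ (Fin M₁)) (EuclideanSpace ℝ (Fin M₂))).continuous.measurable

theorem measurable_snd_vec : Measurable fun z : Vec M₁ M₂ => z.snd :=
  (WithLp.sndL 2 ℝ (EuclideanSpace ℝ (Fin M₁)) (EuclideanSpace ℝ (Fin M₂))).continuous.measurable

theorem measurable_normalizedStep {Ω : Type*} [MeasurableSpace Ω] (a b : ℝ) {z v : Ω → Vec M₁ M₂}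
    (hz : Measurable z) (hv : Measurable v) :
    Measurable fun ω => normalizedStep a b (z ω) (v ω) := by
  have hx := measurable_fst_vec.comp hv
  have hy := measurable_snd_vec.comp hv
  have h1 : Measurable fun ω => (z ω).fst - a • ((‖(v ω).fst‖)⁻¹ • (v ω).fst) :=
    (measurable_fst_vec.comp hz).sub ((hx.norm.inv.smul hx).const_smul a)
  have h2 : Measurable fun ω => (z ω).snd + b • ((‖(v ω).snd‖)⁻¹ • (v ω).snd) :=
    (measurable_snd_vec.comp hz).add ((hy.norm.inv.smul hy).const_smul b)
  exact (WithLp.prod_continuous_toLp 2 _ _).measurable.comp (h1.prodMk h2)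

theorem measurable_localIterate (h : ∀ k, BoundedVariance c (Q k) (𝒟 k) (J k)) {Ω : Type*}
    [MeasurableSpace Ω] (k : Fin K) {s : Ω → ℕ → S} {z : Ω → Vec M₁ M₂}
    (hs : ∀ n, Measurable fun ω => s ω n) (hz : Measurable z) (n : ℕ) :
    Measurable fun ω => localIterate p (Q k) (s ω) (z ω) n := by
  induction n with
  | zero => exact hz
  | succ n ih =>
    exact measurable_normalizedStep _ _ ih
      ((h k).measurable_gradient_comp ih (hs n))

theorem measurable_run (h : ∀ k, BoundedVariance c (Q k) (𝒟 k) (J k)) (z₀ zm : Vec M₁ M₂) (i : ℕ) :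
    (∀ k, Measurable fun s => (run p Q A z₀ zm s i).z k) ∧
    (∀ k, Measurable fun s => (run p Q A z₀ zm s i).zPrev k) ∧
    (∀ k, Measurable fun s => (run p Q A z₀ zm s i).m k) ∧
    (∀ k, Measurable fun s => (run p Q A z₀ zm s i).u k) := by
  induction i with
  | zero =>
    have h1 : ∀ k, Measurable fun s : SampleIndex K → S =>
        gradient (fun w => Q k w (s (k, none))) zm := fun k =>
      ((h k).measurable_gradient zm).comp (measurable_pi_apply _)
    exact ⟨fun k => measurable_const, fun k => measurable_const, h1, h1⟩
  | succ i ih =>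
    obtain ⟨hz, hzp, hm, hu⟩ := ih
    have hs : ∀ k n, Measurable fun s : SampleIndex K → S => s (k, some (i, n)) :=
      fun k n => measurable_pi_apply _
    have hm' : ∀ k, Measurable fun s => (run p Q A z₀ zm s (i + 1)).m k := fun k => by
      have h1 : Measurable fun s => localCorrection p (Q k) (fun n => s (k, some (i, n)))
          ((run p Q A z₀ zm s i).z k) ((run p Q A z₀ zm s i).zPrev k) :=
        measurable_smul_const (Finset.measurable_fun_sum _ fun n _ =>
          (h k).measurable_hvp (hz k) (hzp k) (hs k n)) _
      have h2 : Measurable fun s => localGrad p (Q k) (fun n => s (k, some (i, n)))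
          ((run p Q A z₀ zm s i).z k) :=
        measurable_smul_const (Finset.measurable_fun_sum _ fun n _ =>
          (h k).measurable_gradient_comp
            (measurable_localIterate h k (hs k) (hz k) n) (hs k n)) _
      exact (measurable_smul_const ((hm k).add (measurable_smul_const h1 _)) _).add
        (measurable_smul_const h2 _)
    have hu' : ∀ k, Measurable fun s => (run p Q A z₀ zm s (i + 1)).u k := fun k => by
      change Measurable fun s => ∑ l, A k l • ((run p Q A z₀ zm s i).u l
        + (run p Q A z₀ zm s (i + 1)).m l - (run p Q A z₀ zm s i).m l)
      exact Finset.measurable_fun_sum _ fun l _ =>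
        measurable_smul_const (((hu l).add (hm' l)).sub (hm l)) (A k l)
    refine ⟨fun k => ?_, hz, hm', hu'⟩
    change Measurable fun s => ∑ l, A k l • normalizedStep p.μx p.μy
      ((run p Q A z₀ zm s i).z l) ((run p Q A z₀ zm s (i + 1)).u l)
    exact Finset.measurable_fun_sum _ fun l _ =>
      measurable_smul_const (measurable_normalizedStep _ _ (hz l) (hu' l)) (A k l)

theorem measurable_centroid {Ω V : Type*} [MeasurableSpace Ω] [NormedAddCommGroup V]
    [InnerProductSpace ℝ V] [FiniteDimensional ℝ V] [MeasurableSpace V] [BorelSpace V]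
    {v : Ω → Fin K → V} (hv : ∀ k, Measurable fun ω => v ω k) :
    Measurable fun ω => centroid (v ω) :=
  measurable_smul_const (Finset.measurable_fun_sum _ fun k _ => hv k) _

theorem measurable_centroidIterate (h : ∀ k, BoundedVariance c (Q k) (𝒟 k) (J k))
    (z₀ zm : Vec M₁ M₂) (i : ℕ) : Measurable fun s => centroidIterate p Q A z₀ zm s i :=
  measurable_centroid (measurable_run h z₀ zm i).1

end RunMeasurable

end LocalDiMA

end

/-! ### Second moments of sums of noise terms -/

noncomputable section

namespace LocalDiMA

section NoiseTerm

variable {ι S V α : Type*} [MeasurableSpace S] [DecidableEq ι]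
  [NormedAddCommGroup V] [InnerProductSpace ℝ V] [MeasurableSpace V] [BorelSpace V]

/-- A random vector that is centered given all samples except the `j`-th one, with conditional
second moment at most `v`. -/
structure NoiseTerm (ν : ι → Measure S) (j : ι) (D : (ι → S) → V) (v : (ι → S) → ℝ) : Prop where
  measurable : Measurable D
  integrable : Integrable v (Measure.infinitePi ν)
  nonneg : ∀ s, 0 ≤ v s
  centered : ∀ s, ∫ t, D (Function.update s j t) ∂ν j = 0
  variance_le : ∀ s, ∫⁻ t, ‖D (Function.update s j t)‖ₑ ^ 2 ∂ν j ≤ ENNReal.ofReal (v s)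

variable {ν : ι → Measure S} [∀ i, IsProbabilityMeasure (ν i)] [SecondCountableTopology V]

theorem NoiseTerm.memLp {j : ι} {D : (ι → S) → V} {v : (ι → S) → ℝ} (h : NoiseTerm ν j D v) :
    MemLp D 2 (Measure.infinitePi ν) :=
  (second_moment_of_update h.measurable h.integrable h.nonneg j h.variance_le).1

theorem NoiseTerm.integral_sq_le {j : ι} {D : (ι → S) → V} {v : (ι → S) → ℝ}
    (h : NoiseTerm ν j D v) :
    ∫ s, ‖D s‖ ^ 2 ∂Measure.infinitePi ν ≤ ∫ s, v s ∂Measure.infinitePi ν :=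
  (second_moment_of_update h.measurable h.integrable h.nonneg j h.variance_le).2

/-- Distinct noise terms are orthogonal if one of them does not depend on the sample of the
other. -/
theorem integral_norm_sq_sum_noise_le [CompleteSpace V] {idx : α → ι} {D : α → (ι → S) → V}
    {v : α → (ι → S) → ℝ} (F : Finset α) (h : ∀ a ∈ F, NoiseTerm ν (idx a) (D a) (v a))
    (hinv : ∀ a ∈ F, ∀ b ∈ F, a ≠ b →
      (∀ s t, D a (Function.update s (idx b) t) = D a s) ∨
      (∀ s t, D b (Function.update s (idx a) t) = D b s)) (w : α → ℝ) :
    MemLp (fun s => ∑ a ∈ F, w a • D a s) 2 (Measure.infinitePi ν) ∧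
    ∫ s, ‖∑ a ∈ F, w a • D a s‖ ^ 2 ∂Measure.infinitePi ν
      ≤ ∑ a ∈ F, w a ^ 2 * ∫ s, v a s ∂Measure.infinitePi ν := by
  have hm : ∀ a ∈ F, MemLp (fun s => w a • D a s) 2 (Measure.infinitePi ν) :=
    fun a ha => (h a ha).memLp.const_smul (w a)
  refine ⟨memLp_finsetSum _ hm, ?_⟩
  rw [integral_norm_sq_sum F hm]
  · refine Finset.sum_le_sum fun a ha => ?_
    simp only [norm_smul, mul_pow, integral_const_mul, Real.norm_eq_abs, sq_abs]
    exact mul_le_mul_of_nonneg_left (h a ha).integral_sq_le (sq_nonneg _)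
  · intro a ha b hb hab
    simp only [inner_smul_left, inner_smul_right, integral_const_mul]
    have : ∫ s, inner ℝ (D a s) (D b s) ∂Measure.infinitePi ν = 0 := by
      rcases hinv a ha b hb hab with hi | hi
      · exact integral_inner_eq_zero_of_update (h a ha).memLp (h b hb).memLp (idx b) hi
          (h b hb).centered
      · simp only [fun s => real_inner_comm (D b s) (D a s)]
        exact integral_inner_eq_zero_of_update (h b hb).memLp (h a ha).memLp (idx a) hi
          (h a ha).centered
    rw [this, mul_zero, mul_zero]

end NoiseTerm

theorem memLp_netNorm {Ω V : Type*} [MeasurableSpace Ω] {μ : Measure Ω} {K : ℕ}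
    [NormedAddCommGroup V] {X : Ω → Fin K → V} (hX : ∀ k, MemLp (fun ω => X ω k) 2 μ) :
    MemLp (fun ω => netNorm (X ω)) 2 μ := by
  have hs : AEStronglyMeasurable (fun ω => netNorm (X ω)) μ := by
    have : AEStronglyMeasurable (fun ω => ∑ k, ‖X ω k‖ ^ 2) μ :=
      Finset.aestronglyMeasurable_fun_sum _ fun k _ => (hX k).1.norm.pow 2
    exact Real.continuous_sqrt.comp_aestronglyMeasurable this
  rw [memLp_two_iff_integrable_sq hs]
  simp only [netNorm_sq]
  exact integrable_finsetSum _ fun k _ => (hX k).norm.integrable_sq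

theorem integral_netNorm_le {Ω V : Type*} [MeasurableSpace Ω] {μ : Measure Ω}
    [IsProbabilityMeasure μ] {K : ℕ}
    [NormedAddCommGroup V] {X : Ω → Fin K → V} (hX : ∀ k, MemLp (fun ω => X ω k) 2 μ) :
    ∫ ω, netNorm (X ω) ∂μ ≤ √(∑ k, ∫ ω, ‖X ω k‖ ^ 2 ∂μ) := by
  have h := integral_norm_le_sqrt (memLp_netNorm hX)
  simp only [Real.norm_of_nonneg (netNorm_nonneg _), netNorm_sq] at h
  rwa [integral_finsetSum _ fun k _ => (hX k).norm.integrable_sq] at h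

section Family

variable {K : ℕ} {S V : Type*} [MeasurableSpace S]
  [NormedAddCommGroup V] [InnerProductSpace ℝ V] [MeasurableSpace V] [BorelSpace V]
  [FiniteDimensional ℝ V]

/-- The noise terms of the agents `k` in the local steps `n` of the rounds `i`; the average of
their conditional variances over the agents is at most `w`. -/
structure NoiseFamily (𝒟 : Fin K → Measure S) (D : ℕ → Fin K → ℕ → (SampleIndex K → S) → V)
    (w : ℝ) : Prop where
  exists_var : ∃ v : ℕ → Fin K → (SampleIndex K → S) → ℝ,
    (∀ i k n, NoiseTerm (fun j : SampleIndex K => 𝒟 j.1) (k, some (i, n)) (D i k n) (v i k)) ∧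
    ∀ i, ∑ k, ∫ s, v i k s ∂(Measure.infinitePi fun j : SampleIndex K => 𝒟 j.1) ≤ K * w
  nonanticipating : ∀ i k n i' k' n', (i < i' ∨ i = i' ∧ n ≤ n') → (i, k, n) ≠ (i', k', n') →
    ∀ s t, D i k n (Function.update s (k', some (i', n')) t) = D i k n s

variable {𝒟 : Fin K → Measure S} [∀ k, IsProbabilityMeasure (𝒟 k)]
  {D : ℕ → Fin K → ℕ → (SampleIndex K → S) → V} {w : ℝ}

namespace NoiseFamily

omit [InnerProductSpace ℝ V] [BorelSpace V] [FiniteDimensional ℝ V]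
  [∀ k, IsProbabilityMeasure (𝒟 k)] in
-- Order the indices by round and then by local step. Of two indices one is not later than the
-- other, and ties between different agents are harmless.
theorem or_invariant [InnerProductSpace ℝ V] (h : NoiseFamily 𝒟 D w) (a b : ℕ × Fin K × ℕ)
    (hab : a ≠ b) :
    (∀ s t, D a.1 a.2.1 a.2.2 (Function.update s (b.2.1, some (b.1, b.2.2)) t)
      = D a.1 a.2.1 a.2.2 s) ∨
    (∀ s t, D b.1 b.2.1 b.2.2 (Function.update s (a.2.1, some (a.1, a.2.2)) t)
      = D b.1 b.2.1 b.2.2 s) := by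
  obtain ⟨i, k, n⟩ := a
  obtain ⟨i', k', n'⟩ := b
  by_cases h1 : i < i' ∨ i = i' ∧ n ≤ n'
  · exact Or.inl (h.nonanticipating _ _ _ _ _ _ h1 hab)
  · have h2 : i' < i ∨ i' = i ∧ n' ≤ n := by omega
    exact Or.inr (h.nonanticipating _ _ _ _ _ _ h2 hab.symm)

/-- The averages over the `N` local steps. -/
theorem average (h : NoiseFamily 𝒟 D w) (i N : ℕ) (hN : 0 < N) :
    (∀ k, MemLp (fun s => (N : ℝ)⁻¹ • ∑ n ∈ Finset.range N, D i k n s) 2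
      (Measure.infinitePi fun j : SampleIndex K => 𝒟 j.1)) ∧
    ∫ s, netNorm (fun k => (N : ℝ)⁻¹ • ∑ n ∈ Finset.range N, D i k n s)
      ∂(Measure.infinitePi fun j : SampleIndex K => 𝒟 j.1) ≤ √(K * w / N) := by
  obtain ⟨v, hv, hvw⟩ := h.exists_var
  have hN' : (0 : ℝ) < N := by exact_mod_cast hN
  have key := fun k => integral_norm_sq_sum_noise_le (idx := fun n => (k, some (i, n)))
    (D := D i k) (v := fun _ => v i k) (Finset.range N) (fun n _ => hv i k n)
    (fun n _ n' _ hn => h.or_invariant (i, k, n) (i, k, n') (by simpa using hn))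
    (fun _ => (N : ℝ)⁻¹)
  simp only [← Finset.smul_sum] at key
  refine ⟨fun k => (key k).1, ?_⟩
  refine (integral_netNorm_le fun k => (key k).1).trans (Real.sqrt_le_sqrt ?_)
  calc _ ≤ ∑ k, (N : ℝ)⁻¹ * ∫ s, v i k s ∂(Measure.infinitePi fun j : SampleIndex K => 𝒟 j.1) := by
        refine Finset.sum_le_sum fun k _ => (key k).2.trans (le_of_eq ?_)
        rw [Finset.sum_const, Finset.card_range, nsmul_eq_mul]
        field_simp
    _ = (N : ℝ)⁻¹ * ∑ k, ∫ s, v i k s ∂(Measure.infinitePi fun j : SampleIndex K => 𝒟 j.1) := by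
        rw [← Finset.mul_sum]
    _ ≤ (N : ℝ)⁻¹ * (K * w) := by gcongr; exact hvw i
    _ = _ := by ring

/-- The discounted sums of the network averages. -/
theorem discounted (h : NoiseFamily 𝒟 D w) (hw : 0 ≤ w) (i N : ℕ) (hN : 0 < N) (hK : 0 < K)
    {β : ℝ} (hβ : 0 < β) (hβ1 : β ≤ 1) :
    MemLp (fun s => discountedSum β
      (fun j => centroid fun k => (N : ℝ)⁻¹ • ∑ n ∈ Finset.range N, D j k n s) i) 2
      (Measure.infinitePi fun j : SampleIndex K => 𝒟 j.1) ∧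
    ∫ s, ‖discountedSum β
      (fun j => centroid fun k => (N : ℝ)⁻¹ • ∑ n ∈ Finset.range N, D j k n s) i‖
      ∂(Measure.infinitePi fun j : SampleIndex K => 𝒟 j.1) ≤ √(w / (N * K * β)) := by
  obtain ⟨v, hv, hvw⟩ := h.exists_var
  have hN' : (0 : ℝ) < N := by exact_mod_cast hN
  have hK' : (0 : ℝ) < K := by exact_mod_cast hK
  -- One orthogonal family over rounds, agents and local steps at once, so that all three averagings
  -- contribute to the same second moment.
  let F : Finset (ℕ × Fin K × ℕ) := Finset.range i ×ˢ Finset.univ ×ˢ Finset.range N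
  let wt : ℕ × Fin K × ℕ → ℝ := fun a => (1 - β) ^ (i - 1 - a.1) * ((K : ℝ)⁻¹ * (N : ℝ)⁻¹)
  have e : ∀ s, discountedSum β
      (fun j => centroid fun k => (N : ℝ)⁻¹ • ∑ n ∈ Finset.range N, D j k n s) i
      = ∑ a ∈ F, wt a • D a.1 a.2.1 a.2.2 s := fun s => by
    simp only [F, wt, Finset.sum_product, discountedSum, centroid, Finset.smul_sum, smul_smul]
  simp only [e]
  have key := integral_norm_sq_sum_noise_le (idx := fun a : ℕ × Fin K × ℕ => (a.2.1, some (a.1, a.2.2)))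
    (D := fun a => D a.1 a.2.1 a.2.2) (v := fun a => v a.1 a.2.1) F (fun a _ => hv a.1 a.2.1 a.2.2)
    (fun a _ b _ hab => h.or_invariant a b hab) wt
  refine ⟨key.1, (integral_norm_le_sqrt key.1).trans (Real.sqrt_le_sqrt (key.2.trans ?_))⟩
  calc ∑ a ∈ F, wt a ^ 2 * ∫ s, v a.1 a.2.1 s ∂(Measure.infinitePi fun j : SampleIndex K => 𝒟 j.1)
      = ∑ j ∈ Finset.range i, ((1 - β) ^ (i - 1 - j)) ^ 2 * ((K : ℝ)⁻¹ ^ 2 * (N : ℝ)⁻¹ *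
          ∑ k, ∫ s, v j k s ∂(Measure.infinitePi fun j : SampleIndex K => 𝒟 j.1)) := by
        simp only [F, wt, Finset.sum_product, Finset.sum_const, Finset.card_range, nsmul_eq_mul,
          Finset.mul_sum]
        refine Finset.sum_congr rfl fun j _ => Finset.sum_congr rfl fun k _ => ?_
        field_simp
    _ ≤ ∑ j ∈ Finset.range i, (1 - β) ^ (i - 1 - j) * (w / (N * K)) := by
        refine Finset.sum_le_sum fun j _ => ?_
        have h0 : 0 ≤ 1 - β := by linarith
        -- Orthogonality squares the weights. Replacing the square by the first power loses at most
        -- a constant, and the geometric sum is then at most 1/β.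
        have h1 : ((1 - β) ^ (i - 1 - j)) ^ 2 ≤ (1 - β) ^ (i - 1 - j) :=
          pow_le_of_le_one (pow_nonneg h0 _) (pow_le_one₀ h0 (by linarith)) two_ne_zero
        have h2 : (K : ℝ)⁻¹ ^ 2 * (N : ℝ)⁻¹ *
          ∑ k, ∫ s, v j k s ∂(Measure.infinitePi fun j : SampleIndex K => 𝒟 j.1)
            ≤ w / (N * K) := by
          calc _ ≤ (K : ℝ)⁻¹ ^ 2 * (N : ℝ)⁻¹ * (K * w) := by gcongr; exact hvw j
            _ = _ := by field_simp
        calc _ ≤ ((1 - β) ^ (i - 1 - j)) ^ 2 * (w / (N * K)) := by gcongr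
          _ ≤ _ := by gcongr
    _ = (∑ j ∈ Finset.range i, (1 - β) ^ j) * (w / (N * K)) := by
        rw [← Finset.sum_mul, Finset.sum_range_reflect (fun j => (1 - β) ^ j)]
    _ ≤ 1 / β * (w / (N * K)) := by
        gcongr
        exact sum_one_sub_pow_le hβ hβ1 i
    _ = _ := by field_simp

end NoiseFamily

end Family

end LocalDiMA

end

/-! ### The noise families generated by a run -/

noncomputable section

namespace LocalDiMA

variable {K M₁ M₂ : ℕ} {S : Type*}

section Dependence

variable {p : Params} {Q : Fin K → Vec M₁ M₂ → S → ℝ} {A : Matrix (Fin K) (Fin K) ℝ}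
  {z₀ zm : Vec M₁ M₂} {s s' : SampleIndex K → S}

theorem localIterate_congr (q : Vec M₁ M₂ → S → ℝ) {s s' : ℕ → S} (z : Vec M₁ M₂) (n : ℕ)
    (h : ∀ m < n, s m = s' m) : localIterate p q s z n = localIterate p q s' z n := by
  induction n with
  | zero => rfl
  | succ n ih =>
    rw [localIterate, localIterate, ih fun m hm => h m (by omega), h n (by omega)]

theorem run_congr (i : ℕ) (h0 : ∀ k, s (k, none) = s' (k, none))
    (h : ∀ k i' n, i' < i → s (k, some (i', n)) = s' (k, some (i', n))) :
    run p Q A z₀ zm s i = run p Q A z₀ zm s' i := by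
  induction i with
  | zero => simp only [run, h0]
  | succ i ih =>
    have h1 : (fun k n => s (k, some (i, n))) = fun k n => s' (k, some (i, n)) := by
      funext k n
      exact h k i n (by omega)
    rw [run, run, ih fun k i' n hi => h k i' n (by omega), h1]

theorem run_update (i : ℕ) {k' : Fin K} {i' n' : ℕ} (hi : i ≤ i') (t : S) :
    run p Q A z₀ zm (Function.update s (k', some (i', n')) t) i = run p Q A z₀ zm s i := by
  refine run_congr i (fun k => ?_) fun k j n hj => ?_
  · exact Function.update_of_ne (by simp) _ _
  · refine Function.update_of_ne ?_ _ _
    simp only [ne_eq, Prod.mk.injEq, Option.some.injEq, not_and]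
    intros
    omega

end Dependence

theorem LipschitzConditions.measurable_gradient {c : Constants} {J : Vec M₁ M₂ → ℝ}
    (h : LipschitzConditions c J) (hL : 0 ≤ c.Lf) : Measurable (gradient J) := by
  have : LipschitzWith ⟨c.Lf, hL⟩ (gradient J) :=
    LipschitzWith.of_dist_le_mul fun z w => by
      rw [dist_eq_norm, dist_eq_norm]
      exact h.gradient_lipschitz z w
  exact this.continuous.measurable

section Families

variable (p : Params) (Q : Fin K → Vec M₁ M₂ → S → ℝ) (A : Matrix (Fin K) (Fin K) ℝ)
  (z₀ zm : Vec M₁ M₂) (J : Fin K → Vec M₁ M₂ → ℝ)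

/-- The gradient noise of agent `k` in local step `n` of round `i`. -/
def stepGradNoise (i : ℕ) (k : Fin K) (n : ℕ) (s : SampleIndex K → S) : Vec M₁ M₂ :=
  gradient (fun w => Q k w (s (k, some (i, n))))
      (localIterate p (Q k) (fun n => s (k, some (i, n))) ((run p Q A z₀ zm s i).z k) n)
    - gradient (J k)
      (localIterate p (Q k) (fun n => s (k, some (i, n))) ((run p Q A z₀ zm s i).z k) n)

/-- The Hessian noise of agent `k` in local step `n` of round `i`. -/
def stepHessNoise (i : ℕ) (k : Fin K) (n : ℕ) (s : SampleIndex K → S) : Vec M₁ M₂ :=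
  hvp (fun w => Q k w (s (k, some (i, n)))) ((run p Q A z₀ zm s i).z k)
      ((run p Q A z₀ zm s i).zPrev k)
    - hvp (J k) ((run p Q A z₀ zm s i).z k) ((run p Q A z₀ zm s i).zPrev k)

variable {p Q A z₀ zm J}

/-- The point reached before local step n uses only the samples of its own agent and round with
local index below n. Neither the sample of step n nor any later one matters. -/
theorem localIterate_update (s : SampleIndex K → S) (z : Vec M₁ M₂) {i n i' n' : ℕ}
    {k k' : Fin K} (h : (i, k, n) = (i', k', n') ∨ (i < i' ∨ i = i' ∧ n ≤ n')) (t : S) :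
    localIterate p (Q k) (fun m => Function.update s (k', some (i', n')) t (k, some (i, m))) z n
      = localIterate p (Q k) (fun m => s (k, some (i, m))) z n := by
  refine localIterate_congr _ _ _ fun m hm => Function.update_of_ne ?_ _ _
  simp only [Prod.mk.injEq] at h
  simp only [ne_eq, Prod.mk.injEq, Option.some.injEq, not_and]
  intros
  omega

variable [MeasurableSpace S] {c : Constants} {𝒟 : Fin K → Measure S}

omit [MeasurableSpace S] in
-- With all other samples frozen the evaluation point is fixed, so the oracle assumptions at a
-- deterministic point give mean and variance.
theorem stepGradNoise_update_self (i : ℕ) (k : Fin K) (n : ℕ) (s : SampleIndex K → S) (t : S) :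
    stepGradNoise p Q A z₀ zm J i k n (Function.update s (k, some (i, n)) t)
      = gradient (fun w => Q k w t)
          (localIterate p (Q k) (fun n => s (k, some (i, n))) ((run p Q A z₀ zm s i).z k) n)
        - gradient (J k)
          (localIterate p (Q k) (fun n => s (k, some (i, n))) ((run p Q A z₀ zm s i).z k) n) := by
  rw [stepGradNoise, run_update i le_rfl, localIterate_update s _ (Or.inl rfl),
    Function.update_self]

omit [MeasurableSpace S] in
theorem stepHessNoise_update_self (i : ℕ) (k : Fin K) (n : ℕ) (s : SampleIndex K → S) (t : S) :
    stepHessNoise p Q A z₀ zm J i k n (Function.update s (k, some (i, n)) t)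
      = hvp (fun w => Q k w t) ((run p Q A z₀ zm s i).z k) ((run p Q A z₀ zm s i).zPrev k)
        - hvp (J k) ((run p Q A z₀ zm s i).z k) ((run p Q A z₀ zm s i).zPrev k) := by
  rw [stepHessNoise, run_update i le_rfl, Function.update_self]

omit [MeasurableSpace S] in
theorem update_apply_of_ne {s : SampleIndex K → S} {i n i' n' : ℕ} {k k' : Fin K}
    (h : (i, k, n) ≠ (i', k', n')) (t : S) :
    Function.update s (k', some (i', n')) t (k, some (i, n)) = s (k, some (i, n)) := by
  refine Function.update_of_ne (fun h1 => h ?_) _ _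
  simp only [Prod.mk.injEq, Option.some.injEq] at h1 ⊢
  tauto

variable [∀ k, IsProbabilityMeasure (𝒟 k)]

theorem noiseFamily_grad (h : RunConditions c p A J)
    (ho : ∀ k, BoundedVariance c (Q k) (𝒟 k) (J k)) :
    NoiseFamily 𝒟 (stepGradNoise p Q A z₀ zm J) (c.σ ^ 2) where
  exists_var := by
    refine ⟨fun _ _ _ => c.σ ^ 2, fun i k n => ⟨?_, integrable_const _, fun _ => sq_nonneg _,
      fun s => ?_, fun s => ?_⟩, fun i => by simp⟩
    · have hs : ∀ n, Measurable fun s : SampleIndex K → S => s (k, some (i, n)) :=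
        fun n => measurable_pi_apply _
      have hY := measurable_localIterate (p := p) ho k (s := fun s n => s (k, some (i, n))) hs
        ((measurable_run (p := p) (A := A) ho z₀ zm i).1 k) n
      exact ((ho k).measurable_gradient_comp hY (hs n)).sub
        (((h.lipschitz k).measurable_gradient h.Lf_pos.le).comp hY)
    · simp only [stepGradNoise_update_self]
      exact (ho k).integral_gradient_sub _
    · simp only [stepGradNoise_update_self]
      exact (ho k).gradient_variance _
  nonanticipating i k n i' k' n' hle hne s t := by
    rw [stepGradNoise, run_update i (by omega), localIterate_update s _ (Or.inr hle),
      update_apply_of_ne hne]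
    rfl

theorem measurable_hvp_cost (h : RunConditions c p A J) (k : Fin K) {Ω : Type*}
    [MeasurableSpace Ω] {z z' : Ω → Vec M₁ M₂} (hz : Measurable z) (hz' : Measurable z') :
    Measurable fun ω => hvp (J k) (z ω) (z' ω) :=
  measurable_fderiv_apply_of_differentiable (S := Unit) (g := fun z _ => gradient (J k) z)
    (ξ := fun _ => ()) (fun _ => measurable_const)
    (fun _ => (h.lipschitz k).gradient_differentiable) hz (hz.sub hz') measurable_const

/-- The conditional variance of an agent is σ_h² times its squared displacement, which is random.
Only the sum over the agents has the sharp deterministic bound, and this is why noise families ask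
for an average over agents. -/
theorem noiseFamily_hess (h : RunConditions c p A J) (hz : CloseStart p z₀ zm)
    (ho : ∀ k, BoundedVariance c (Q k) (𝒟 k) (J k)) :
    NoiseFamily 𝒟 (stepHessNoise p Q A z₀ zm J)
      (c.σh ^ 2 * (4 * p.μy / (1 - mixingRate A)) ^ 2) where
  exists_var := by
    have hdz : ∀ i k, Measurable fun s : SampleIndex K → S => c.σh ^ 2 *
        ‖(run p Q A z₀ zm s i).z k - (run p Q A z₀ zm s i).zPrev k‖ ^ 2 := fun i k => by
      have hr := measurable_run (p := p) (A := A) ho z₀ zm i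
      exact (((hr.1 k).sub (hr.2.1 k)).norm.pow_const 2).const_mul _
    have hb : ∀ i (s : SampleIndex K → S),
        ∑ k, ‖(run p Q A z₀ zm s i).z k - (run p Q A z₀ zm s i).zPrev k‖ ^ 2
          ≤ K * (4 * p.μy / (1 - mixingRate A)) ^ 2 := fun i s => by
      have h2 := pow_le_pow_left₀ (netNorm_nonneg _)
        (h.netNorm_z_sub_zPrev_le (Q := Q) (s := s) hz i) 2
      rwa [netNorm_sq, mul_pow, Real.sq_sqrt h.K_pos'.le] at h2
    have hint : ∀ i k, Integrable (fun s : SampleIndex K → S => c.σh ^ 2 *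
        ‖(run p Q A z₀ zm s i).z k - (run p Q A z₀ zm s i).zPrev k‖ ^ 2)
        (Measure.infinitePi fun j : SampleIndex K => 𝒟 j.1) := fun i k => by
      refine Integrable.of_bound (hdz i k).aestronglyMeasurable
        (c.σh ^ 2 * (K * (4 * p.μy / (1 - mixingRate A)) ^ 2))
        (Filter.Eventually.of_forall fun s => ?_)
      rw [Real.norm_of_nonneg (by positivity)]
      gcongr
      exact (Finset.single_le_sum (f := fun k =>
        ‖(run p Q A z₀ zm s i).z k - (run p Q A z₀ zm s i).zPrev k‖ ^ 2)
        (fun _ _ => sq_nonneg _) (Finset.mem_univ k)).trans (hb i s)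
    refine ⟨fun i k s => c.σh ^ 2 *
        ‖(run p Q A z₀ zm s i).z k - (run p Q A z₀ zm s i).zPrev k‖ ^ 2,
      fun i k n => ⟨?_, hint i k, fun _ => by positivity, fun s => ?_, fun s => ?_⟩, fun i => ?_⟩
    · have hr := measurable_run (p := p) (A := A) ho z₀ zm i
      exact ((ho k).measurable_hvp (hr.1 k) (hr.2.1 k) (measurable_pi_apply _)).sub
        (measurable_hvp_cost h k (hr.1 k) (hr.2.1 k))
    · simp only [stepHessNoise_update_self]
      exact (ho k).integral_hvp_sub _ _
    · simp only [stepHessNoise_update_self]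
      exact (ho k).lintegral_hvp_sub_le _ _
    · rw [← integral_finsetSum _ fun k _ => hint i k]
      have hle := integral_mono (integrable_finsetSum Finset.univ fun k _ => hint i k)
        (integrable_const (c.σh ^ 2 * (K * (4 * p.μy / (1 - mixingRate A)) ^ 2))) fun s => by
          simp only [← Finset.mul_sum]
          exact mul_le_mul_of_nonneg_left (hb i s) (sq_nonneg _)
      refine hle.trans (le_of_eq ?_)
      simp
      ring
  nonanticipating i k n i' k' n' hle hne s t := by
    rw [stepHessNoise, run_update i (by omega), update_apply_of_ne hne]
    rfl

omit [MeasurableSpace S] in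
theorem momentumError_zero (s : SampleIndex K → S) (k : Fin K) :
    momentumError p Q A z₀ zm s J 0 k
      = gradient (fun w => Q k w (s (k, none))) zm - gradient (J k) zm :=
  rfl

theorem noiseTerm_init (ho : ∀ k, BoundedVariance c (Q k) (𝒟 k) (J k)) (k : Fin K) :
    NoiseTerm (fun j : SampleIndex K => 𝒟 j.1) (k, none)
      (fun s => momentumError p Q A z₀ zm s J 0 k) (fun _ => c.σ ^ 2) := by
  have e : ∀ s t, momentumError p Q A z₀ zm (Function.update s (k, none) t) J 0 k
      = gradient (fun w => Q k w t) zm - gradient (J k) zm := fun s t => by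
    rw [momentumError_zero, Function.update_self]
  refine ⟨?_, integrable_const _, fun _ => sq_nonneg _, fun s => ?_, fun s => ?_⟩
  · have h1 : Measurable fun s : SampleIndex K → S => gradient (fun w => Q k w (s (k, none))) zm :=
      ((ho k).measurable_gradient zm).comp (measurable_pi_apply _)
    simp only [momentumError_zero]
    exact h1.sub measurable_const
  · simp only [e]
    exact (ho k).integral_gradient_sub zm
  · simp only [e]
    exact (ho k).gradient_variance zm

theorem memLp_momentumError_zero (ho : ∀ k, BoundedVariance c (Q k) (𝒟 k) (J k)) (k : Fin K) :
    MemLp (fun s => momentumError p Q A z₀ zm s J 0 k) 2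
      (Measure.infinitePi fun j : SampleIndex K => 𝒟 j.1) :=
  (noiseTerm_init ho k).memLp

theorem integral_netNorm_momentumError_zero_le (hσ : 0 ≤ c.σ)
    (ho : ∀ k, BoundedVariance c (Q k) (𝒟 k) (J k)) :
    ∫ s, netNorm (momentumError p Q A z₀ zm s J 0)
      ∂(Measure.infinitePi fun j : SampleIndex K => 𝒟 j.1) ≤ √K * c.σ := by
  refine (integral_netNorm_le fun k => memLp_momentumError_zero ho k).trans ?_
  have h1 : ∑ k, ∫ s, ‖momentumError p Q A z₀ zm s J 0 k‖ ^ 2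
      ∂(Measure.infinitePi fun j : SampleIndex K => 𝒟 j.1) ≤ K * c.σ ^ 2 := by
    refine (Finset.sum_le_sum fun k _ => (noiseTerm_init ho k).integral_sq_le).trans ?_
    simp
  refine (Real.sqrt_le_sqrt h1).trans (le_of_eq ?_)
  rw [Real.sqrt_mul (Nat.cast_nonneg K), Real.sqrt_sq hσ]

/-- The initial samples of different agents are independent, so averaging over the network gains √K.
-/
theorem integral_norm_centroid_momentumError_zero_le (hσ : 0 ≤ c.σ) (hK : 0 < K)
    (ho : ∀ k, BoundedVariance c (Q k) (𝒟 k) (J k)) :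
    MemLp (fun s => centroid (momentumError p Q A z₀ zm s J 0)) 2
      (Measure.infinitePi fun j : SampleIndex K => 𝒟 j.1) ∧
    ∫ s, ‖centroid (momentumError p Q A z₀ zm s J 0)‖
      ∂(Measure.infinitePi fun j : SampleIndex K => 𝒟 j.1) ≤ c.σ / √K := by
  have hK' : (0 : ℝ) < K := by exact_mod_cast hK
  have key := integral_norm_sq_sum_noise_le (ν := fun j : SampleIndex K => 𝒟 j.1)
    (idx := fun k : Fin K => (k, none)) (D := fun k s => momentumError p Q A z₀ zm s J 0 k)
    (v := fun _ _ => c.σ ^ 2) Finset.univ (fun k _ => noiseTerm_init ho k)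
    (fun a _ b _ hab => Or.inl fun s t => by
      rw [momentumError_zero, momentumError_zero, Function.update_of_ne (by simp [hab])])
    (fun _ => (K : ℝ)⁻¹)
  simp only [← Finset.smul_sum] at key
  refine ⟨key.1, (integral_norm_le_sqrt key.1).trans ?_⟩
  refine (Real.sqrt_le_sqrt key.2).trans (le_of_eq ?_)
  rw [← Real.sqrt_sq hσ, ← Real.sqrt_div (sq_nonneg _), Real.sqrt_sq hσ]
  congr 1
  simp
  field_simp

end Families

end LocalDiMA

end

/-! ### Taking expectations of the summed bound -/

noncomputable section

namespace LocalDiMA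

variable {K M₁ M₂ : ℕ} {S : Type*}

section IntegralBound

variable {Ω : Type*} [MeasurableSpace Ω] {μ : Measure Ω}

/-- An integrable function with integral at most `b`. -/
def IntegralLe (μ : Measure Ω) (f : Ω → ℝ) (b : ℝ) : Prop := Integrable f μ ∧ ∫ ω, f ω ∂μ ≤ b

theorem IntegralLe.add {f g : Ω → ℝ} {a b : ℝ} (hf : IntegralLe μ f a) (hg : IntegralLe μ g b) :
    IntegralLe μ (fun ω => f ω + g ω) (a + b) :=
  ⟨hf.1.add hg.1, by rw [integral_add hf.1 hg.1]; exact add_le_add hf.2 hg.2⟩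

theorem IntegralLe.const_mul {f : Ω → ℝ} {a r : ℝ} (hr : 0 ≤ r) (hf : IntegralLe μ f a) :
    IntegralLe μ (fun ω => r * f ω) (r * a) :=
  ⟨hf.1.const_mul r, by rw [integral_const_mul]; exact mul_le_mul_of_nonneg_left hf.2 hr⟩

theorem IntegralLe.const [IsProbabilityMeasure μ] (a : ℝ) : IntegralLe μ (fun _ => a) a :=
  ⟨integrable_const _, by simp⟩

theorem IntegralLe.sum {α : Type*} (F : Finset α) {f : α → Ω → ℝ} {a : α → ℝ}
    (hf : ∀ i ∈ F, IntegralLe μ (f i) (a i)) :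
    IntegralLe μ (fun ω => ∑ i ∈ F, f i ω) (∑ i ∈ F, a i) :=
  ⟨integrable_finsetSum _ fun i hi => (hf i hi).1, by
    rw [integral_finsetSum _ fun i hi => (hf i hi).1]
    exact Finset.sum_le_sum fun i hi => (hf i hi).2⟩

theorem IntegralLe.self {f : Ω → ℝ} (hf : Integrable f μ) : IntegralLe μ f (∫ ω, f ω ∂μ) :=
  ⟨hf, le_rfl⟩

end IntegralBound

section Sampling

variable [MeasurableSpace S] {Ω : Type*} [MeasurableSpace Ω] {P : Measure Ω}
  {𝒟 : Fin K → Measure S} {ξ : SampleIndex K → Ω → S}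

/-- The law of the samples. -/
def pathLaw (𝒟 : Fin K → Measure S) : Measure (SampleIndex K → S) :=
  Measure.infinitePi fun j => 𝒟 j.1

instance [∀ k, IsProbabilityMeasure (𝒟 k)] : IsProbabilityMeasure (pathLaw 𝒟) := by
  unfold pathLaw; infer_instance

variable [IsProbabilityMeasure P]

/-- Independence and the prescribed marginals say that the joint law is the product law, so all
expectations may be computed on path space. -/
theorem IsSampling.measurePreserving (h : IsSampling P 𝒟 ξ) :
    MeasurePreserving (fun ω j => ξ j ω) P (pathLaw 𝒟) := by
  refine ⟨measurable_pi_lambda _ h.measurable, ?_⟩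
  rw [(iIndepFun_iff_map_fun_eq_infinitePi_map h.measurable).1 h.indep, pathLaw]
  congr 1
  funext j
  exact h.law j

theorem IsSampling.integral_comp (h : IsSampling P 𝒟 ξ) {f : (SampleIndex K → S) → ℝ}
    (hf : AEStronglyMeasurable f (pathLaw 𝒟)) :
    ∫ ω, f (fun j => ξ j ω) ∂P = ∫ s, f s ∂(pathLaw 𝒟) := by
  have hm := h.measurePreserving
  rw [← hm.map_eq, integral_map hm.measurable.aemeasurable (by rwa [hm.map_eq])]

end Sampling

section Integrability

variable [MeasurableSpace S] {c : Constants} {p : Params} {Q : Fin K → Vec M₁ M₂ → S → ℝ}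
  {𝒟 : Fin K → Measure S} {A : Matrix (Fin K) (Fin K) ℝ} {z₀ zm : Vec M₁ M₂}

theorem SmoothPL.measurable_gradient {J : Vec M₁ M₂ → ℝ} (h : SmoothPL c J) :
    Measurable (gradient J) := by
  have : LipschitzWith ⟨c.Lf, h.Lf_pos.le⟩ (gradient J) :=
    LipschitzWith.of_dist_le_mul fun z w => by
      rw [dist_eq_norm, dist_eq_norm]
      exact h.gradient_lipschitz z w
  exact this.continuous.measurable

theorem SmoothPL.measurable_norm_gradX {J : Vec M₁ M₂ → ℝ} (h : SmoothPL c J) :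
    Measurable fun z => ‖gradX J z‖ :=
  (measurable_fst_vec.comp h.measurable_gradient).norm

theorem SmoothPL.measurable_norm_gradY {J : Vec M₁ M₂ → ℝ} (h : SmoothPL c J) :
    Measurable fun z => ‖gradY J z‖ :=
  (measurable_snd_vec.comp h.measurable_gradient).norm

/-- Normalized steps confine the centroid to a deterministic ball around the start, so the gradients
there are bounded and hence integrable. -/
theorem Assumptions.norm_gradient_centroidIterate_le (h : Assumptions c Q 𝒟 A)
    (hp : StepConditions c p) (s : SampleIndex K → S) (i : ℕ) :
    ‖gradient (globalCost Q 𝒟) (centroidIterate p Q A z₀ zm s i)‖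
      ≤ ‖gradient (globalCost Q 𝒟) z₀‖ + c.Lf * (i * (2 * p.μy)) := by
  have hs := h.smoothPL
  have h1 := hs.gradient_lipschitz (centroidIterate p Q A z₀ zm s i) z₀
  have h2 := mul_le_mul_of_nonneg_left
    ((h.runConditions hp).norm_centroidIterate_sub_le (Q := Q) (z₀ := z₀) (zm := zm) (s := s) i)
    hs.Lf_pos.le
  have h3 := norm_sub_norm_le (gradient (globalCost Q 𝒟) (centroidIterate p Q A z₀ zm s i))
    (gradient (globalCost Q 𝒟) z₀)
  linarith

theorem Assumptions.integrable_norm_grad (h : Assumptions c Q 𝒟 A) (hp : StepConditions c p)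
    {Ω : Type*} [MeasurableSpace Ω] {P : Measure Ω} [IsFiniteMeasure P]
    {ξ : Ω → SampleIndex K → S} (hξ : Measurable ξ) (i : ℕ) :
    Integrable (fun ω => ‖gradX (globalCost Q 𝒟) (centroidIterate p Q A z₀ zm (ξ ω) i)‖) P ∧
    Integrable (fun ω => ‖gradY (globalCost Q 𝒟) (centroidIterate p Q A z₀ zm (ξ ω) i)‖) P := by
  have hs := h.smoothPL
  have hm := (measurable_centroidIterate (p := p) (A := A) h.oracle z₀ zm i).comp hξ
  constructor
  · refine Integrable.of_bound (hs.measurable_norm_gradX.comp hm).aestronglyMeasurable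
      (‖gradient (globalCost Q 𝒟) z₀‖ + c.Lf * (i * (2 * p.μy)))
      (Filter.Eventually.of_forall fun ω => ?_)
    rw [norm_norm]
    exact (norm_fst_le _).trans (h.norm_gradient_centroidIterate_le hp _ i)
  · refine Integrable.of_bound (hs.measurable_norm_gradY.comp hm).aestronglyMeasurable
      (‖gradient (globalCost Q 𝒟) z₀‖ + c.Lf * (i * (2 * p.μy)))
      (Filter.Eventually.of_forall fun ω => ?_)
    rw [norm_norm]
    exact (norm_snd_le _).trans (h.norm_gradient_centroidIterate_le hp _ i)

end Integrability

section Expectation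

variable [MeasurableSpace S] {c : Constants} {p : Params} {Q : Fin K → Vec M₁ M₂ → S → ℝ}
  {𝒟 : Fin K → Measure S} {A : Matrix (Fin K) (Fin K) ℝ} {z₀ zm : Vec M₁ M₂}

/-- The expected initial consensus error of a component of the tracking variables. -/
def meanInitTracking {W : Type*} [NormedAddCommGroup W] [InnerProductSpace ℝ W]
    (Q : Fin K → Vec M₁ M₂ → S → ℝ) (𝒟 : Fin K → Measure S) (zm : Vec M₁ M₂)
    (L : Vec M₁ M₂ →L[ℝ] W) : ℝ :=
  ∫ s, consensusError (fun k => L (gradient (fun w => Q k w (s (k, none))) zm)) ∂(pathLaw 𝒟)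

/-- The expected initial error of a component of the momenta. -/
def meanInitMomentum {W : Type*} [NormedAddCommGroup W] [InnerProductSpace ℝ W]
    (Q : Fin K → Vec M₁ M₂ → S → ℝ) (𝒟 : Fin K → Measure S) (zm : Vec M₁ M₂)
    (L : Vec M₁ M₂ →L[ℝ] W) : ℝ :=
  ∫ s, netNorm (fun k => L (gradient (fun w => Q k w (s (k, none))) zm
    - gradient (localCost Q 𝒟 k) zm)) ∂(pathLaw 𝒟)

/-- The projection `z = col {x, y} ↦ x`. -/
def projX (M₁ M₂ : ℕ) : Vec M₁ M₂ →L[ℝ] EuclideanSpace ℝ (Fin M₁) := WithLp.fstL 2 ℝ _ _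

/-- The projection `z = col {x, y} ↦ y`. -/
def projY (M₁ M₂ : ℕ) : Vec M₁ M₂ →L[ℝ] EuclideanSpace ℝ (Fin M₂) := WithLp.sndL 2 ℝ _ _

variable [∀ k, IsProbabilityMeasure (𝒟 k)]

theorem Assumptions.memLp_init_sub (h : Assumptions c Q 𝒟 A) (zm : Vec M₁ M₂) (k : Fin K) :
    MemLp (fun s => gradient (fun w => Q k w (s (k, none))) zm - gradient (localCost Q 𝒟 k) zm) 2
      (pathLaw 𝒟) :=
  -- The initial momentum error depends neither on the parameters nor on `z₀`, so arbitrary values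
  -- are inserted.
  memLp_momentumError_zero (p := ⟨0, 0, 0, 0, 0, 0, 0⟩) (A := A) (z₀ := zm) (J := localCost Q 𝒟) h.oracle k

section Init

variable {W : Type*} [NormedAddCommGroup W] [InnerProductSpace ℝ W] (L : Vec M₁ M₂ →L[ℝ] W)

theorem Assumptions.memLp_init_momentum (h : Assumptions c Q 𝒟 A) (zm : Vec M₁ M₂) :
    MemLp (fun s => netNorm fun k => L (gradient (fun w => Q k w (s (k, none))) zm
      - gradient (localCost Q 𝒟 k) zm)) 2 (pathLaw 𝒟) :=
  memLp_netNorm fun k => L.comp_memLp' (h.memLp_init_sub zm k)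

theorem Assumptions.integrable_init_momentum (h : Assumptions c Q 𝒟 A) (zm : Vec M₁ M₂) :
    Integrable (fun s => netNorm fun k => L (gradient (fun w => Q k w (s (k, none))) zm
      - gradient (localCost Q 𝒟 k) zm)) (pathLaw 𝒟) :=
  (h.memLp_init_momentum L zm).integrable (by norm_num)

theorem Assumptions.integrable_init_tracking (h : Assumptions c Q 𝒟 A) (zm : Vec M₁ M₂) :
    Integrable (fun s => consensusError fun k => L (gradient (fun w => Q k w (s (k, none))) zm))
      (pathLaw 𝒟) := by
  have h1 : ∀ k, MemLp (fun s : SampleIndex K → S =>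
      L (gradient (fun w => Q k w (s (k, none))) zm)) 2 (pathLaw 𝒟) := fun k => by
    have := L.comp_memLp' ((h.memLp_init_sub zm k).add (memLp_const (gradient (localCost Q 𝒟 k) zm)))
    refine this.ae_eq (Filter.Eventually.of_forall fun s => ?_)
    simp
  have h2 : MemLp (fun s : SampleIndex K → S =>
      centroid fun k => L (gradient (fun w => Q k w (s (k, none))) zm)) 2 (pathLaw 𝒟) :=
    (memLp_finsetSum _ fun k _ => h1 k).const_smul _
  exact (memLp_netNorm fun k => (h1 k).sub h2).integrable (by norm_num)

omit [∀ k, IsProbabilityMeasure (𝒟 k)] in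
theorem meanInitTracking_nonneg : 0 ≤ meanInitTracking Q 𝒟 zm L :=
  integral_nonneg fun _ => consensusError_nonneg _

omit [∀ k, IsProbabilityMeasure (𝒟 k)] in
theorem meanInitMomentum_nonneg : 0 ≤ meanInitMomentum Q 𝒟 zm L :=
  integral_nonneg fun _ => netNorm_nonneg _

variable {L}

theorem Assumptions.meanInitMomentum_le (h : Assumptions c Q 𝒟 A) (hL : ∀ v, ‖L v‖ ≤ ‖v‖)
    (zm : Vec M₁ M₂) : meanInitMomentum Q 𝒟 zm L ≤ √K * c.σ := by
  refine le_trans ?_ (integral_netNorm_momentumError_zero_le (p := ⟨0, 0, 0, 0, 0, 0, 0⟩) (A := A)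
    (z₀ := zm) (zm := zm) (J := localCost Q 𝒟) h.σ_nonneg h.oracle)
  exact integral_mono (h.integrable_init_momentum L zm)
    (h.integrable_init_momentum (ContinuousLinearMap.id ℝ _) zm)
    fun s => netNorm_mono fun k => hL _

/-- The initial gradients differ between agents by noise and by heterogeneity of the costs. This is
the only place where heterogeneity enters the rate. -/
theorem Assumptions.meanInitTracking_le (h : Assumptions c Q 𝒟 A) (hL : ∀ v, ‖L v‖ ≤ ‖v‖)
    {G : ℝ} {z₀ zm : Vec M₁ M₂} (hG : InitialBound G Q 𝒟 z₀ zm) :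
    meanInitTracking Q 𝒟 zm L ≤ √K * c.σ + √K * G := by
  have h1 : ∀ s : SampleIndex K → S,
      consensusError (fun k => L (gradient (fun w => Q k w (s (k, none))) zm))
      ≤ netNorm (fun k => L (gradient (fun w => Q k w (s (k, none))) zm
        - gradient (localCost Q 𝒟 k) zm)) + √K * G := fun s => by
    have e1 := consensusError_add_le
      (fun k => L (gradient (fun w => Q k w (s (k, none))) zm - gradient (localCost Q 𝒟 k) zm))
      (fun k => L (gradient (localCost Q 𝒟 k) zm))
    simp only [← map_add, sub_add_cancel] at e1
    have e2 : consensusError (fun k => L (gradient (localCost Q 𝒟 k) zm)) ≤ √K * G := by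
      refine le_trans (netNorm_mono fun k => ?_) hG.heterogeneity
      rw [gradient_globalCost fun k => (h.lipschitz k).differentiable,
        ← map_centroid L (fun k => gradient (localCost Q 𝒟 k) zm), ← map_sub]
      exact hL _
    exact e1.trans (add_le_add (consensusError_le_netNorm h.agents_pos _) e2)
  have h2 := integral_mono (h.integrable_init_tracking L zm)
    ((h.integrable_init_momentum L zm).add (integrable_const (√K * G))) h1
  refine h2.trans ?_
  rw [integral_add' (h.integrable_init_momentum L zm) (integrable_const _)]
  have h3 := h.meanInitMomentum_le hL zm
  unfold meanInitMomentum at h3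
  simpa using h3

end Init

/-- The bias and noise level of the search directions. -/
def noiseLevel (c : Constants) (p : Params) (K : ℕ) (lam : ℝ) : ℝ :=
  lam / (1 - lam) / √K * (2 * √(K * (c.σh ^ 2 * (4 * p.μy / (1 - lam)) ^ 2) / p.N)
      + 2 * p.β * √(K * c.σ ^ 2 / p.N) + 3 * c.Lf * (√K * (4 * p.μy / (1 - lam)))
      + 2 * p.β * (√K * (2 * c.Lf * p.N * p.μby)))
    + √(c.σh ^ 2 * (4 * p.μy / (1 - lam)) ^ 2 / (p.N * K * p.β))
    + p.β * √(c.σ ^ 2 / (p.N * K * p.β))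
    + (c.Lh * (4 * p.μy / (1 - lam)) ^ 2 / p.β + 2 * c.Lf * p.N * p.μby)
    + c.Lf * (lam / (1 - lam) * (2 * p.μy))

/-- The pathwise bound integrated term by term. The initial averaged momentum error is discounted
geometrically, so over all rounds it costs 1/β and not T. -/
theorem Assumptions.sum_integral_gradNorms_le (h : Assumptions c Q 𝒟 A) (hp : StepConditions c p)
    (hβ1 : p.β ≤ 1) (hz : CloseStart p z₀ zm) (T : ℕ) :
    ∑ i ∈ Finset.range T, ∫ s, gradNorms (globalCost Q 𝒟) (centroidIterate p Q A z₀ zm s i)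
        ∂(pathLaw 𝒟) ≤
      (envelope (globalCost Q 𝒟) z₀.fst - optValue (globalCost Q 𝒟)) / p.μx
      + 6 * c.κ * (initialGap (globalCost Q 𝒟) z₀ / p.μy)
      + T * (c.L * p.μx + 6 * c.κ * (c.Lf * p.μx / 4 + 4 * c.Lf * p.μy))
      + mixingRate A / (1 - mixingRate A) / √K *
        (2 * (meanInitTracking Q 𝒟 zm (projX M₁ M₂) + meanInitMomentum Q 𝒟 zm (projX M₁ M₂))
          + 12 * c.κ *
            (meanInitTracking Q 𝒟 zm (projY M₁ M₂) + meanInitMomentum Q 𝒟 zm (projY M₁ M₂)))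
      + 14 * c.κ * (T * noiseLevel c p K (mixingRate A) + c.σ / √K / p.β) := by
  have hr := h.runConditions hp
  have hκ := h.one_le_κ
  have hl := mixingRate_nonneg A
  have hl1 : 0 < 1 - mixingRate A := by linarith [hr.mixingRate_lt_one]
  have hβ := hp.β_pos
  have hρ : 0 ≤ mixingRate A / (1 - mixingRate A) / √K := by positivity
  have hint : ∀ i, Integrable (fun s => gradNorms (globalCost Q 𝒟)
      (centroidIterate p Q A z₀ zm s i)) (pathLaw 𝒟) := fun i => by
    have := h.integrable_norm_grad hp (z₀ := z₀) (zm := zm) (P := pathLaw 𝒟) (ξ := fun s => s)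
      measurable_id i
    exact this.1.add this.2
  have hFg := noiseFamily_grad (z₀ := z₀) (zm := zm) hr h.oracle
  have hFh := noiseFamily_hess (z₀ := z₀) (zm := zm) hr hz h.oracle
  have hd0 : 0 ≤ c.σh ^ 2 * (4 * p.μy / (1 - mixingRate A)) ^ 2 := by positivity
  have hH : ∀ i, IntegralLe (pathLaw 𝒟)
      (fun s => netNorm (runHessNoise p Q A z₀ zm s (localCost Q 𝒟) i))
      √(K * (c.σh ^ 2 * (4 * p.μy / (1 - mixingRate A)) ^ 2) / p.N) := fun i =>
    ⟨(memLp_netNorm (hFh.average i p.N hr.N_pos).1).integrable (by norm_num),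
      (hFh.average i p.N hr.N_pos).2⟩
  have hG : ∀ i, IntegralLe (pathLaw 𝒟)
      (fun s => netNorm (runGradNoise p Q A z₀ zm s (localCost Q 𝒟) i))
      √(K * c.σ ^ 2 / p.N) := fun i =>
    ⟨(memLp_netNorm (hFg.average i p.N hr.N_pos).1).integrable (by norm_num),
      (hFg.average i p.N hr.N_pos).2⟩
  have hDH : ∀ i, IntegralLe (pathLaw 𝒟) (fun s => ‖discountedSum p.β
      (fun j => centroid (runHessNoise p Q A z₀ zm s (localCost Q 𝒟) j)) i‖)
      √(c.σh ^ 2 * (4 * p.μy / (1 - mixingRate A)) ^ 2 / (p.N * K * p.β)) := fun i =>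
    ⟨((hFh.discounted hd0 i p.N hr.N_pos hr.K_pos hβ hβ1).1.integrable (by norm_num)).norm,
      (hFh.discounted hd0 i p.N hr.N_pos hr.K_pos hβ hβ1).2⟩
  have hDG : ∀ i, IntegralLe (pathLaw 𝒟) (fun s => ‖discountedSum p.β
      (fun j => centroid (runGradNoise p Q A z₀ zm s (localCost Q 𝒟) j)) i‖)
      √(c.σ ^ 2 / (p.N * K * p.β)) := fun i =>
    ⟨((hFg.discounted (sq_nonneg _) i p.N hr.N_pos hr.K_pos hβ hβ1).1.integrable
      (by norm_num)).norm, (hFg.discounted (sq_nonneg _) i p.N hr.N_pos hr.K_pos hβ hβ1).2⟩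
  have hC : IntegralLe (pathLaw 𝒟)
      (fun s => ‖centroid (momentumError p Q A z₀ zm s (localCost Q 𝒟) 0)‖) (c.σ / √K) := by
    have := integral_norm_centroid_momentumError_zero_le (p := p) (A := A) (z₀ := z₀) (zm := zm)
      h.σ_nonneg hr.K_pos h.oracle
    exact ⟨(this.1.integrable (by norm_num)).norm, this.2⟩
  have hinit : IntegralLe (pathLaw 𝒟) _ _ := ((((IntegralLe.self
      (h.integrable_init_tracking (projX M₁ M₂) zm)).add
      (IntegralLe.self (h.integrable_init_momentum (projX M₁ M₂) zm))).const_mul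
        (by norm_num : (0 : ℝ) ≤ 2)).add (((IntegralLe.self
      (h.integrable_init_tracking (projY M₁ M₂) zm)).add
      (IntegralLe.self (h.integrable_init_momentum (projY M₁ M₂) zm))).const_mul
        (by linarith : 0 ≤ 12 * c.κ))).const_mul hρ
  have h1 := fun i => (((hH i).const_mul (by norm_num : (0 : ℝ) ≤ 2)).add
    ((hG i).const_mul (by linarith : 0 ≤ 2 * p.β))).add
    (IntegralLe.const (3 * c.Lf * (√K * (4 * p.μy / (1 - mixingRate A)))))
  have h2 := fun i => ((h1 i).add
    (IntegralLe.const (2 * p.β * (√K * (2 * c.Lf * p.N * p.μby))))).const_mul hρ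
  have h3 := fun i : ℕ => ((h2 i).add
    (hC.const_mul (pow_nonneg (by linarith : 0 ≤ 1 - p.β) (i + 1)))).add (hDH (i + 1))
  have h4 := fun i => ((h3 i).add ((hDG (i + 1)).const_mul hβ.le)).add (IntegralLe.const
    (c.Lh * (4 * p.μy / (1 - mixingRate A)) ^ 2 / p.β + 2 * c.Lf * p.N * p.μby))
  have hround := fun i => (h4 i).add
    (IntegralLe.const (c.Lf * (mixingRate A / (1 - mixingRate A) * (2 * p.μy))))
  have hsum := (IntegralLe.sum (Finset.range T) fun i _ => hround i).const_mul
      (by linarith : 0 ≤ 14 * c.κ)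
  have htot := ((IntegralLe.const (μ := pathLaw 𝒟)
      ((envelope (globalCost Q 𝒟) z₀.fst - optValue (globalCost Q 𝒟)) / p.μx
      + 6 * c.κ * (initialGap (globalCost Q 𝒟) z₀ / p.μy)
      + T * (c.L * p.μx + 6 * c.κ * (c.Lf * p.μx / 4 + 4 * c.Lf * p.μy)))).add hinit).add hsum
  rw [← integral_finsetSum _ fun i _ => hint i]
  refine (integral_mono (integrable_finsetSum _ fun i _ => hint i) htot.1
    fun s => h.sum_gradNorms_le hp hβ1 hz s T).trans (htot.2.trans ?_)
  refine add_le_add le_rfl (mul_le_mul_of_nonneg_left ?_ (by linarith))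
  have hgeo : ∑ i ∈ Finset.range T, (1 - p.β) ^ (i + 1) ≤ 1 / p.β := by
    refine le_trans (Finset.sum_le_sum fun i _ => ?_) (sum_one_sub_pow_le hβ hβ1 T)
    exact pow_le_pow_of_le_one (by linarith) (by linarith) (Nat.le_succ i)
  have hgeo' := mul_le_mul_of_nonneg_right hgeo
    (div_nonneg h.σ_nonneg (Real.sqrt_nonneg (K : ℝ)))
  have e : ∀ a b d e f : ℝ, ∑ i ∈ Finset.range T, (a + (1 - p.β) ^ (i + 1) * (c.σ / √K) + b + d
      + e + f) = T * (a + b + d + e + f) + (∑ i ∈ Finset.range T, (1 - p.β) ^ (i + 1)) * (c.σ / √K) :=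
    fun a b d e f => by
      simp only [Finset.sum_add_distrib, Finset.sum_const, Finset.card_range, nsmul_eq_mul,
        Finset.sum_mul]
      ring
  rw [e, noiseLevel]
  refine add_le_add le_rfl (hgeo'.trans (le_of_eq ?_))
  ring

end Expectation

end LocalDiMA

end

/-! ### The explicit bound -/

noncomputable section

namespace LocalDiMA

variable {K M₁ M₂ : ℕ} {S : Type*}

section Explicit

variable [MeasurableSpace S] {c : Constants} {p : Params} {Q : Fin K → Vec M₁ M₂ → S → ℝ}
  {𝒟 : Fin K → Measure S} {A : Matrix (Fin K) (Fin K) ℝ} {z₀ zm : Vec M₁ M₂}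
  {Ω : Type*} [MeasurableSpace Ω] {P : Measure Ω} [IsProbabilityMeasure P]
  {ξ : SampleIndex K → Ω → S}

/-- The consensus terms of the previous iterates vanish because all agents share `zm`. -/
theorem potentialOf_run_zero (hK : 0 < K) (s : SampleIndex K → S) (lam : ℝ) :
    potentialOf c p Q 𝒟 lam (run p Q A z₀ zm s 0) =
      envelope (globalCost Q 𝒟) z₀.fst
      + coefD c p * Metric.infDist z₀.snd (argmaxSet (globalCost Q 𝒟) z₀.fst)
      + coefBx p K lam * consensusError (fun k =>
          projX M₁ M₂ (gradient (fun w => Q k w (s (k, none))) zm))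
      + coefBy c p K lam * consensusError (fun k =>
          projY M₁ M₂ (gradient (fun w => Q k w (s (k, none))) zm))
      + coefCx p K lam * netNorm (fun k =>
          projX M₁ M₂ (gradient (fun w => Q k w (s (k, none))) zm - gradient (localCost Q 𝒟 k) zm))
      + coefCy c p K lam * netNorm (fun k =>
          projY M₁ M₂ (gradient (fun w => Q k w (s (k, none))) zm
            - gradient (localCost Q 𝒟 k) zm)) := by
  have h1 : centroid (run p Q A z₀ zm s 0).z = z₀ := centroid_const hK z₀
  have h2 : consensusError (fun k => ((run p Q A z₀ zm s 0).zPrev k).fst) = 0 :=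
    consensusError_const hK zm.fst
  have h3 : consensusError (fun k => ((run p Q A z₀ zm s 0).zPrev k).snd) = 0 :=
    consensusError_const hK zm.snd
  unfold potentialOf
  rw [h1, h2, h3]
  have h4 : ∀ a b d e f g h : ℝ, a + b * (0 + 0) + d * (0 ^ 2 + 0 ^ 2) + e + f + g + h =
      a + e + f + g + h := fun a b d e f g h => by ring
  have h5 : ∀ a b d e f g : ℝ, a + b + d + e + f + g = a + g + b + d + e + f :=
    fun a b d e f g => by ring
  rw [add_assoc _ _ (coefD c p * _), ← add_assoc, h4, h5]
  rfl

variable [∀ k, IsProbabilityMeasure (𝒟 k)]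

/-- At the start only the four initial errors are random. The distance to the maximizers is a
nonnegative constant and is dropped, because only a lower bound on the potential is needed. -/
theorem Assumptions.le_initialPotential (h : Assumptions c Q 𝒟 A) (hp : StepConditions c p)
    (hs : IsSampling P 𝒟 ξ) :
    envelope (globalCost Q 𝒟) z₀.fst
      + coefBx p K (mixingRate A) * meanInitTracking Q 𝒟 zm (projX M₁ M₂)
      + coefBy c p K (mixingRate A) * meanInitTracking Q 𝒟 zm (projY M₁ M₂)
      + coefCx p K (mixingRate A) * meanInitMomentum Q 𝒟 zm (projX M₁ M₂)
      + coefCy c p K (mixingRate A) * meanInitMomentum Q 𝒟 zm (projY M₁ M₂)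
      ≤ initialPotential P c p Q 𝒟 A z₀ zm ξ := by
  have h1 := (h.integrable_init_tracking (projX M₁ M₂) zm).const_mul (coefBx p K (mixingRate A))
  have h2 := (h.integrable_init_tracking (projY M₁ M₂) zm).const_mul (coefBy c p K (mixingRate A))
  have h3 := (h.integrable_init_momentum (projX M₁ M₂) zm).const_mul (coefCx p K (mixingRate A))
  have h4 := (h.integrable_init_momentum (projY M₁ M₂) zm).const_mul (coefCy c p K (mixingRate A))
  have h0 := integrable_const (μ := pathLaw 𝒟) (envelope (globalCost Q 𝒟) z₀.fst
      + coefD c p * Metric.infDist z₀.snd (argmaxSet (globalCost Q 𝒟) z₀.fst))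
  have hint := (((h0.add h1).add h2).add h3).add h4
  have e : initialPotential P c p Q 𝒟 A z₀ zm ξ = ∫ s, potentialOf c p Q 𝒟 (mixingRate A)
      (run p Q A z₀ zm s 0) ∂(pathLaw 𝒟) := by
    refine hs.integral_comp (f := fun s => potentialOf c p Q 𝒟 (mixingRate A)
      (run p Q A z₀ zm s 0)) ?_
    simp only [potentialOf_run_zero h.agents_pos]
    exact hint.aestronglyMeasurable
  rw [e]
  simp only [potentialOf_run_zero h.agents_pos]
  have e2 := integral_add (((h0.add h1).add h2).add h3) h4
  have e3 := integral_add ((h0.add h1).add h2) h3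
  have e4 := integral_add (h0.add h1) h2
  have e5 := integral_add h0 h1
  simp only [Pi.add_apply] at e2 e3 e4 e5
  rw [e2, e3, e4, e5]
  simp only [integral_const_mul, integral_const, probReal_univ, one_smul]
  have hD : 0 ≤ coefD c p * Metric.infDist z₀.snd (argmaxSet (globalCost Q 𝒟) z₀.fst) := by
    have := Lf_pos_of h.ν_pos h.one_le_κ
    have := hp.μx_pos
    unfold coefD
    have := Metric.infDist_nonneg (x := z₀.snd) (s := argmaxSet (globalCost Q 𝒟) z₀.fst)
    positivity
  unfold meanInitTracking meanInitMomentum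
  linarith

theorem Assumptions.avgMeasure_eq (h : Assumptions c Q 𝒟 A) (hp : StepConditions c p)
    (hs : IsSampling P 𝒟 ξ) (T : ℕ) :
    avgMeasure P p Q 𝒟 A z₀ zm ξ T = (T : ℝ)⁻¹ * ∑ i ∈ Finset.range T,
      ∫ s, gradNorms (globalCost Q 𝒟) (centroidIterate p Q A z₀ zm s i) ∂(pathLaw 𝒟) := by
  unfold avgMeasure
  congr 1
  refine Finset.sum_congr rfl fun i _ => ?_
  have := h.integrable_norm_grad hp (z₀ := z₀) (zm := zm) (P := pathLaw 𝒟) (ξ := fun s => s)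
    measurable_id i
  exact hs.integral_comp (f := fun s => gradNorms (globalCost Q 𝒟) (centroidIterate p Q A z₀ zm s i))
    (this.1.add this.2).aestronglyMeasurable

omit [MeasurableSpace S] in
theorem noiseLevel_eq (hσ : 0 ≤ c.σ) (hσh : 0 ≤ c.σh) (hN : 0 < p.N) (hK : 0 < K)
    (hβ : 0 < p.β) (hμ : 0 ≤ p.μy) {lam : ℝ} (hlam : lam < 1) :
    noiseLevel c p K lam =
      lam / (1 - lam) * (8 * c.σh * p.μy / (√p.N * (1 - lam)) + 2 * c.σ * p.β / √p.N
        + 12 * c.Lf * p.μy / (1 - lam) + 4 * p.N * c.Lf * p.μby * p.β)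
      + 4 * c.σh * p.μy / ((1 - lam) * √(p.N * K * p.β)) + √p.β * c.σ / √(p.N * K)
      + 16 * c.Lh * p.μy ^ 2 / ((1 - lam) ^ 2 * p.β) + 2 * p.N * c.Lf * p.μby
      + 2 * c.Lf * lam * p.μy / (1 - lam) := by
  have hN' : (0 : ℝ) < p.N := by exact_mod_cast hN
  have hK' : (0 : ℝ) < K := by exact_mod_cast hK
  have hl1 : 0 < 1 - lam := by linarith
  have hd : 0 ≤ 4 * p.μy / (1 - lam) := by positivity
  have e1 : √(K * (c.σh ^ 2 * (4 * p.μy / (1 - lam)) ^ 2) / p.N)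
      = √K * (c.σh * (4 * p.μy / (1 - lam))) / √p.N := by
    rw [Real.sqrt_div (by positivity), Real.sqrt_mul hK'.le, ← mul_pow, Real.sqrt_sq (by positivity)]
  have e2 : √(K * c.σ ^ 2 / p.N) = √K * c.σ / √p.N := by
    rw [Real.sqrt_div (by positivity), Real.sqrt_mul hK'.le, Real.sqrt_sq hσ]
  have e3 : √(c.σh ^ 2 * (4 * p.μy / (1 - lam)) ^ 2 / (p.N * K * p.β))
      = c.σh * (4 * p.μy / (1 - lam)) / √(p.N * K * p.β) := by
    rw [Real.sqrt_div (by positivity), ← mul_pow, Real.sqrt_sq (by positivity)]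
  have e4 : p.β * √(c.σ ^ 2 / (p.N * K * p.β)) = √p.β * c.σ / √(p.N * K) := by
    rw [Real.sqrt_div (by positivity), Real.sqrt_sq hσ, Real.sqrt_mul (by positivity)]
    have h1 : √p.β * √p.β = p.β := Real.mul_self_sqrt hβ.le
    have h2 : 0 < √p.β := Real.sqrt_pos.2 hβ
    have h3 : 0 < √((p.N : ℝ) * K) := Real.sqrt_pos.2 (by positivity)
    rw [mul_div_assoc', div_eq_div_iff (by positivity) h3.ne']
    linear_combination (-(c.σ * √((p.N : ℝ) * K))) * h1
  have hs : 0 < √(K : ℝ) := Real.sqrt_pos.2 hK'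
  have hsN : 0 < √(p.N : ℝ) := Real.sqrt_pos.2 hN'
  have hq : 0 < √(p.N * K * p.β) := Real.sqrt_pos.2 (by positivity)
  rw [noiseLevel, e1, e2, e3, e4]
  have f1 : lam / (1 - lam) / √K * (2 * (√K * (c.σh * (4 * p.μy / (1 - lam))) / √p.N)
      + 2 * p.β * (√K * c.σ / √p.N) + 3 * c.Lf * (√K * (4 * p.μy / (1 - lam)))
      + 2 * p.β * (√K * (2 * c.Lf * p.N * p.μby)))
      = lam / (1 - lam) * (8 * c.σh * p.μy / (√p.N * (1 - lam)) + 2 * c.σ * p.β / √p.N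
        + 12 * c.Lf * p.μy / (1 - lam) + 4 * p.N * c.Lf * p.μby * p.β) := by
    field_simp
    ring
  have f2 : c.σh * (4 * p.μy / (1 - lam)) / √(p.N * K * p.β)
      = 4 * c.σh * p.μy / ((1 - lam) * √(p.N * K * p.β)) := by field_simp
  have f3 : c.Lh * (4 * p.μy / (1 - lam)) ^ 2 / p.β
      = 16 * c.Lh * p.μy ^ 2 / ((1 - lam) ^ 2 * p.β) := by field_simp; ring
  have f4 : c.Lf * (lam / (1 - lam) * (2 * p.μy)) = 2 * c.Lf * lam * p.μy / (1 - lam) := by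
    field_simp
  rw [f1, f2, f3, f4]
  ring

/-- The noise level expands into nine monomials, each of which also occurs in the Q's with a larger
coefficient. The remaining terms of the Q's are nonnegative. -/
theorem noiseLevel_le_explicit (hκ : 0 ≤ c.κ) (hLf : 0 ≤ c.Lf) (hLh : 0 ≤ c.Lh)
    (hσ : 0 ≤ c.σ) (hσh : 0 ≤ c.σh) (hN : 0 < p.N) (hK : 0 < K)
    (hβ : 0 < p.β) (hμ : 0 ≤ p.μy) (hμb : 0 ≤ p.μby) {lam : ℝ} (h0 : 0 ≤ lam) (hlam : lam < 1) :
    14 * c.κ * noiseLevel c p K lam ≤ 3 * (Q₄ c p lam + Q₅ c p K lam) + 225 * c.κ * Q₆ c p K lam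
      + 450 * c.κ / ((1 - lam) * √K) * Q₁ c p K lam
      + 450 * c.κ * lam / ((1 - lam) * √K) * Q₂ c p K := by
  have hN' : (0 : ℝ) < p.N := by exact_mod_cast hN
  have hK' : (0 : ℝ) < K := by exact_mod_cast hK
  have hs : 0 < √(K : ℝ) := Real.sqrt_pos.2 hK'
  have hsN : 0 < √(p.N : ℝ) := Real.sqrt_pos.2 hN'
  have hq : 0 < √(p.N * K * p.β) := Real.sqrt_pos.2 (by positivity)
  have hq2 : 0 < √((p.N : ℝ) * K) := Real.sqrt_pos.2 (by positivity)
  have hsβ : 0 < √p.β := Real.sqrt_pos.2 hβ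
  have hl1 : 0 < 1 - lam := by linarith
  rw [noiseLevel_eq hσ hσh hN hK hβ hμ hlam]
  set τ := 1 - lam with hτ
  set N : ℝ := (p.N : ℝ) with hN_def
  have hQ5 : 0 ≤ Q₅ c p K lam := by unfold Q₅; rw [← hτ]; positivity
  have hQ6 : c.κ * (48 * c.Lh * p.μy ^ 2 / (τ ^ 2 * p.β)) + c.κ * (7 * c.σh * p.μy
        / (τ * √(N * K * p.β))) + c.κ * (√p.β * c.σ / √(N * K)) + c.κ * (N * c.Lf * p.μby)
      ≤ c.κ * Q₆ c p K lam := by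
    unfold Q₆
    rw [← hτ]
    have h1 : 0 ≤ c.κ * (3 * c.Lh * p.μy ^ 2 / p.β) := by positivity
    have h2 : 0 ≤ c.κ * (3 * c.σh * p.μy / √(p.N * K * p.β)) := by positivity
    linarith
  have hQ4 : 300 * (c.κ * (lam * c.Lf * p.μy / τ))
      + 1200 * lam * (c.κ * (lam * c.σh * p.μy / (τ ^ 2 * √N)))
      + 1200 * lam * (c.κ * (lam * c.Lf * p.μy / τ ^ 2)) ≤ Q₄ c p lam := by
    unfold Q₄ Q₃
    rw [← hτ]
    have e : 300 * (c.κ * (lam * c.Lf * p.μy / τ))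
        + 1200 * lam * (c.κ * (lam * c.σh * p.μy / (τ ^ 2 * √N)))
        + 1200 * lam * (c.κ * (lam * c.Lf * p.μy / τ ^ 2))
        = (75 * c.κ * c.Lf / τ + 300 * c.κ * lam * (c.σh / √N + c.Lf) / τ ^ 2)
          * (4 * lam * p.μy) := by
      field_simp
      ring
    rw [e]
    refine mul_le_mul_of_nonneg_right ?_ (by positivity)
    have h1 : 0 ≤ 300 * c.κ * lam * c.σh / (τ ^ 2 * √N) := by positivity
    have h2 : 0 ≤ 150 * c.κ * lam * (c.σh / √N + c.Lf) / τ := by positivity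
    have h3 : 0 ≤ 150 * c.κ * lam * c.σh / (τ * √N) := by positivity
    have h4 : 0 ≤ 72 * c.Lf * c.κ := by positivity
    linarith
  have hQ2 : c.κ * (900 * τ * (lam * c.σh * p.μy / (τ ^ 2 * √N)))
      + c.κ * (450 * (lam / τ * (c.σ * p.β / √N))) + c.κ * (450 * (lam / τ * (N * c.Lf * p.μby * p.β)))
      ≤ 450 * c.κ * lam / (τ * √K) * Q₂ c p K := by
    unfold Q₂
    have e : c.κ * (900 * τ * (lam * c.σh * p.μy / (τ ^ 2 * √N)))
      + c.κ * (450 * (lam / τ * (c.σ * p.β / √N))) + c.κ * (450 * (lam / τ * (N * c.Lf * p.μby * p.β)))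
        = 450 * c.κ * lam / (τ * √K) * (2 * √K * c.σh * p.μy / √N + √K * c.σ / √N * p.β
          + √K * N * c.Lf * p.μby * p.β) := by
      field_simp
      ring
    rw [e]
    gcongr
    have : 0 ≤ 3 * K * c.Lh * p.μy ^ 2 := by positivity
    linarith
  have hQ1 : c.κ * (900 * τ * (lam * c.Lf * p.μy / τ ^ 2))
      ≤ 450 * c.κ / (τ * √K) * Q₁ c p K lam := by
    unfold Q₁
    have e : c.κ * (900 * τ * (lam * c.Lf * p.μy / τ ^ 2))
        = 450 * c.κ / (τ * √K) * (lam * (2 * √K * c.Lf * p.μy)) := by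
      field_simp
      ring
    rw [e]
    gcongr
    have h1 : 0 ≤ 2 * √K * c.σh * p.μy / √p.N := by positivity
    have h2 : 0 ≤ 3 * K * c.Lh * p.μy ^ 2 := by positivity
    have h3 : 0 ≤ √K * c.σ / √p.N * p.β := by positivity
    have h4 : 0 ≤ √K * p.N * c.Lf * p.μby * p.β := by positivity
    linarith
  have a1 : 0 ≤ c.κ * (lam * c.σh * p.μy / (τ ^ 2 * √N)) := by positivity
  have a2 : 0 ≤ c.κ * (lam * c.Lf * p.μy / τ ^ 2) := by positivity
  have a3 : 0 ≤ c.κ * (lam * c.Lf * p.μy / τ) := by positivity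
  have a4 : 0 ≤ c.κ * (lam / τ * (c.σ * p.β / √N)) := by positivity
  have a5 : 0 ≤ c.κ * (lam / τ * (N * c.Lf * p.μby * p.β)) := by positivity
  have a6 : 0 ≤ c.κ * (c.Lh * p.μy ^ 2 / (τ ^ 2 * p.β)) := by positivity
  have a7 : 0 ≤ c.κ * (c.σh * p.μy / (τ * √(N * K * p.β))) := by positivity
  have a8 : 0 ≤ c.κ * (√p.β * c.σ / √(N * K)) := by positivity
  have a9 : 0 ≤ c.κ * (N * c.Lf * p.μby) := by positivity
  have eL : 14 * c.κ * (lam / τ * (8 * c.σh * p.μy / (√N * τ) + 2 * c.σ * p.β / √N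
        + 12 * c.Lf * p.μy / τ + 4 * N * c.Lf * p.μby * p.β)
      + 4 * c.σh * p.μy / (τ * √(N * K * p.β)) + √p.β * c.σ / √(N * K)
      + 16 * c.Lh * p.μy ^ 2 / (τ ^ 2 * p.β) + 2 * N * c.Lf * p.μby
      + 2 * c.Lf * lam * p.μy / τ)
      = 112 * (c.κ * (lam * c.σh * p.μy / (τ ^ 2 * √N)))
        + 28 * (c.κ * (lam / τ * (c.σ * p.β / √N)))
        + 168 * (c.κ * (lam * c.Lf * p.μy / τ ^ 2))
        + 56 * (c.κ * (lam / τ * (N * c.Lf * p.μby * p.β)))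
        + 56 * (c.κ * (c.σh * p.μy / (τ * √(N * K * p.β))))
        + 14 * (c.κ * (√p.β * c.σ / √(N * K)))
        + 224 * (c.κ * (c.Lh * p.μy ^ 2 / (τ ^ 2 * p.β)))
        + 28 * (c.κ * (N * c.Lf * p.μby)) + 28 * (c.κ * (lam * c.Lf * p.μy / τ)) := by
    field_simp
    ring
  have eR : c.κ * (48 * c.Lh * p.μy ^ 2 / (τ ^ 2 * p.β)) + c.κ * (7 * c.σh * p.μy
        / (τ * √(N * K * p.β))) = 48 * (c.κ * (c.Lh * p.μy ^ 2 / (τ ^ 2 * p.β)))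
        + 7 * (c.κ * (c.σh * p.μy / (τ * √(N * K * p.β)))) := by ring
  -- The monomials with (1-λ)² in the denominator occur in `Q₄` with an extra λ and in `Q₁` or `Q₂`
  -- with an extra 1 - λ. Neither suffices alone, but together they give 3600λ + 900(1-λ) ≥ 900,
  -- above the required 112 and 168.
  have hmix : ∀ x : ℝ, 0 ≤ x → 900 * x ≤ 3600 * lam * x + 900 * τ * x := fun x hx => by
    have h1 : 0 ≤ lam * x := mul_nonneg h0 hx
    have h2 : τ * x = x - lam * x := by rw [hτ]; ring
    linarith
  have m1 := hmix _ a1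
  have m2 := hmix _ a2
  rw [eL]
  linarith

/-- The averaged measure before the constants are weakened. -/
theorem Assumptions.avgMeasure_le (h : Assumptions c Q 𝒟 A) (hp : StepConditions c p)
    (hβ1 : p.β ≤ 1) (hz : CloseStart p z₀ zm) (hs : IsSampling P 𝒟 ξ) {T : ℕ} (hT : 0 < T) :
    avgMeasure P p Q 𝒟 A z₀ zm ξ T ≤
      (envelope (globalCost Q 𝒟) z₀.fst - optValue (globalCost Q 𝒟)) / (p.μx * T)
      + 6 * c.κ * (initialGap (globalCost Q 𝒟) z₀ / (p.μy * T))
      + (c.L * p.μx + 6 * c.κ * (c.Lf * p.μx / 4 + 4 * c.Lf * p.μy))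
      + mixingRate A / (1 - mixingRate A) / √K / T *
        (2 * (meanInitTracking Q 𝒟 zm (projX M₁ M₂) + meanInitMomentum Q 𝒟 zm (projX M₁ M₂))
          + 12 * c.κ *
            (meanInitTracking Q 𝒟 zm (projY M₁ M₂) + meanInitMomentum Q 𝒟 zm (projY M₁ M₂)))
      + 14 * c.κ * noiseLevel c p K (mixingRate A) + 14 * (c.κ * c.σ / (√K * T * p.β)) := by
  have hT' : (0 : ℝ) < T := by exact_mod_cast hT
  have hμx := hp.μx_pos
  have hμy : 0 < p.μy := hμx.trans_le (h.runConditions hp).μx_le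
  have hβ := hp.β_pos
  have hs' : 0 < √(K : ℝ) := Real.sqrt_pos.2 (h.runConditions hp).K_pos'
  rw [h.avgMeasure_eq hp hs, inv_mul_le_iff₀ hT']
  refine (h.sum_integral_gradNorms_le hp hβ1 hz T).trans (le_of_eq ?_)
  have e1 : T * ((envelope (globalCost Q 𝒟) z₀.fst - optValue (globalCost Q 𝒟)) / (p.μx * T))
      = (envelope (globalCost Q 𝒟) z₀.fst - optValue (globalCost Q 𝒟)) / p.μx := by field_simp
  have e2 : T * (6 * c.κ * (initialGap (globalCost Q 𝒟) z₀ / (p.μy * T)))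
      = 6 * c.κ * (initialGap (globalCost Q 𝒟) z₀ / p.μy) := by field_simp
  have e3 : ∀ a b : ℝ, T * (a / T * b) = a * b := fun a b => by field_simp
  have e4 : T * (14 * (c.κ * c.σ / (√K * T * p.β))) = 14 * c.κ * (c.σ / √K / p.β) := by field_simp
  simp only [mul_add (T : ℝ)]
  rw [e1, e2, e3, e4]
  ring

theorem Assumptions.avgMeasure_le_explicitBound (h : Assumptions c Q 𝒟 A)
    (hp : StepConditions c p) (hβ1 : p.β ≤ 1) (hz : CloseStart p z₀ zm) (hs : IsSampling P 𝒟 ξ)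
    {T : ℕ} (hT : 0 < T) :
    avgMeasure P p Q 𝒟 A z₀ zm ξ T ≤ explicitBound c p K T (mixingRate A)
      (initialPotential P c p Q 𝒟 A z₀ zm ξ) (optValue (globalCost Q 𝒟))
      (initialGap (globalCost Q 𝒟) z₀) := by
  have hr := h.runConditions hp
  have hT' : (0 : ℝ) < T := by exact_mod_cast hT
  have hμx := hp.μx_pos
  have hμy : 0 < p.μy := hμx.trans_le hr.μx_le
  have hβ := hp.β_pos
  have hs' : 0 < √(K : ℝ) := Real.sqrt_pos.2 hr.K_pos'
  have hκ := h.one_le_κ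
  have hκ0 : 0 < c.κ := by linarith
  have hLf := hr.Lf_pos
  have hσ := h.σ_nonneg
  have hl := mixingRate_nonneg A
  have hl1 : 0 < 1 - mixingRate A := by linarith [hr.mixingRate_lt_one]
  have h1 := h.avgMeasure_le (P := P) (ξ := ξ) hp hβ1 hz hs hT
  have h2 := h.le_initialPotential (P := P) (ξ := ξ) (z₀ := z₀) (zm := zm) hp hs
  have h3 := noiseLevel_le_explicit (c := c) (p := p) (K := K) hκ0.le hLf.le h.Lh_nonneg h.σ_nonneg
    h.σh_nonneg hp.N_pos hr.K_pos hβ hμy.le (hr.μbx_nonneg.trans hr.μbx_le) hl hr.mixingRate_lt_one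
  set tx := meanInitTracking Q 𝒟 zm (projX M₁ M₂)
  set ty := meanInitTracking Q 𝒟 zm (projY M₁ M₂)
  set εx := meanInitMomentum Q 𝒟 zm (projX M₁ M₂)
  set εy := meanInitMomentum Q 𝒟 zm (projY M₁ M₂)
  have htx : 0 ≤ tx := meanInitTracking_nonneg _
  have hty : 0 ≤ ty := meanInitTracking_nonneg _
  have hεx : 0 ≤ εx := meanInitMomentum_nonneg _
  have hεy : 0 ≤ εy := meanInitMomentum_nonneg _
  set P0 := envelope (globalCost Q 𝒟) z₀.fst
  set Ps := optValue (globalCost Q 𝒟)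
  set lam := mixingRate A
  set Ω₀ := initialPotential P c p Q 𝒟 A z₀ zm ξ
  have hP : 0 ≤ P0 - Ps := sub_nonneg.2 (ciInf_le h.cost.bddBelow _)
  have hδ : 0 ≤ initialGap (globalCost Q 𝒟) z₀ :=
    sub_nonneg.2 (h.smoothPL.le_envelope z₀.fst z₀.snd)
  -- After division by μ_x T, three times the potential carries the initial errors with weights 9,
  -- 216κ, 18 and 432κ, where only 2 and 12κ are needed.
  have k1 : (P0 - Ps) / (p.μx * T) + lam / (1 - lam) / √K / T * (2 * (tx + εx)
      + 12 * c.κ * (ty + εy)) ≤ 3 * (Ω₀ - Ps) / (p.μx * T) := by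
    have e : 3 * (P0 - Ps + coefBx p K lam * tx + coefBy c p K lam * ty + coefCx p K lam * εx
        + coefCy c p K lam * εy) / (p.μx * T) = 3 * ((P0 - Ps) / (p.μx * T))
        + lam / (1 - lam) / √K / T * (9 * tx + 216 * c.κ * ty + 18 * εx + 432 * c.κ * εy) := by
      unfold coefBx coefBy coefCx coefCy
      field_simp
      ring
    have h4 : 3 * (P0 - Ps + coefBx p K lam * tx + coefBy c p K lam * ty + coefCx p K lam * εx
        + coefCy c p K lam * εy) / (p.μx * T) ≤ 3 * (Ω₀ - Ps) / (p.μx * T) := by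
      gcongr
      linarith
    rw [e] at h4
    have h5 : 0 ≤ (P0 - Ps) / (p.μx * T) := by positivity
    have h6 : lam / (1 - lam) / √K / T * (2 * (tx + εx) + 12 * c.κ * (ty + εy))
        ≤ lam / (1 - lam) / √K / T * (9 * tx + 216 * c.κ * ty + 18 * εx + 432 * c.κ * εy) := by
      refine mul_le_mul_of_nonneg_left ?_ (by positivity)
      have : 0 ≤ c.κ * ty := by positivity
      have : 0 ≤ c.κ * εy := by positivity
      linarith
    linarith
  have k2 : 6 * c.κ * (initialGap (globalCost Q 𝒟) z₀ / (p.μy * T))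
      ≤ 72 * c.κ * initialGap (globalCost Q 𝒟) z₀ / (p.μy * T) := by
    have : 0 ≤ c.κ * initialGap (globalCost Q 𝒟) z₀ / (p.μy * T) := by positivity
    calc _ = 6 * (c.κ * initialGap (globalCost Q 𝒟) z₀ / (p.μy * T)) := by ring
      _ ≤ 72 * (c.κ * initialGap (globalCost Q 𝒟) z₀ / (p.μy * T)) := by linarith
      _ = _ := by ring
  have k3 : 14 * (c.κ * c.σ / (√K * T * p.β)) ≤ 225 * c.κ * c.σ / (√K * T * p.β) := by
    have : 0 ≤ c.κ * c.σ / (√K * T * p.β) := by positivity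
    calc _ ≤ 225 * (c.κ * c.σ / (√K * T * p.β)) := by linarith
      _ = _ := by ring
  have k4 : c.L * p.μx + 6 * c.κ * (c.Lf * p.μx / 4 + 4 * c.Lf * p.μy) ≤ 3 * c.L * p.μx / 2
      + 24 * c.Lf * (3 * c.κ * p.μy / 2 + p.μx / 4 + 19 * c.κ * p.μx / 2 + p.μy) := by
    have i1 : 0 ≤ c.L * p.μx := by unfold Constants.L; positivity
    have i2 : 0 ≤ c.κ * c.Lf * p.μx := by positivity
    have i3 : 0 ≤ c.κ * c.Lf * p.μy := by positivity
    have i4 : 0 ≤ c.Lf * p.μx := by positivity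
    have i5 : 0 ≤ c.Lf * p.μy := by positivity
    linarith
  unfold explicitBound
  linarith

end Explicit

end LocalDiMA

end

/-! ### Rate and complexity for tuned parameters -/

noncomputable section

namespace LocalDiMA

variable {K M₁ M₂ : ℕ} {S : Type*}

/-- The constant of the noise level in the rate. -/
def noiseRateConst (Lf Lh σ σh a b : ℝ) : ℝ :=
  8 * σh * b + 2 * σ * b + 12 * Lf * b + 6 * b + 16 * Lh * b ^ 2 / a + 2 * Lf * b
    + 4 * σh * b / √a + σ * √b

/-- The constant of the rate. -/
def rateConst (Lf Lh σ σh G a b : ℝ) : ℝ :=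
  7 * G / a + 27 * Lf * b + 14 * (2 * σ + G) + 14 * noiseRateConst Lf Lh σ σh a b + 14 * σ / a

section Rate

variable {c : Constants} {p : Params} {a b h A B lam : ℝ}

/-- Here `h`, `A`, `B` are (1-λ)^{1/2}, (NK)^{1/3} and T^{1/3}, so fractional powers become
monomials, with β ~ A/B² and μ_y of order at most hA/B². Terms of order μ_y/(1-λ)² produce the
second part of the rate, and the Hessian noise μ_y/((1-λ)√(NKβ)) the first. The other terms are
smaller because h ≤ 1 ≤ A, B. -/
theorem noiseLevel_le_rate (ha : 0 < a) (hab : a ≤ b) (hLf : 0 ≤ c.Lf) (hLh : 0 ≤ c.Lh)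
    (hσ : 0 ≤ c.σ) (hσh : 0 ≤ c.σh) (hN : 0 < p.N) (hK : 0 < K) (hβ1 : p.β ≤ 1)
    (hh : 0 < h) (hh1 : h ≤ 1) (hA : 1 ≤ A) (hB : 1 ≤ B) (hNK : (p.N * K : ℝ) = A ^ 3)
    (hlam0 : 0 ≤ lam) (hlam : 1 - lam = h ^ 2) (hβa : a * (A / B ^ 2) ≤ p.β)
    (hβb : p.β ≤ b * (A / B ^ 2)) (hμ0 : 0 ≤ p.μy) (hμ : p.μy ≤ b * (h * A / B ^ 2))
    (hμb : p.N * c.Lf * p.μby = p.μy) :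
    noiseLevel c p K lam ≤ noiseRateConst c.Lf c.Lh c.σ c.σh a b *
      (1 / (h * (A * B)) + A / (h ^ 3 * B ^ 2)) := by
  have hb : 0 < b := ha.trans_le hab
  have hA0 : 0 < A := by linarith
  have hB0 : 0 < B := by linarith
  have hβ : 0 < p.β := lt_of_lt_of_le (by positivity) hβa
  have hN1 : (1 : ℝ) ≤ √p.N := Real.one_le_sqrt.2 (by exact_mod_cast hN)
  have hl1 : lam ≤ 1 := by nlinarith
  have hlt : lam < 1 := by nlinarith [pow_pos hh 2]
  rw [noiseLevel_eq hσ hσh hN hK hβ hμ0 hlt, hlam, hNK]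
  set r₁ := 1 / (h * (A * B)) with hr₁
  set r₂ := A / (h ^ 3 * B ^ 2) with hr₂
  have hr₁0 : 0 ≤ r₁ := by positivity
  have hr₂0 : 0 ≤ r₂ := by positivity
  have hm4 : p.μy / (h ^ 2) ^ 2 ≤ b * r₂ := by
    rw [div_le_iff₀ (by positivity)]
    refine hμ.trans (le_of_eq ?_)
    rw [hr₂]; field_simp
  have hmono : ∀ k : ℕ, k ≤ 3 → A / (h ^ k * B ^ 2) ≤ r₂ := fun k hk => by
    rw [hr₂]
    have := pow_le_pow_of_le_one hh.le hh1 hk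
    gcongr
  have hm2 : p.μy / h ^ 2 ≤ b * r₂ := by
    refine le_trans ?_ (mul_le_mul_of_nonneg_left (hmono 1 (by norm_num)) hb.le)
    rw [div_le_iff₀ (by positivity)]
    refine hμ.trans (le_of_eq ?_)
    field_simp
  have hm0 : p.μy ≤ b * r₂ := by
    refine le_trans ?_ hm2
    rw [le_div_iff₀ (by positivity)]
    nlinarith [pow_le_one₀ hh.le hh1 (n := 2)]
  have hβ2 : p.β / h ^ 2 ≤ b * r₂ := by
    refine le_trans ?_ (mul_le_mul_of_nonneg_left (hmono 2 (by norm_num)) hb.le)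
    rw [div_le_iff₀ (by positivity)]
    refine hβb.trans (le_of_eq ?_)
    field_simp
  have hlt2 : lam / h ^ 2 ≤ 1 / h ^ 2 := by gcongr
  have hlam' : 0 ≤ lam / h ^ 2 := by positivity
  have n1 : lam / h ^ 2 * (8 * c.σh * p.μy / (√p.N * h ^ 2)) ≤ 8 * c.σh * b * r₂ := by
    calc _ ≤ 1 / h ^ 2 * (8 * c.σh * p.μy / (1 * h ^ 2)) := by gcongr
      _ = 8 * c.σh * (p.μy / (h ^ 2) ^ 2) := by field_simp
      _ ≤ 8 * c.σh * (b * r₂) := by gcongr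
      _ = _ := by ring
  have n2 : lam / h ^ 2 * (2 * c.σ * p.β / √p.N) ≤ 2 * c.σ * b * r₂ := by
    calc _ ≤ 1 / h ^ 2 * (2 * c.σ * p.β / 1) := by gcongr
      _ = 2 * c.σ * (p.β / h ^ 2) := by field_simp
      _ ≤ 2 * c.σ * (b * r₂) := by gcongr
      _ = _ := by ring
  have n3 : lam / h ^ 2 * (12 * c.Lf * p.μy / h ^ 2) ≤ 12 * c.Lf * b * r₂ := by
    calc _ ≤ 1 / h ^ 2 * (12 * c.Lf * p.μy / h ^ 2) := by gcongr
      _ = 12 * c.Lf * (p.μy / (h ^ 2) ^ 2) := by field_simp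
      _ ≤ 12 * c.Lf * (b * r₂) := by gcongr
      _ = _ := by ring
  have n4 : lam / h ^ 2 * (4 * p.N * c.Lf * p.μby * p.β) ≤ 4 * b * r₂ := by
    calc _ = lam / h ^ 2 * (4 * (p.N * c.Lf * p.μby) * p.β) := by ring
      _ ≤ 1 / h ^ 2 * (4 * p.μy * 1) := by rw [hμb]; gcongr
      _ = 4 * (p.μy / h ^ 2) := by field_simp
      _ ≤ 4 * (b * r₂) := by gcongr
      _ = _ := by ring
  have hsa : 0 < √a := Real.sqrt_pos.2 ha
  have hq : √a * (A ^ 2 / B) ≤ √(A ^ 3 * p.β) := by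
    refine Real.le_sqrt_of_sq_le ?_
    rw [mul_pow, Real.sq_sqrt ha.le]
    calc a * (A ^ 2 / B) ^ 2 = A ^ 3 * (a * (A / B ^ 2)) := by field_simp
      _ ≤ A ^ 3 * p.β := by gcongr
  have n5 : 4 * c.σh * p.μy / (h ^ 2 * √(A ^ 3 * p.β)) ≤ 4 * c.σh * b / √a * r₁ := by
    calc _ ≤ 4 * c.σh * (b * (h * A / B ^ 2)) / (h ^ 2 * (√a * (A ^ 2 / B))) := by gcongr
      _ = _ := by rw [hr₁]; field_simp
  have n6 : √p.β * c.σ / √(A ^ 3) ≤ c.σ * √b * r₁ := by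
    have e : √p.β / √(A ^ 3) ≤ √b / (A * B) := by
      rw [← Real.sqrt_div hβ.le]
      refine Real.sqrt_le_iff.2 ⟨by positivity, ?_⟩
      rw [div_pow, Real.sq_sqrt hb.le, div_le_iff₀ (by positivity)]
      refine hβb.trans (le_of_eq ?_)
      field_simp
    calc _ = c.σ * (√p.β / √(A ^ 3)) := by ring
      _ ≤ c.σ * (√b / (1 * (A * B))) := by rw [one_mul]; gcongr
      _ ≤ c.σ * (√b / (h * (A * B))) := by gcongr
      _ = _ := by rw [hr₁]; ring
  have n7 : 16 * c.Lh * p.μy ^ 2 / ((h ^ 2) ^ 2 * p.β) ≤ 16 * c.Lh * b ^ 2 / a * r₂ := by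
    calc _ ≤ 16 * c.Lh * (b * (h * A / B ^ 2)) ^ 2 / ((h ^ 2) ^ 2 * (a * (A / B ^ 2))) := by
          gcongr
      _ = 16 * c.Lh * b ^ 2 / a * (A / (h ^ 2 * B ^ 2)) := by field_simp
      _ ≤ _ := by
          have := hmono 2 (by norm_num)
          gcongr
  have n8 : 2 * p.N * c.Lf * p.μby ≤ 2 * b * r₂ := by
    have : 2 * p.N * c.Lf * p.μby = 2 * (p.N * c.Lf * p.μby) := by ring
    rw [this, hμb]
    linarith
  have n9 : 2 * c.Lf * lam * p.μy / h ^ 2 ≤ 2 * c.Lf * b * r₂ := by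
    calc _ ≤ 2 * c.Lf * 1 * p.μy / h ^ 2 := by gcongr
      _ = 2 * c.Lf * (p.μy / h ^ 2) := by ring
      _ ≤ 2 * c.Lf * (b * r₂) := by gcongr
      _ = _ := by ring
  have d1 : 0 ≤ (8 * c.σh * b + 2 * c.σ * b + 12 * c.Lf * b + 6 * b + 16 * c.Lh * b ^ 2 / a
      + 2 * c.Lf * b) * r₁ := by positivity
  have d2 : 0 ≤ (4 * c.σh * b / √a + c.σ * √b) * r₂ := by positivity
  have e : (8 * c.σh * b + 2 * c.σ * b + 12 * c.Lf * b + 6 * b + 16 * c.Lh * b ^ 2 / a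
      + 2 * c.Lf * b + 4 * c.σh * b / √a + c.σ * √b) * (r₁ + r₂)
      = (8 * c.σh * b + 2 * c.σ * b + 12 * c.Lf * b + 6 * b + 16 * c.Lh * b ^ 2 / a
      + 2 * c.Lf * b) * r₁ + (4 * c.σh * b / √a + c.σ * √b) * r₂
      + (8 * c.σh * b * r₂ + 2 * c.σ * b * r₂ + 12 * c.Lf * b * r₂ + 4 * b * r₂
        + 4 * c.σh * b / √a * r₁ + c.σ * √b * r₁ + 16 * c.Lh * b ^ 2 / a * r₂
        + 2 * b * r₂ + 2 * c.Lf * b * r₂) := by ring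
  unfold noiseRateConst
  rw [e]
  simp only [mul_add]
  linarith

theorem rpow_one_third_pow_three {x : ℝ} (hx : 0 ≤ x) : (x ^ (1 / 3 : ℝ)) ^ 3 = x := by
  rw [← Real.rpow_mul_natCast hx]; norm_num

theorem rpow_two_thirds {x : ℝ} (hx : 0 ≤ x) : x ^ (2 / 3 : ℝ) = (x ^ (1 / 3 : ℝ)) ^ 2 := by
  rw [← Real.rpow_mul_natCast hx]; norm_num

theorem rpow_one_half_sq {x : ℝ} (hx : 0 ≤ x) : (x ^ (1 / 2 : ℝ)) ^ 2 = x := by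
  rw [← Real.rpow_mul_natCast hx]; norm_num

theorem rpow_three_halves {x : ℝ} (hx : 0 ≤ x) : x ^ (3 / 2 : ℝ) = (x ^ (1 / 2 : ℝ)) ^ 3 := by
  rw [← Real.rpow_mul_natCast hx]; norm_num

theorem rate_eq {κ lam : ℝ} (hlam : lam ≤ 1) (N K T : ℕ) :
    rate κ lam N K T = κ * (1 / ((1 - lam) ^ (1 / 2 : ℝ) *
      ((N * K : ℝ) ^ (1 / 3 : ℝ) * (T : ℝ) ^ (1 / 3 : ℝ)))
      + (N * K : ℝ) ^ (1 / 3 : ℝ) / (((1 - lam) ^ (1 / 2 : ℝ)) ^ 3 * ((T : ℝ) ^ (1 / 3 : ℝ)) ^ 2)) := by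
  rw [rate, rpow_three_halves (by linarith), rpow_two_thirds (Nat.cast_nonneg T),
    Real.mul_rpow (by positivity) (Nat.cast_nonneg T)]
  ring

theorem rate_nonneg {κ lam : ℝ} (hκ : 0 ≤ κ) (hlam : lam ≤ 1) (N K T : ℕ) :
    0 ≤ rate κ lam N K T := by
  have : 0 ≤ 1 - lam := by linarith
  unfold rate
  positivity

/-- The numerical content of the complexity bound. -/
theorem rate_le_of_large {κ ε α γ C Γ x : ℝ} (hκ : 0 < κ) (hε : 0 < ε) (hα : 0 < α) (hγ : 0 < γ)
    (hC : 0 ≤ C) (hΓ : Γ = 1 + C * (1 / α + γ) + (γ ^ 3) ^ 2 * γ) (hh : 0 < h) (hh1 : h ≤ 1)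
    (hx : 0 < x) (hx3 : x ^ 3 = κ / (ε * h ^ 3)) (hA1 : 1 ≤ A) (hAl : α * x ≤ A) (hAu : A ≤ γ * x)
    (hB : Γ * x ^ 2 ≤ B) :
    γ ^ 3 * (A / B ^ 2) < 1 ∧ C * (κ * (1 / (h * (A * B)) + A / (h ^ 3 * B ^ 2))) ≤ ε := by
  have h1 : 0 ≤ C * (1 / α + γ) := by positivity
  have h2 : 0 < (γ ^ 3) ^ 2 * γ := by positivity
  have hΓ1 : 1 ≤ Γ := by linarith
  have hΓ0 : 0 < Γ := by linarith
  have hB0 : 0 < B := lt_of_lt_of_le (by positivity) hB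
  have hA0 : 0 < A := by linarith
  have hκ' : κ = x ^ 3 * (ε * h ^ 3) := by rw [hx3]; field_simp
  have r : A / B ^ 2 ≤ γ / (Γ * x ^ 3) := by
    calc A / B ^ 2 ≤ γ * x / (Γ * x ^ 2) ^ 2 := by gcongr
      _ = γ / (Γ * x ^ 3) / Γ := by field_simp
      _ ≤ γ / (Γ * x ^ 3) := div_le_self (by positivity) hΓ1
  -- The bound on A/B² deteriorates for small `x`. But A ≥ 1 forces γx ≥ 1, so the factor γ³x³ may
  -- be inserted to cancel x. The third summand of `Γ` is what remains.
  have hγx : 1 ≤ γ ^ 3 * x ^ 3 := by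
    rw [← mul_pow]; exact one_le_pow₀ (hA1.trans hAu)
  constructor
  · calc γ ^ 3 * (A / B ^ 2) ≤ γ ^ 3 * (γ / (Γ * x ^ 3)) := by gcongr
      _ ≤ γ ^ 3 * (γ / (Γ * x ^ 3)) * (γ ^ 3 * x ^ 3) :=
          le_mul_of_one_le_right (by positivity) hγx
      _ = (γ ^ 3) ^ 2 * γ / Γ := by field_simp
      _ < 1 := by rw [div_lt_one hΓ0]; linarith
  · have r1 : κ * (1 / (h * (A * B))) ≤ ε * (1 / α) / Γ := by
      calc κ * (1 / (h * (A * B))) ≤ κ * (1 / (h * (α * x * (Γ * x ^ 2)))) := by gcongr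
        _ = ε * (1 / α) / Γ * h ^ 2 := by rw [hκ']; field_simp
        _ ≤ ε * (1 / α) / Γ := mul_le_of_le_one_right (by positivity) (pow_le_one₀ hh.le hh1)
    have r2 : κ * (A / (h ^ 3 * B ^ 2)) ≤ ε * γ / Γ := by
      calc κ * (A / (h ^ 3 * B ^ 2)) = ε * x ^ 3 * (A / B ^ 2) := by rw [hκ']; field_simp
        _ ≤ ε * x ^ 3 * (γ / (Γ * x ^ 3)) := by gcongr
        _ = _ := by field_simp
    calc C * (κ * (1 / (h * (A * B)) + A / (h ^ 3 * B ^ 2)))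
        ≤ C * (ε * (1 / α) / Γ + ε * γ / Γ) := by
          refine mul_le_mul_of_nonneg_left ?_ hC
          rw [mul_add]; exact add_le_add r1 r2
      _ = ε * (C * (1 / α + γ)) / Γ := by ring
      _ ≤ ε := by
          rw [div_le_iff₀ hΓ0]
          exact mul_le_mul_of_nonneg_left (by linarith) hε.le

end Rate

section Tuning

variable [MeasurableSpace S] {c : Constants} {p : Params} {Q : Fin K → Vec M₁ M₂ → S → ℝ}
  {𝒟 : Fin K → Measure S} [∀ k, IsProbabilityMeasure (𝒟 k)]
  {A : Matrix (Fin K) (Fin K) ℝ} {z₀ zm : Vec M₁ M₂}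
  {Ω : Type*} [MeasurableSpace Ω] {P : Measure Ω} [IsProbabilityMeasure P]
  {ξ : SampleIndex K → Ω → S} {a b G : ℝ} {T : ℕ}

/-- Starts from the bound before the constants are weakened: the explicit bound contains terms such
as √K L_h μ_y², which are not of the order of the rate uniformly in K. -/
theorem Assumptions.avgMeasure_le_rate (h : Assumptions c Q 𝒟 A) (hp : StepConditions c p)
    (hβ1 : p.β ≤ 1) (hz : CloseStart p z₀ zm) (hs : IsSampling P 𝒟 ξ) (hT : 0 < T)
    (ha : 0 < a) (hab : a ≤ b) (hG : InitialBound G Q 𝒟 z₀ zm)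
    (ht : Tuned a b c p K T (mixingRate A)) :
    avgMeasure P p Q 𝒟 A z₀ zm ξ T ≤ rateConst c.Lf c.Lh c.σ c.σh G a b *
      rate c.κ (mixingRate A) p.N K T := by
  have hr := h.runConditions hp
  have hT' : (1 : ℝ) ≤ T := by exact_mod_cast hT
  have hb : 0 < b := ha.trans_le hab
  have hμx := hp.μx_pos
  have hμy : 0 < p.μy := hμx.trans_le hr.μx_le
  have hβ := hp.β_pos
  have hK1 : (1 : ℝ) ≤ K := by exact_mod_cast hr.K_pos
  have hN1 : (1 : ℝ) ≤ p.N := by exact_mod_cast hp.N_pos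
  have hsK : 1 ≤ √(K : ℝ) := Real.one_le_sqrt.2 hK1
  have hκ := h.one_le_κ
  have hκ0 : 0 < c.κ := by linarith
  have hLf := hr.Lf_pos
  have hσ := h.σ_nonneg
  have hl := mixingRate_nonneg A
  have hl1 := hr.mixingRate_lt_one
  have hP : 0 ≤ envelope (globalCost Q 𝒟) z₀.fst - optValue (globalCost Q 𝒟) :=
    sub_nonneg.2 (ciInf_le h.cost.bddBelow _)
  have hG0 : 0 ≤ G := hP.trans hG.value_gap
  have hNK1 : (1 : ℝ) ≤ p.N * K := one_le_mul_of_one_le_of_one_le hN1 hK1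
  have i1 := h.avgMeasure_le (P := P) (ξ := ξ) hp hβ1 hz hs hT
  have htx := h.meanInitTracking_le (L := projX M₁ M₂) norm_fst_le hG
  have hty := h.meanInitTracking_le (L := projY M₁ M₂) norm_snd_le hG
  have hεx := h.meanInitMomentum_le (L := projX M₁ M₂) norm_fst_le zm
  have hεy := h.meanInitMomentum_le (L := projY M₁ M₂) norm_snd_le zm
  set tx := meanInitTracking Q 𝒟 zm (projX M₁ M₂)
  set ty := meanInitTracking Q 𝒟 zm (projY M₁ M₂)
  set εx := meanInitMomentum Q 𝒟 zm (projX M₁ M₂)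
  set εy := meanInitMomentum Q 𝒟 zm (projY M₁ M₂)
  obtain ⟨⟨hβa, hβb⟩, ⟨hya, hyb⟩, ⟨hxa, hxb⟩, -, hby⟩ := ht
  rw [rpow_two_thirds (by linarith)] at hβa hβb hya hyb hxa hxb
  rw [rate_eq hl1.le]
  set lam := mixingRate A
  have hh2 : 1 - lam = ((1 - lam) ^ (1 / 2 : ℝ)) ^ 2 := (rpow_one_half_sq (by linarith)).symm
  have hA3 : (p.N * K : ℝ) = ((p.N * K : ℝ) ^ (1 / 3 : ℝ)) ^ 3 :=
    (rpow_one_third_pow_three (by linarith)).symm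
  have hB3 : (T : ℝ) = ((T : ℝ) ^ (1 / 3 : ℝ)) ^ 3 := (rpow_one_third_pow_three (by linarith)).symm
  have hA1 : 1 ≤ (p.N * K : ℝ) ^ (1 / 3 : ℝ) := Real.one_le_rpow hNK1 (by norm_num)
  have hB1 : 1 ≤ (T : ℝ) ^ (1 / 3 : ℝ) := Real.one_le_rpow hT' (by norm_num)
  have hh : 0 < (1 - lam) ^ (1 / 2 : ℝ) := Real.rpow_pos_of_pos (by linarith) _
  have hh1 : (1 - lam) ^ (1 / 2 : ℝ) ≤ 1 := Real.rpow_le_one (by linarith) (by linarith) (by norm_num)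
  set α := (p.N * K : ℝ) ^ (1 / 3 : ℝ)
  set B := (T : ℝ) ^ (1 / 3 : ℝ)
  set η := (1 - lam) ^ (1 / 2 : ℝ)
  have hα0 : 0 < α := by linarith
  have hB0 : 0 < B := by linarith
  have i2 := noiseLevel_le_rate (c := c) (p := p) (K := K) ha hab hLf.le h.Lh_nonneg hσ h.σh_nonneg
    hp.N_pos hr.K_pos hβ1 hh hh1 hA1 hB1 hA3 hl hh2 hβa hβb hμy.le hyb
    (by rw [hby]; field_simp)
  have hNC : 0 ≤ noiseRateConst c.Lf c.Lh c.σ c.σh a b := by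
    have := h.Lh_nonneg
    have := h.σh_nonneg
    unfold noiseRateConst
    positivity
  set r₁ := 1 / (η * (α * B)) with hr₁
  set r₂ := α / (η ^ 3 * B ^ 2) with hr₂
  have hr₁0 : 0 ≤ r₁ := by positivity
  have hr₂0 : 0 ≤ r₂ := by positivity
  have s1 : (envelope (globalCost Q 𝒟) z₀.fst - optValue (globalCost Q 𝒟)) / (p.μx * T)
      ≤ c.κ * (G / a * r₁) := by
    calc _ ≤ G / (a * (η * α / (c.κ * B ^ 2)) * B ^ 3) := by
          rw [← hB3]
          gcongr
          exact hG.value_gap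
      _ = _ := by rw [hr₁]; field_simp
  have s2 : 6 * c.κ * (initialGap (globalCost Q 𝒟) z₀ / (p.μy * T)) ≤ c.κ * (6 * G / a * r₁) := by
    calc _ ≤ 6 * c.κ * (G / (a * (η * α / B ^ 2) * B ^ 3)) := by
          rw [← hB3]
          gcongr
          exact hG.dual_gap
      _ = _ := by rw [hr₁]; field_simp
  have s3 : c.L * p.μx + 6 * c.κ * (c.Lf * p.μx / 4 + 4 * c.Lf * p.μy)
      ≤ c.κ * (27 * c.Lf * b * r₂) := by
    have e1 : p.μy ≤ b * r₂ := by
      calc p.μy ≤ b * (η * α / B ^ 2) := hyb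
        _ ≤ b * (1 * α / B ^ 2) := by gcongr
        _ ≤ b * (α / (η ^ 3 * B ^ 2)) := by
            rw [one_mul]
            gcongr
            exact mul_le_of_le_one_left (by positivity) (pow_le_one₀ hh.le hh1)
    calc _ ≤ 3 / 2 * c.κ * c.Lf * p.μy + 6 * c.κ * (c.Lf * p.μy / 4 + 4 * c.Lf * p.μy) := by
          have := h.smoothPL.L_le
          have := hr.μx_le
          gcongr
      _ = c.κ * (27 * c.Lf * p.μy) := by ring
      _ ≤ c.κ * (27 * c.Lf * (b * r₂)) := by gcongr
      _ = _ := by ring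
  -- The √K in the initial errors cancels against the 1/√K in front. The factor 1/T = B⁻³ is far
  -- below what the second part of the rate allows.
  have s4 : lam / (1 - lam) / √K / T * (2 * (tx + εx) + 12 * c.κ * (ty + εy))
      ≤ c.κ * (14 * (2 * c.σ + G) * r₂) := by
    have e1 : 2 * (tx + εx) + 12 * c.κ * (ty + εy) ≤ 14 * c.κ * (√K * (2 * c.σ + G)) := by
      have f1 : tx + εx ≤ √K * (2 * c.σ + G) := by linarith
      have f2 : ty + εy ≤ √K * (2 * c.σ + G) := by linarith
      have f3 : 0 ≤ √K * (2 * c.σ + G) := by positivity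
      have f4 := mul_le_mul_of_nonneg_left f2 hκ0.le
      have f5 : √K * (2 * c.σ + G) ≤ c.κ * (√K * (2 * c.σ + G)) := le_mul_of_one_le_left f3 hκ
      linarith
    calc _ ≤ 1 / η ^ 2 / √K / B ^ 3 * (14 * c.κ * (√K * (2 * c.σ + G))) := by
          have : 0 < 1 - lam := by linarith
          have := div_nonneg (div_nonneg (div_nonneg hl this.le) (Real.sqrt_nonneg (K : ℝ)))
            (zero_le_one.trans hT')
          refine (mul_le_mul_of_nonneg_left e1 this).trans ?_
          rw [← hh2, ← hB3]
          gcongr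
      _ = c.κ * (14 * (2 * c.σ + G) * (1 * 1 / (η ^ 2 * B ^ 2 * B))) := by field_simp
      _ ≤ c.κ * (14 * (2 * c.σ + G) * (α * 1 / (η ^ 3 * B ^ 2 * 1))) := by
          have : η ^ 3 ≤ η ^ 2 := pow_le_pow_of_le_one hh.le hh1 (by norm_num)
          gcongr
      _ = _ := by rw [mul_one, mul_one]
  have s5 : 14 * (c.κ * c.σ / (√K * T * p.β)) ≤ c.κ * (14 * c.σ / a * r₁) := by
    calc _ ≤ 14 * (c.κ * c.σ / (1 * B ^ 3 * (a * (α / B ^ 2)))) := by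
          rw [← hB3]
          gcongr
      _ = c.κ * (14 * c.σ / a * (1 / (1 * (α * B)))) := by field_simp
      _ ≤ c.κ * (14 * c.σ / a * (1 / (η * (α * B)))) := by gcongr
  have s6 : 14 * c.κ * noiseLevel c p K lam ≤
      c.κ * (14 * noiseRateConst c.Lf c.Lh c.σ c.σh a b * (r₁ + r₂)) := by
    calc _ = c.κ * (14 * noiseLevel c p K lam) := by ring
      _ ≤ c.κ * (14 * (noiseRateConst c.Lf c.Lh c.σ c.σh a b * (r₁ + r₂))) := by gcongr
      _ = _ := by ring
  -- The constant multiplies the sum r₁ + r₂, while each term above needs only one of the two. These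
  -- are the superfluous products.
  have d1 : 0 ≤ c.κ * ((27 * c.Lf * b + 14 * (2 * c.σ + G)) * r₁) := by positivity
  have d2 : 0 ≤ c.κ * ((7 * G / a + 14 * c.σ / a) * r₂) := by positivity
  have e : rateConst c.Lf c.Lh c.σ c.σh G a b * (c.κ * (r₁ + r₂)) =
      c.κ * (G / a * r₁) + c.κ * (6 * G / a * r₁) + c.κ * (27 * c.Lf * b * r₂)
      + c.κ * (14 * (2 * c.σ + G) * r₂) + c.κ * (14 * c.σ / a * r₁)
      + c.κ * (14 * noiseRateConst c.Lf c.Lh c.σ c.σh a b * (r₁ + r₂))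
      + c.κ * ((27 * c.Lf * b + 14 * (2 * c.σ + G)) * r₁)
      + c.κ * ((7 * G / a + 14 * c.σ / a) * r₂) := by
    unfold rateConst
    ring
  rw [e]
  linarith

omit [∀ k, IsProbabilityMeasure (𝒟 k)] in
/-- Small `β` and a small rate for large `T` and matching `N`. -/
theorem Assumptions.rate_le (h : Assumptions c Q 𝒟 A) (hp : StepConditions c p) {C ε : ℝ}
    (ha : 0 < a) (hab : a ≤ b) (hC : 0 ≤ C) (hε : 0 < ε)
    (ht : Tuned a b c p K T (mixingRate A))
    (hN : (p.N : ℝ) ∈ Set.Icc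
      (a * (c.κ * ε⁻¹ / ((1 - mixingRate A) ^ (3 / 2 : ℝ) * K)))
      (b * (c.κ * ε⁻¹ / ((1 - mixingRate A) ^ (3 / 2 : ℝ) * K))))
    (hT : (1 + C * (1 / a ^ (1 / 3 : ℝ) + b ^ (1 / 3 : ℝ)) + b ^ 2 * b ^ (1 / 3 : ℝ)) ^ 3
      / (1 - mixingRate A) ^ 3 * (c.κ ^ 2 * (ε ^ 2)⁻¹) ≤ T) :
    p.β < 1 ∧ C * rate c.κ (mixingRate A) p.N K T ≤ ε := by
  have hr := h.runConditions hp
  have hb : 0 < b := ha.trans_le hab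
  have hK1 : (1 : ℝ) ≤ K := by exact_mod_cast hr.K_pos
  have hN1 : (1 : ℝ) ≤ p.N := by exact_mod_cast hp.N_pos
  have hK0 : (0 : ℝ) < K := by linarith
  have hκ0 : 0 < c.κ := by linarith [h.one_le_κ]
  have hl := mixingRate_nonneg A
  have hl1 := hr.mixingRate_lt_one
  have hNK1 : (1 : ℝ) ≤ p.N * K := one_le_mul_of_one_le_of_one_le hN1 hK1
  have hβb := ht.β_mem.2
  rw [rpow_two_thirds (Nat.cast_nonneg T)] at hβb
  rw [rpow_three_halves (by linarith)] at hN
  rw [rate_eq hl1.le]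
  set lam := mixingRate A
  have hh2 : 1 - lam = ((1 - lam) ^ (1 / 2 : ℝ)) ^ 2 := (rpow_one_half_sq (by linarith)).symm
  have hh : 0 < (1 - lam) ^ (1 / 2 : ℝ) := Real.rpow_pos_of_pos (by linarith) _
  have hh1 : (1 - lam) ^ (1 / 2 : ℝ) ≤ 1 := Real.rpow_le_one (by linarith) (by linarith) (by norm_num)
  set η := (1 - lam) ^ (1 / 2 : ℝ)
  have hX : 0 < c.κ / (ε * η ^ 3) := by positivity
  have hb3 : (b ^ (1 / 3 : ℝ)) ^ 3 = b := rpow_one_third_pow_three hb.le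
  have hx3 := rpow_one_third_pow_three hX.le
  have hXeq : c.κ * ε⁻¹ / (η ^ 3 * K) = c.κ / (ε * η ^ 3) / K := by field_simp
  rw [hXeq] at hN
  have hNl : a * (c.κ / (ε * η ^ 3)) ≤ p.N * K := by
    have := hN.1
    rwa [mul_div_assoc', div_le_iff₀ hK0] at this
  have hNu : p.N * K ≤ b * (c.κ / (ε * η ^ 3)) := by
    have := hN.2
    rwa [mul_div_assoc', le_div_iff₀ hK0] at this
  -- With x³ = κ/(ε(1-λ)^{3/2}), the condition on N says that (NK)^{1/3} lies between a^{1/3}x and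
  -- b^{1/3}x, and the condition on T is the cube of Γx² ≤ T^{1/3}.
  have key := rate_le_of_large (A := (p.N * K : ℝ) ^ (1 / 3 : ℝ)) (B := (T : ℝ) ^ (1 / 3 : ℝ))
    (h := η) (γ := b ^ (1 / 3 : ℝ)) (α := a ^ (1 / 3 : ℝ)) (x := (c.κ / (ε * η ^ 3)) ^ (1 / 3 : ℝ))
    hκ0 hε (Real.rpow_pos_of_pos ha _) (Real.rpow_pos_of_pos hb _) hC rfl hh hh1
    (Real.rpow_pos_of_pos hX _) hx3 (Real.one_le_rpow hNK1 (by norm_num))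
    (by rw [← Real.mul_rpow ha.le hX.le]
        exact Real.rpow_le_rpow (by positivity) hNl (by norm_num))
    (by rw [← Real.mul_rpow hb.le hX.le]
        exact Real.rpow_le_rpow (by positivity) hNu (by norm_num))
    (by
      refine le_of_pow_le_pow_left₀ (n := 3) (by norm_num) (by positivity) ?_
      have e : ∀ g : ℝ, g ^ 3 * (c.κ / (ε * η ^ 3)) ^ 2
          = g ^ 3 / (η ^ 2) ^ 3 * (c.κ ^ 2 * (ε ^ 2)⁻¹) := fun g => by field_simp
      rw [rpow_one_third_pow_three (Nat.cast_nonneg T), hb3, mul_pow, pow_right_comm _ 2 3, hx3, e,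
        ← hh2]
      exact hT)
  rw [hb3] at key
  exact ⟨hβb.trans_lt key.1, key.2⟩

omit [∀ k, IsProbabilityMeasure (𝒟 k)] in
-- Some round is no worse than the average, and there each of the two nonnegative expectations is at
-- most their sum.
theorem Assumptions.exists_isGameStationary (h : Assumptions c Q 𝒟 A) (hp : StepConditions c p)
    (hs : IsSampling P 𝒟 ξ) (hT : 0 < T) {ε : ℝ}
    (hε : avgMeasure P p Q 𝒟 A z₀ zm ξ T ≤ ε) :
    ∃ i < T, IsGameStationary P (globalCost Q 𝒟) ε
      (fun ω => centroidIterate p Q A z₀ zm (fun j => ξ j ω) i) := by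
  have hT' : (0 : ℝ) < T := by exact_mod_cast hT
  have hint := fun i => h.integrable_norm_grad hp (P := P) (z₀ := z₀) (zm := zm)
    (ξ := fun ω j => ξ j ω) (measurable_pi_lambda _ hs.measurable) i
  rw [avgMeasure, inv_mul_le_iff₀ hT'] at hε
  have hsum : ∑ i ∈ Finset.range T, ∫ ω, gradNorms (globalCost Q 𝒟)
      (centroidIterate p Q A z₀ zm (fun j => ξ j ω) i) ∂P ≤ ∑ i ∈ Finset.range T, ε := by
    simpa using hε
  obtain ⟨i, hi, hle⟩ := Finset.exists_le_of_sum_le ⟨0, Finset.mem_range.2 hT⟩ hsum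
  have hadd := integral_add (hint i).1 (hint i).2
  have hx : 0 ≤ ∫ ω, ‖gradX (globalCost Q 𝒟) (centroidIterate p Q A z₀ zm (fun j => ξ j ω) i)‖ ∂P :=
    integral_nonneg fun _ => norm_nonneg _
  have hy : 0 ≤ ∫ ω, ‖gradY (globalCost Q 𝒟) (centroidIterate p Q A z₀ zm (fun j => ξ j ω) i)‖ ∂P :=
    integral_nonneg fun _ => norm_nonneg _
  simp only [gradNorms] at hle
  rw [hadd] at hle
  exact ⟨i, Finset.mem_range.1 hi, (hint i).1, (hint i).2, by linarith, by linarith⟩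

end Tuning

end LocalDiMA

end

/-! ### The main theorem -/

theorem mainTheorem1 (Lf Lh σ σh G a b : ℝ) (ha : 0 < a) (hab : a ≤ b) :
    ∃ C C' : ℝ, 0 < C ∧ 0 < C' ∧
      ∀ {K M₁ M₂ : ℕ} {S Ω : Type*} [MeasurableSpace S] [MeasurableSpace Ω]
        (P : Measure Ω) [IsProbabilityMeasure P]
        (Q : Fin K → LocalDiMA.Vec M₁ M₂ → S → ℝ)
        (𝒟 : Fin K → Measure S) [∀ k, IsProbabilityMeasure (𝒟 k)]
        (A : Matrix (Fin K) (Fin K) ℝ) (ν : ℝ) (c : LocalDiMA.Constants)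
        (ξ : LocalDiMA.SampleIndex K → Ω → S)
        (p : LocalDiMA.Params) (z₀ zm : LocalDiMA.Vec M₁ M₂) (T : ℕ),
        c = ⟨Lf, Lh, σ, σh, ν⟩ →
        LocalDiMA.Assumptions c Q 𝒟 A →
        LocalDiMA.IsSampling P 𝒟 ξ →
        LocalDiMA.StepConditions c p →
        LocalDiMA.CloseStart p z₀ zm →
        0 < T →
        -- the expectations below exist
        (∀ i, Integrable (fun ω => LocalDiMA.gradNorms (LocalDiMA.globalCost Q 𝒟)
          (LocalDiMA.centroidIterate p Q A z₀ zm (fun j => ξ j ω) i)) P) ∧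
        -- the explicit bound, for all admissible parameters
        (p.β < 1 →
          LocalDiMA.avgMeasure P p Q 𝒟 A z₀ zm ξ T ≤
            LocalDiMA.explicitBound c p K T (LocalDiMA.mixingRate A)
              (LocalDiMA.initialPotential P c p Q 𝒟 A z₀ zm ξ)
              (LocalDiMA.optValue (LocalDiMA.globalCost Q 𝒟))
              (LocalDiMA.initialGap (LocalDiMA.globalCost Q 𝒟) z₀)) ∧
        -- the rate, for tuned parameters
        (LocalDiMA.InitialBound G Q 𝒟 z₀ zm →
          LocalDiMA.Tuned a b c p K T (LocalDiMA.mixingRate A) →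
          (p.β < 1 →
            LocalDiMA.avgMeasure P p Q 𝒟 A z₀ zm ξ T ≤
              C * LocalDiMA.rate c.κ (LocalDiMA.mixingRate A) p.N K T) ∧
          -- the complexity of reaching an `ε`-game stationary point
          (∀ ε : ℝ, 0 < ε →
            (p.N : ℝ) ∈ Set.Icc
              (a * (c.κ * ε⁻¹ / ((1 - LocalDiMA.mixingRate A) ^ (3 / 2 : ℝ) * K)))
              (b * (c.κ * ε⁻¹ / ((1 - LocalDiMA.mixingRate A) ^ (3 / 2 : ℝ) * K))) →
            C' / (1 - LocalDiMA.mixingRate A) ^ 3 * (c.κ ^ 2 * (ε ^ 2)⁻¹) ≤ T →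
            p.β < 1 ∧
            LocalDiMA.avgMeasure P p Q 𝒟 A z₀ zm ξ T ≤ ε ∧
            ∃ i < T, LocalDiMA.IsGameStationary P (LocalDiMA.globalCost Q 𝒟) ε
              (fun ω => LocalDiMA.centroidIterate p Q A z₀ zm (fun j => ξ j ω) i))) := by
  -- The constants are chosen before any sign of `Lf`, `Lh`, `σ`, `σh`, `G` is known, so the
  -- absolute value and the summand 1 guarantee positivity. The second constant is the cube of `Γ`
  -- in `rate_le_of_large` for α = a^{1/3} and γ = b^{1/3}.
  refine ⟨1 + |LocalDiMA.rateConst Lf Lh σ σh G a b|,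
    (1 + (1 + |LocalDiMA.rateConst Lf Lh σ σh G a b|) * (1 / a ^ (1 / 3 : ℝ) + b ^ (1 / 3 : ℝ))
      + b ^ 2 * b ^ (1 / 3 : ℝ)) ^ 3, by positivity, ?_, ?_⟩
  · have hb : 0 < b := ha.trans_le hab
    positivity
  intro K M₁ M₂ S Ω _ _ P _ Q 𝒟 _ A ν c ξ p z₀ zm T hc h hs hp hz hT
  subst hc
  have hint := fun i => h.integrable_norm_grad hp (P := P) (z₀ := z₀) (zm := zm)
    (ξ := fun ω j => ξ j ω) (measurable_pi_lambda _ hs.measurable) i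
  have hrate : LocalDiMA.InitialBound G Q 𝒟 z₀ zm →
      LocalDiMA.Tuned a b ⟨Lf, Lh, σ, σh, ν⟩ p K T (LocalDiMA.mixingRate A) → p.β < 1 →
      LocalDiMA.avgMeasure P p Q 𝒟 A z₀ zm ξ T ≤ (1 + |LocalDiMA.rateConst Lf Lh σ σh G a b|) *
        LocalDiMA.rate (⟨Lf, Lh, σ, σh, ν⟩ : LocalDiMA.Constants).κ
          (LocalDiMA.mixingRate A) p.N K T := fun hG ht hβ => by
    refine (h.avgMeasure_le_rate hp hβ.le hz hs hT ha hab hG ht).trans ?_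
    refine mul_le_mul_of_nonneg_right ?_ (LocalDiMA.rate_nonneg
      (zero_le_one.trans h.one_le_κ) h.mixing.mixingRate_lt_one.le _ _ _)
    exact (le_abs_self _).trans (le_add_of_nonneg_left zero_le_one)
  refine ⟨fun i => (hint i).1.add (hint i).2,
    fun hβ => h.avgMeasure_le_explicitBound hp hβ.le hz hs hT, fun hG ht => ⟨hrate hG ht, ?_⟩⟩
  intro ε hε hN hTε
  obtain ⟨hβ, hle⟩ := h.rate_le hp ha hab (by positivity) hε ht hN hTε
  have havg := (hrate hG ht hβ).trans hle
  exact ⟨hβ, havg, h.exists_isGameStationary hp hs hT havg⟩
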